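/- **Setting.** Let $(\mathbb X,\mathcal X)$ be a measurable space with countably generated $\sigma$-field, $\lambda$ a reference measure, $M$ a Markov kernel on $\mathbb X$ with (jointly measurable) density $m$ with respect to $\lambda$, $\chi$ a probability measure and $(g_t)_{t\ge0}$ measurable functions on $\mathbb X$. For a bounded measurable $F$ on $\mathbb X^{T+1}$ put $$\phi_{0:T|T}[F]=\frac{\int\chi(dx_0)g_0(x_0)\prod_{u=1}^TM(x_{u-1},dx_u)g_u(x_u)\,F(x_{0:T})}{\int\chi(dx_0)g_0(x_0)\prod_{u=1}^TM(x_{u-1},dx_u)g_u(x_u)}.$$ Let $\rho_0$ be a probability measure with $\chi\ll\rho_0$ and, for $t\ge1$, let $\vartheta_t$ be measurable functions and $P_t$ Markov kernels with (jointly measurable) densities $p_t$ with respect to $\lambda$. Let $\omega_0=\frac{d\chi}{d\rho_0}g_0$ and $\omega_t(x,x')=\frac{m(x,x')g_t(x')}{\vartheta_t(x)p_t(x,x')}$ for $t\ge1$. *Forward pass with $N$ particles.* $\xi_0^1,\dots,\xi_0^N$ are i.i.d. with law $\rho_0$, with weights $\omega_0^\ell=\omega_0(\xi_0^\ell)$.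 For $t\ge1$, conditionally on $\mathcal F_{t-1}=\sigma\{(\xi_s^i,\omega_s^i):s\le t-1,\,1\le i\le N\}$, the pairs $(I_t^\ell,\xi_t^\ell)_{\ell=1}^N$ are i.i.d. on $\{1,\dots,N\}\times\mathbb X$ with law proportional to $\omega_{t-1}^{i}\vartheta_t(\xi_{t-1}^i)P_t(\xi_{t-1}^i,dx)$, and $\omega_t^\ell=\omega_t(\xi_{t-1}^{I_t^\ell},\xi_t^\ell)$. *Estimators.* Put $\Lambda_t(i,j)=\omega_t^jm(\xi_t^j,\xi_{t+1}^i)/\sum_\ell\omega_t^\ell m(\xi_t^\ell,\xi_{t+1}^i)$ and, for $j_{0:T}\in\{1,\dots,N\}^{T+1}$, $\pi(j_{0:T})=\frac{\omega_T^{j_T}}{\sum_\ell\omega_T^\ell}\prod_{u=1}^T\Lambda_{u-1}(j_u,j_{u-1})$. The FFBS estimator is $\phi^N_{0:T|T}[F]=\sum_{j_{0:T}}\pi(j_{0:T})F(\xi_0^{j_0},\dots,\xi_T^{j_T})$. The FFBSi estimator is $\widetilde\phi^N_{0:T|T}[F]=N^{-1}\sum_{\ell=1}^NF(\xi_0^{J_0^\ell},\dots,\xi_T^{J_T^\ell})$,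 where, conditionally on $\mathcal F_T$, the paths $J^1_{0:T},\dots,J^N_{0:T}$ are i.i.d. with law $\pi$. **Assumptions.** There are constants $0<\sigma_-<\sigma_+$, $c_->0$, $B_\vartheta$, $B_\omega$ such that: $\sigma_-\le m(x,x')\le\sigma_+$ for all $x,x'$; $\int g_0\,d\chi\ge c_-$ and $\int M(x,dx')g_t(x')\ge c_-$ for all $t\ge1$ and all $x$; $g_t>0$ for all $t\ge0$ and $\sup_{t\ge0}|g_t|_\infty<\infty$; $\sup_{t\ge1}|\vartheta_t|_\infty\le B_\vartheta$, $\sup_{t\ge1}|p_t|_\infty<\infty$ and $\sup_{t\ge0}|\omega_t|_\infty\le B_\omega$. The weights are well defined and positive: $\vartheta_t>0$ and $p_t>0$ for $t\ge1$, and $\frac{d\chi}{d\rho_0}>0$ $\rho_0$-almost everywhere. **Theorem.** There is a constant $C>0$ depending only on $\sigma_-,\sigma_+,c_-,B_\vartheta,B_\omega$ such that for all integers $T\ge0$, $N\ge1$, $r\ge0$, all $\varepsilon>0$ and all bounded measurable $h_s:\mathbb X^{r+1}\to\mathbb R$, $r\le s\le T$, with $S_{T,r}(x_{0:T})=\sum_{s=r}^Th_s(x_{s-r:s})$,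 $\operatorname{osc}(h)=\sup_{z,z'}|h(z)-h(z')|$ and $\Theta_{r,T}=(1+r)\{(1+r)\wedge(T-r+1)\}$, $$\mathbb P\left\{\left|\phi_{0:T|T}[S_{T,r}]-\phi^N_{0:T|T}[S_{T,r}]\right|>\varepsilon\right\}\le2\exp\left(-\frac{CN\varepsilon^2}{\Theta_{r,T}\sum_{s=r}^T\operatorname{osc}(h_s)^2}\right)+8\exp\left(-\frac{CN\varepsilon}{(1+r)\sum_{s=r}^T\operatorname{osc}(h_s)}\right)$$ and $$\mathbb P\left\{\left|\phi_{0:T|T}[S_{T,r}]-\widetilde\phi^N_{0:T|T}[S_{T,r}]\right|>\varepsilon\right\}\le4\exp\left(-\frac{CN\varepsilon^2}{\Theta_{r,T}\sum_{s=r}^T\operatorname{osc}(h_s)^2}\right)+8\exp\left(-\frac{CN\varepsilon}{(1+r)\sum_{s=r}^T\operatorname{osc}(h_s)}\right).$$ (If all $\operatorname{osc}(h_s)$ vanish, or $r>T$, quotients with denominator $0$ are read as $0$.) -/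

import Mathlib

open MeasureTheory ProbabilityTheory

universe u v

noncomputable section

/-- The oscillation `sup |h z - h z'|` of a (bounded) real function. -/
def osc {E : Type*} (h : E → ℝ) : ℝ := ⨆ z : E × E, |h z.1 - h z.2|

/-- A state-space model (initial law `χ`, Markov kernel `M` with density `m` with respect to a
reference measure `lam`, potentials `g t`), together with the ingredients of the auxiliary particle
filter: initial instrumental law `ρ₀`, adjustment multipliers `θ t` and proposal kernels `P t` with
densities `p t` with respect to `lam`.  Only `θ t`, `P t`, `p t` with `1 ≤ t` matter. -/
structure ParticleModel (X : Type u) [MeasurableSpace X] where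
  /-- the reference measure -/
  lam : Measure X
  /-- the initial distribution -/
  χ : Measure X
  prob_χ : IsProbabilityMeasure χ
  /-- the Markov transition kernel of the hidden chain -/
  M : Kernel X X
  markov_M : IsMarkovKernel M
  /-- the transition density -/
  m : X → X → ℝ
  measurable_m : Measurable (Function.uncurry m)
  m_nonneg : ∀ x x', 0 ≤ m x x'
  M_eq : ∀ x, M x = lam.withDensity (fun x' => ENNReal.ofReal (m x x'))
  /-- the potential functions -/
  g : ℕ → X → ℝ
  measurable_g : ∀ t, Measurable (g t)
  /-- the initial instrumental distribution -/
  ρ₀ : Measure X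
  prob_ρ₀ : IsProbabilityMeasure ρ₀
  /-- a version of the Radon-Nikodym derivative of `χ` with respect to `ρ₀` -/
  dχ : X → ℝ
  measurable_dχ : Measurable dχ
  dχ_nonneg : ∀ x, 0 ≤ dχ x
  χ_eq : χ = ρ₀.withDensity (fun x => ENNReal.ofReal (dχ x))
  /-- the adjustment multiplier functions -/
  θ : ℕ → X → ℝ
  measurable_θ : ∀ t, Measurable (θ t)
  /-- the proposal transition kernels -/
  P : ℕ → Kernel X X
  markov_P : ∀ t, 1 ≤ t → IsMarkovKernel (P t)
  /-- the proposal densities -/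
  p : ℕ → X → X → ℝ
  measurable_p : ∀ t, Measurable (Function.uncurry (p t))
  P_eq : ∀ t, 1 ≤ t → ∀ x, P t x = lam.withDensity (fun x' => ENNReal.ofReal (p t x x'))

namespace ParticleModel

variable {X : Type u} [MeasurableSpace X]

/-- The initial weight function `ω₀ = (dχ/dρ₀) g₀`. -/
def weightFun₀ (S : ParticleModel X) (x : X) : ℝ := S.dχ x * S.g 0 x

/-- The weight function `ω_t(x, x') = m(x, x') g_t(x') / (θ_t(x) p_t(x, x'))`, for `t ≥ 1`. -/
def weightFun (S : ParticleModel X) (t : ℕ) (x x' : X) : ℝ :=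
  S.m x x' * S.g t x' / (S.θ t x * S.p t x x')

/-- The standing assumptions: strong mixing, lower bounds on the one-step normalising constants,
positive bounded potentials, bounded algorithmic quantities.  The weights are well defined and
positive: `θ_t > 0` and `p_t > 0` for `t ≥ 1`, and `dχ/dρ₀ > 0` almost everywhere (so that almost
surely the weights of the initial particles are not all zero). -/
structure Assumptions (S : ParticleModel X) (σm σp cm Bθ Bω : ℝ) : Prop where
  mixing : ∀ x x', σm ≤ S.m x x' ∧ S.m x x' ≤ σp
  lower_zero : cm ≤ ∫ x, S.g 0 x ∂S.χ
  lower_succ : ∀ t, 1 ≤ t → ∀ x, cm ≤ ∫ x', S.g t x' ∂(S.M x)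
  g_pos : ∀ t x, 0 < S.g t x
  g_bdd : ∃ K : ℝ, ∀ t x, S.g t x ≤ K
  θ_pos : ∀ t, 1 ≤ t → ∀ x, 0 < S.θ t x
  θ_le : ∀ t, 1 ≤ t → ∀ x, S.θ t x ≤ Bθ
  p_pos : ∀ t, 1 ≤ t → ∀ x x', 0 < S.p t x x'
  p_bdd : ∃ K : ℝ, ∀ t, 1 ≤ t → ∀ x x', S.p t x x' ≤ K
  dχ_pos : ∀ᵐ x ∂S.ρ₀, 0 < S.dχ x
  weight_zero_le : ∀ x, S.weightFun₀ x ≤ Bω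
  weight_succ_le : ∀ t, 1 ≤ t → ∀ x x', S.weightFun t x x' ≤ Bω

/-! ### The smoothing distribution -/

/-- For a function `F` of the path and a path `x` (of which only `x 0, …, x t` are relevant):
`∫ M(x_t, dx_{t+1}) g_{t+1}(x_{t+1}) ⋯ M(x_{t+k-1}, dx_{t+k}) g_{t+k}(x_{t+k}) F(x)`. -/
def iterInt (S : ParticleModel X) (F : (ℕ → X) → ℝ) : ℕ → ℕ → (ℕ → X) → ℝ
  | _, 0, x => F x
  | t, k + 1, x =>
      ∫ y, S.g (t + 1) y * iterInt S F (t + 1) k (Function.update x (t + 1) y) ∂(S.M (x t))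

/-- The unnormalised smoothing functional
`∫ χ(dx_0) g_0(x_0) ∏_{u=1}^T M(x_{u-1}, dx_u) g_u(x_u) F(x_{0:T})`. -/
def unnormSmooth (S : ParticleModel X) (T : ℕ) (F : (Fin (T + 1) → X) → ℝ) : ℝ :=
  ∫ x₀, S.g 0 x₀ * S.iterInt (fun x => F (fun i => x i)) 0 T (fun _ => x₀) ∂S.χ

/-- The fixed-interval smoothing distribution `φ_{0:T|T}[F]`. -/
def smooth (S : ParticleModel X) (T : ℕ) (F : (Fin (T + 1) → X) → ℝ) : ℝ :=
  S.unnormSmooth T F / S.unnormSmooth T (fun _ => 1)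

/-! ### Weighted samples -/

variable {N : ℕ}

/-- The instrumental distribution on pairs (index, position) at time `t`, given the weights `w` and
the positions `x` of the particles at time `t - 1`: it is proportional to
`w ℓ * θ_t (x ℓ) * P_t (x ℓ, ·)`. -/
def instrumental (S : ParticleModel X) (t : ℕ) (w : Fin N → ℝ) (x : Fin N → X) :
    Measure (Fin N × X) :=
  ∑ ℓ, ENNReal.ofReal (w ℓ * S.θ t (x ℓ) / ∑ i, w i * S.θ t (x i)) •
    (Measure.dirac ℓ).prod (S.P t (x ℓ))

/-- The backward transition matrix `Λ_t(i, j)`, for weights `w s ℓ` and positions `x s ℓ`. -/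
def backMatrix (S : ParticleModel X) (w : ℕ → Fin N → ℝ) (x : ℕ → Fin N → X) (t : ℕ)
    (i j : Fin N) : ℝ :=
  w t j * S.m (x t j) (x (t + 1) i) / ∑ ℓ, w t ℓ * S.m (x t ℓ) (x (t + 1) i)

/-- The probability of the index path `j_{0:T}` under the backward Markov chain:
`(w_T^{j_T} / ∑ w_T) Λ_{T-1}(j_T, j_{T-1}) ⋯ Λ_0(j_1, j_0)`. -/
def pathProb (S : ParticleModel X) (T : ℕ) (w : ℕ → Fin N → ℝ) (x : ℕ → Fin N → X)
    (j : Fin (T + 1) → Fin N) : ℝ :=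
  w T (j (Fin.last T)) / (∑ ℓ, w T ℓ) * ∏ u : Fin T, S.backMatrix w x u (j u.succ) (j u.castSucc)

/-- The FFBS approximation `φ^N_{0:T|T}[F]` of the smoothing distribution. -/
def ffbs (S : ParticleModel X) (T : ℕ) (w : ℕ → Fin N → ℝ) (x : ℕ → Fin N → X)
    (F : (Fin (T + 1) → X) → ℝ) : ℝ :=
  ∑ j : Fin (T + 1) → Fin N, S.pathProb T w x j * F (fun u => x u (j u))

/-! ### The random particle system -/

variable {Ω : Type v} [MeasurableSpace Ω]

/-- The importance weights of the particles `ξ t ℓ` with ancestor indices `I t ℓ`. -/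
def weight (S : ParticleModel X) (ξ : ℕ → Fin N → Ω → X) (I : ℕ → Fin N → Ω → Fin N) :
    ℕ → Fin N → Ω → ℝ
  | 0, ℓ, ω => S.weightFun₀ (ξ 0 ℓ ω)
  | t + 1, ℓ, ω => S.weightFun (t + 1) (ξ t (I (t + 1) ℓ ω) ω) (ξ (t + 1) ℓ ω)

/-- The σ-field generated by the particles and the weights up to time `t`. -/
@[reducible] def history (S : ParticleModel X) (ξ : ℕ → Fin N → Ω → X) (I : ℕ → Fin N → Ω → Fin N) (t : ℕ) :
    MeasurableSpace Ω :=
  ⨆ (s : ℕ) (_ : s ≤ t) (i : Fin N),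
    MeasurableSpace.comap (fun ω => (ξ s i ω, S.weight ξ I s i ω)) inferInstance

/-- `ξ` (positions) and `I` (ancestor indices) are produced by the forward pass up to time `T` with
`N` particles: the initial particles are i.i.d. with law `ρ₀` and, for `t < T`, conditionally on the
particles and weights up to time `t`, the pairs `(I (t+1) ℓ, ξ (t+1) ℓ)` are i.i.d. in `ℓ` with
the instrumental distribution. -/
structure IsForwardPass (S : ParticleModel X) (T : ℕ) (μ : Measure Ω)
    (ξ : ℕ → Fin N → Ω → X) (I : ℕ → Fin N → Ω → Fin N) : Prop where
  measurable_ξ : ∀ t ℓ, Measurable (ξ t ℓ)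
  measurable_I : ∀ t ℓ, Measurable (I t ℓ)
  law_zero : ∀ B : Fin N → Set X, (∀ ℓ, MeasurableSet (B ℓ)) →
    μ {ω | ∀ ℓ, ξ 0 ℓ ω ∈ B ℓ} = ∏ ℓ, S.ρ₀ (B ℓ)
  law_succ : ∀ t, t < T → ∀ A : Set Ω, MeasurableSet[S.history ξ I t] A →
    ∀ B : Fin N → Set (Fin N × X), (∀ ℓ, MeasurableSet (B ℓ)) →
      μ (A ∩ {ω | ∀ ℓ, (I (t + 1) ℓ ω, ξ (t + 1) ℓ ω) ∈ B ℓ}) =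
        ∫⁻ ω in A, ∏ ℓ, S.instrumental (t + 1) (fun i => S.weight ξ I t i ω)
          (fun i => ξ t i ω) (B ℓ) ∂μ

/-- `J 0, …, J (N-1)` are the index paths of the backward simulation: conditionally on the
particles and weights up to time `T`, they are independent, each with the law `pathProb`. -/
structure IsBackwardSimulation (S : ParticleModel X) (T : ℕ) (μ : Measure Ω)
    (ξ : ℕ → Fin N → Ω → X) (I : ℕ → Fin N → Ω → Fin N)
    (J : Fin N → Ω → Fin (T + 1) → Fin N) : Prop where
  measurable_J : ∀ ℓ, Measurable (J ℓ)
  law : ∀ A : Set Ω, MeasurableSet[S.history ξ I T] A → ∀ j : Fin N → Fin (T + 1) → Fin N,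
    μ (A ∩ {ω | ∀ ℓ, J ℓ ω = j ℓ}) =
      ∫⁻ ω in A, ∏ ℓ, ENNReal.ofReal
        (S.pathProb T (fun s i => S.weight ξ I s i ω) (fun s i => ξ s i ω) (j ℓ)) ∂μ

/-- The FFBS estimator of `φ_{0:T|T}[F]`, as a random variable. -/
def ffbsEstimator (S : ParticleModel X) (T : ℕ) (ξ : ℕ → Fin N → Ω → X)
    (I : ℕ → Fin N → Ω → Fin N) (F : (Fin (T + 1) → X) → ℝ) (ω : Ω) : ℝ :=
  S.ffbs T (fun s i => S.weight ξ I s i ω) (fun s i => ξ s i ω) F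

end ParticleModel

/-- The FFBSi estimator `N⁻¹ ∑_ℓ F(ξ_0^{J_0^ℓ}, …, ξ_T^{J_T^ℓ})`. -/
def ffbsiEstimator {X : Type u} {Ω : Type v} {N : ℕ} (T : ℕ) (ξ : ℕ → Fin N → Ω → X)
    (J : Fin N → Ω → Fin (T + 1) → Fin N) (F : (Fin (T + 1) → X) → ℝ) (ω : Ω) : ℝ :=
  (N : ℝ)⁻¹ * ∑ ℓ, F (fun u => ξ u (J ℓ ω u) ω)

/-- The additive functional `S_{T,r}(x_{0:T}) = ∑_{t=r}^T h_t(x_{t-r:t})`; here `t = r + k`. -/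
def additiveFunctional {X : Type u} (T r : ℕ) (h : ℕ → (Fin (r + 1) → X) → ℝ)
    (x : Fin (T + 1) → X) : ℝ :=
  ∑ k : Fin (T + 1 - r), h (r + k) (fun i => x ⟨k + i, by omega⟩)

/-- `Θ_{r,T} = (1 + r) ((1 + r) ∧ (T - r + 1))`. -/
def bigTheta (r T : ℕ) : ℝ := (1 + (r : ℝ)) * min (1 + (r : ℝ)) ((T : ℝ) - r + 1)

end

/-! ### Exponential inequalities -/

/-! At each time `t` consider `hybrid`: the particles describe the path up to `t` through the
backward chain `back`, and the future is integrated out exactly by `iterInt`. At the final time this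
is the FFBS estimator, so its error telescopes into the error at time 0 and the increments from `t`
to `t + 1`.

Given the first generations, generation `t + 1` is i.i.d., and the hybrid at `t + 1` is a
self-normalised importance sampling estimator whose target is exactly the hybrid at `t`. The
exactness comes from `sum_integral_back`: the denominator of the backward weights is the density of
the weighted mixture of transition kernels, and it cancels. The weights are bounded above, and their
mean is bounded below, by constants that do not depend on the horizon (`iterInt_one_ratio`).

A ratio of empirical means has a bias of order 1/N, so the increments are not martingale
differences. `integral_exp_ratio_le` bounds the exponential moment at `l` by exp(K(l² + |l|)/N), the
linear term paying for the bias. An integrand of oscillation δ turns `l` into lδ, and successive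
conditioning adds the exponents (`lintegral_exp_hybrid_le`): the error behaves as if it had variance
∑δ_t²/N and bias ∑δ_t/N, up to constants.

The oscillations δ_t are controlled by strong mixing. The forward smoothing chain and the backward
particle chain both contract by ρ = 1 - σ₋/σ₊ per step (`fwd_contraction`, `back_contraction`), so
h_s contributes osc(h_s) ρ^d to δ_t, with d the distance from t to the window [s - r, s]
(`oscLE_back_fwd`). Summing the geometric series gives the two denominators of the theorem
(`sum_decayBound_sq_le`, `sum_decayBound_le`).

If ε exceeds twice the bias level, Chernoff's bound yields the Gaussian term; otherwise 8/e ≥ 1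
makes the second term trivial (`deviation_of_lintegral_exp`). Backward simulation adds an average of
N conditionally i.i.d. paths, which multiplies the exponential moment by a factor exp(l²∑δ_t²/N)
with the same bounds on the oscillations (`lintegral_exp_ffbsi_le`). -/

lemma exp_le_self_add_exp_sq (y : ℝ) : Real.exp y ≤ y + Real.exp (y ^ 2) := by
  have h2 : y ^ 2 + 1 ≤ Real.exp (y ^ 2) := Real.add_one_le_exp _
  rcases le_total |y| 1 with h | h
  · have h1 := abs_le.mp (Real.abs_exp_sub_one_sub_id_le h)
    linarith [h1.2]
  · rcases le_abs.mp h with h | h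
    · have : Real.exp y ≤ Real.exp (y ^ 2) := Real.exp_le_exp.mpr (by nlinarith)
      linarith
    · have : Real.exp y ≤ 1 := Real.exp_le_one_iff.mpr (by linarith)
      nlinarith

lemma exp_mul_le_of_mem_unit {s y : ℝ} (h0 : 0 ≤ s) (h1 : s ≤ 1) :
    Real.exp (s * y) ≤ 1 + s * (Real.exp y - 1) := by
  have := convexOn_exp.2 (Set.mem_univ (0 : ℝ)) (Set.mem_univ y) (sub_nonneg.mpr h1) h0 (by ring)
  simp only [smul_eq_mul, mul_zero, zero_add, Real.exp_zero, mul_one] at this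
  linarith

lemma integrable_of_abs_le {E : Type*} [MeasurableSpace E] {ν : Measure E} [IsFiniteMeasure ν]
    {f : E → ℝ} (hf : Measurable f) {C : ℝ} (h : ∀ z, |f z| ≤ C) : Integrable f ν :=
  Integrable.of_bound hf.aestronglyMeasurable C (ae_of_all _ fun z => by simpa using h z)

/-- Integrating `exp_le_self_add_exp_sq` kills the linear term for a centred function; the result is
Hoeffding's lemma with a cruder constant. -/
lemma integral_exp_mul_le {E : Type*} [MeasurableSpace E] {ν : Measure E} [IsProbabilityMeasure ν]
    {f : E → ℝ} (hf : Measurable f) {B : ℝ} (hB : ∀ z, |f z| ≤ B) (h0 : ∫ z, f z ∂ν = 0) (s : ℝ) :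
    ∫ z, Real.exp (s * f z) ∂ν ≤ Real.exp (s ^ 2 * B ^ 2) := by
  have hsq : ∀ z, (s * f z) ^ 2 ≤ s ^ 2 * B ^ 2 := fun z => by
    rw [mul_pow]
    exact mul_le_mul_of_nonneg_left (sq_le_sq.mpr ((hB z).trans (le_abs_self B))) (sq_nonneg s)
  have habs : ∀ z, |s * f z| ≤ |s| * B := fun z => by
    rw [abs_mul]; exact mul_le_mul_of_nonneg_left (hB z) (abs_nonneg s)
  have hi1 : Integrable (fun z => s * f z) ν :=
    integrable_of_abs_le (hf.const_mul s) habs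
  have hi2 : Integrable (fun z => Real.exp (s * f z)) ν :=
    integrable_of_abs_le (C := Real.exp (|s| * B)) (by fun_prop) fun z => by
      rw [Real.abs_exp]
      exact Real.exp_le_exp.mpr ((le_abs_self _).trans (habs z))
  calc ∫ z, Real.exp (s * f z) ∂ν ≤ ∫ z, (s * f z + Real.exp (s ^ 2 * B ^ 2)) ∂ν := by
        refine integral_mono hi2 (hi1.add (integrable_const _)) fun z => ?_
        exact (exp_le_self_add_exp_sq _).trans
          (add_le_add le_rfl (Real.exp_le_exp.mpr (hsq z)))
    _ = Real.exp (s ^ 2 * B ^ 2) := by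
        rw [integral_add hi1 (integrable_const _), integral_const_mul, h0]; simp

lemma lintegral_gaussian_exp_sq_div_four :
    ∫⁻ x, ENNReal.ofReal (Real.exp (x ^ 2 / 4)) ∂(gaussianReal 0 1) ≤ 2 := by
  rw [gaussianReal_of_var_ne_zero _ one_ne_zero,
    lintegral_withDensity_eq_lintegral_mul _ (measurable_gaussianPDF _ _) (by fun_prop)]
  have : ∀ x : ℝ, (gaussianPDF 0 1 * fun x => ENNReal.ofReal (Real.exp (x ^ 2 / 4))) x =
      ENNReal.ofReal ((√(2 * Real.pi))⁻¹ * Real.exp (-(1 / 4) * x ^ 2)) := by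
    intro x
    simp only [Pi.mul_apply, gaussianPDF, gaussianPDFReal]
    rw [← ENNReal.ofReal_mul (by positivity)]
    congr 1
    simp only [NNReal.coe_one, mul_one, sub_zero]
    rw [mul_assoc, ← Real.exp_add]
    congr 2; ring
  simp_rw [this]
  rw [← ofReal_integral_eq_lintegral_ofReal, integral_const_mul, integral_gaussian]
  · rw [show (2 : ENNReal) = ENNReal.ofReal 2 by simp]
    apply ENNReal.ofReal_le_ofReal
    rw [← Real.sqrt_inv, ← Real.sqrt_mul (by positivity)]
    refine Real.sqrt_le_iff.mpr ⟨by norm_num, ?_⟩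
    have := Real.pi_pos
    field_simp
    norm_num
  · exact (integrable_exp_neg_mul_sq (by norm_num)).const_mul _
  · exact ae_of_all _ fun x => by positivity

/-- Gaussian linearisation: exp(y²/2) is the average of exp(yx) over a standard Gaussian x. After
Fubini the exponential of the sum factorises over the i.i.d. coordinates and each factor is
sub-Gaussian. -/
lemma integral_exp_sq_sum_le {E : Type*} [MeasurableSpace E] {ν : Measure E}
    [IsProbabilityMeasure ν] {f : E → ℝ} (hf : Measurable f) {B : ℝ} (hB0 : 0 < B)
    (hB : ∀ z, |f z| ≤ B) (h0 : ∫ z, f z ∂ν = 0) {N : ℕ} (hN : 1 ≤ N) :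
    ∫ z, Real.exp ((∑ i : Fin N, f (z i)) ^ 2 / (8 * B ^ 2 * N)) ∂(Measure.pi fun _ => ν) ≤ 2 := by
  have hNpos : (0 : ℝ) < N := by exact_mod_cast hN
  -- Here s²/2 is the coefficient 1/(8B²N) of the squared sum, and the N sub-Gaussian factors
  -- multiply to exp(N s²x²B²) = exp(x²/4), whose Gaussian integral is √2.
  set s : ℝ := 1 / (2 * B * √N) with hs
  have hs2 : s ^ 2 = 1 / (4 * B ^ 2 * N) := by
    rw [hs, div_pow, mul_pow, mul_pow, Real.sq_sqrt hNpos.le]; norm_num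
  have hmeas : Measurable fun z : Fin N → E => ∑ i, f (z i) := by fun_prop
  have key : ∀ z : Fin N → E, ENNReal.ofReal
      (Real.exp ((∑ i : Fin N, f (z i)) ^ 2 / (8 * B ^ 2 * N))) =
      ∫⁻ x, ENNReal.ofReal (Real.exp (s * (∑ i, f (z i)) * x)) ∂(gaussianReal 0 1) := by
    intro z
    have h1 := mgf_gaussianReal (p := gaussianReal 0 1) (X := id) (μ := 0) (v := 1) (by simp)
      (s * ∑ i, f (z i))
    rw [mgf] at h1
    rw [← ofReal_integral_eq_lintegral_ofReal]
    · simp only [id] at h1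
      rw [h1]
      congr 2
      simp only [NNReal.coe_one, one_mul, zero_mul, zero_add]
      rw [mul_pow, hs2]; field_simp; ring
    · exact integrable_exp_mul_gaussianReal _
    · exact ae_of_all _ fun x => by positivity
  rw [integral_eq_lintegral_of_nonneg_ae (ae_of_all _ fun z => by positivity)
    (by measurability : Measurable _).aestronglyMeasurable]
  refine ENNReal.toReal_le_of_le_ofReal (by norm_num) ?_
  simp_rw [key]
  rw [lintegral_lintegral_swap (by fun_prop)]
  refine le_trans (lintegral_mono fun x => ?_)
    (lintegral_gaussian_exp_sq_div_four.trans (by simp))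
  have h2 : ∀ z : Fin N → E, Real.exp (s * (∑ i, f (z i)) * x) =
      ∏ i, Real.exp ((s * x) * f (z i)) := by
    intro z
    rw [← Real.exp_sum, ← Finset.mul_sum]; congr 1; ring
  have h3 : Integrable (fun z => Real.exp ((s * x) * f z)) ν :=
    integrable_of_abs_le (C := Real.exp (|s * x| * B)) (by fun_prop) fun z => by
      rw [Real.abs_exp]
      refine Real.exp_le_exp.mpr ((le_abs_self _).trans ?_)
      rw [abs_mul]; exact mul_le_mul_of_nonneg_left (hB z) (abs_nonneg _)
  simp_rw [h2]
  rw [← ofReal_integral_eq_lintegral_ofReal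
    (Integrable.fintype_prod (f := fun _ z => Real.exp ((s * x) * f z)) fun _ => h3)
    (ae_of_all _ fun x => by positivity),
    integral_fintype_prod_eq_pow (fun z => Real.exp ((s * x) * f z))]
  refine ENNReal.ofReal_le_ofReal ?_
  refine (pow_le_pow_left₀ (integral_nonneg fun z => by positivity)
    (integral_exp_mul_le hf hB h0 (s * x)) _).trans ?_
  rw [← Real.exp_nat_mul]
  refine Real.exp_le_exp.mpr (le_of_eq ?_)
  rw [Fintype.card_fin, mul_pow, hs2]; field_simp

/-- Exponential moments of a self-normalised sum of centred i.i.d. terms. -/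
lemma integral_exp_ratio_le {E : Type*} [MeasurableSpace E] {ν : Measure E}
    [IsProbabilityMeasure ν] {a b : E → ℝ} (ha : Measurable a) (hb : Measurable b)
    {B β₀ : ℝ} (hβ₀ : 0 < β₀) (hab : ∀ z, |a z| ≤ b z) (hbB : ∀ z, b z ≤ B)
    (h0 : ∫ z, a z ∂ν = 0) (hβ : β₀ ≤ ∫ z, b z ∂ν) {N : ℕ} (hN : 1 ≤ N) (l : ℝ) :
    ∫ z, Real.exp (l * ((∑ i : Fin N, a (z i)) / ∑ i, b (z i))) ∂(Measure.pi fun _ => ν) ≤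
      Real.exp (128 * B ^ 2 / β₀ ^ 2 * (l ^ 2 + |l|) / N) := by
  have hNpos : (0 : ℝ) < N := by exact_mod_cast hN
  set β := ∫ z, b z ∂ν with hβdef
  have hβpos : 0 < β := hβ₀.trans_le hβ
  have hb0 : ∀ z, 0 ≤ b z := fun z => (abs_nonneg _).trans (hab z)
  have hbi : Integrable b ν := integrable_of_abs_le hb fun z => by
    rw [abs_of_nonneg (hb0 z)]; exact hbB z
  have hβB : β ≤ B := by
    calc β ≤ ∫ _, B ∂ν := integral_mono hbi (integrable_const _) hbB
      _ = B := by simp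
  have hBpos : 0 < B := hβpos.trans_le hβB
  set U : (Fin N → E) → ℝ := fun z => ∑ i, a (z i) with hU
  set V : (Fin N → E) → ℝ := fun z => ∑ i, (b (z i) - β) with hV
  set X : (Fin N → E) → ℝ := fun z => (∑ i, a (z i)) / ∑ i, b (z i) with hX
  -- W is the average of the two exponents to which `integral_exp_sq_sum_le` applies, so by
  -- convexity exp W has mean at most 2. It dominates both X² and |XV|.
  set W : (Fin N → E) → ℝ := fun z => (U z ^ 2 + V z ^ 2) / (16 * B ^ 2 * N) with hW
  have hUm : Measurable U := by fun_prop
  have hVm : Measurable V := by fun_prop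
  have hXm : Measurable X := by fun_prop
  have hWm : Measurable W := by fun_prop
  have hsum : ∀ z : Fin N → E, ∑ i, b (z i) = V z + N * β := fun z => by
    simp [hV, Finset.sum_sub_distrib]
  have hUb : ∀ z, |U z| ≤ ∑ i, b (z i) := fun z =>
    (Finset.abs_sum_le_sum_abs _ _).trans (Finset.sum_le_sum fun i _ => hab _)
  have hX1 : ∀ z, |X z| ≤ 1 := fun z => by
    have hs : 0 ≤ ∑ i, b (z i) := (abs_nonneg _).trans (hUb z)
    simp only [hX]
    rw [abs_div, abs_of_nonneg hs]
    exact div_le_one_of_le₀ (hUb z) hs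
  have hXU : ∀ z, X z * (V z + N * β) = U z := fun z => by
    rw [← hsum]
    -- A vanishing denominator forces a vanishing numerator, since |a| ≤ b, so the identity survives
    -- the convention for division by zero.
    by_cases hs : ∑ i, b (z i) = 0
    · have := hUb z
      rw [hs] at this ⊢
      rw [mul_zero, abs_nonpos_iff.mp this]
    · simp only [hX, hU]; field_simp
  have hbβ : ∀ z, |b z - β| ≤ B := fun z => by
    rw [abs_le]; constructor <;> linarith [hb0 z, hbB z]
  have haB : ∀ z, |a z| ≤ B := fun z => (hab z).trans (hbB z)
  have hUB : ∀ z, |U z| ≤ N * B := fun z => by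
    refine (Finset.abs_sum_le_sum_abs _ _).trans ((Finset.sum_le_sum fun i _ => haB _).trans ?_)
    simp
  have hVB : ∀ z, |V z| ≤ N * B := fun z => by
    refine (Finset.abs_sum_le_sum_abs _ _).trans ((Finset.sum_le_sum fun i _ => hbβ _).trans ?_)
    simp
  -- the ratio is controlled by the two centred sums
  have hmax : ∀ z, N * β * |X z| ≤ 2 * max |U z| |V z| := fun z => by
    -- Either the denominator is at least half its mean and the numerator controls X, or the
    -- denominator deviates by at least Nβ/2 and |X| ≤ 1 suffices.
    rcases le_total (N * β / 2) (V z + N * β) with h | h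
    · have h2 : |X z| * (N * β / 2) ≤ |U z| := by
        rw [← hXU z, abs_mul]
        exact mul_le_mul_of_nonneg_left (h.trans (le_abs_self _)) (abs_nonneg _)
      linarith [le_max_left |U z| |V z|]
    · have h2 : N * β / 2 ≤ |V z| := by
        have := neg_abs_le (V z); linarith
      have h3 : N * β * |X z| ≤ N * β * 1 :=
        mul_le_mul_of_nonneg_left (hX1 z) (by positivity)
      linarith [le_max_right |U z| |V z|]
  have hmaxsq : ∀ z, max |U z| |V z| ^ 2 ≤ U z ^ 2 + V z ^ 2 := fun z => by
    rcases max_choice |U z| |V z| with h | h <;> rw [h, sq_abs] <;> nlinarith [sq_nonneg (U z), sq_nonneg (V z)]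
  set D : ℝ := 64 * B ^ 2 / (β ^ 2 * N) with hD
  have hDpos : 0 < D := by positivity
  have hWeq : ∀ z, U z ^ 2 + V z ^ 2 = 16 * B ^ 2 * N * W z := fun z => by
    simp only [hW]; field_simp
  have hXsq : ∀ z, X z ^ 2 ≤ D * W z := fun z => by
    have h1 : (N * β * |X z|) ^ 2 ≤ 4 * (U z ^ 2 + V z ^ 2) := by
      have := pow_le_pow_left₀ (by positivity) (hmax z) 2
      nlinarith [hmaxsq z]
    rw [mul_pow, sq_abs, hWeq] at h1
    have : D * W z = 4 * (16 * B ^ 2 * N * W z) / (N * β) ^ 2 := by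
      rw [hD]; field_simp; ring
    rw [this, le_div_iff₀ (by positivity)]
    linarith
  have hXV : ∀ z, |X z * V z| ≤ N * β * (D / 2 * W z) := fun z => by
    have h1 : N * β * |X z| * |V z| ≤ 2 * (U z ^ 2 + V z ^ 2) := by
      have h2 := mul_le_mul (hmax z) (le_max_right |U z| |V z|) (abs_nonneg _) (by positivity)
      nlinarith [hmaxsq z]
    rw [hWeq] at h1
    have : N * β * (D / 2 * W z) = 2 * (16 * B ^ 2 * N * W z) / (N * β) := by
      rw [hD]; field_simp; ring
    rw [this, le_div_iff₀ (by positivity), abs_mul]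
    linarith
  have hW0 : ∀ z, 0 ≤ W z := fun z => by positivity
  -- exponential moment of W
  have hWB : ∀ z, W z ≤ N := fun z => by
    have h1 := sq_le_sq' (neg_le_of_abs_le (hUB z)) (le_of_abs_le (hUB z))
    have h2 := sq_le_sq' (neg_le_of_abs_le (hVB z)) (le_of_abs_le (hVB z))
    simp only [hW]
    rw [div_le_iff₀ (by positivity)]
    nlinarith [mul_pos hNpos hNpos, sq_nonneg ((N : ℝ) * B)]
  have hexpi : ∀ f : (Fin N → E) → ℝ, Measurable f → (∃ C, ∀ z, f z ≤ C) →
      Integrable (fun z => Real.exp (f z)) (Measure.pi fun _ => ν) := fun f hf ⟨C, hC⟩ =>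
    integrable_of_abs_le (C := Real.exp C) (by fun_prop) fun z => by
      rw [Real.abs_exp]; exact Real.exp_le_exp.mpr (hC z)
  have hWi : Integrable W (Measure.pi fun _ => ν) := integrable_of_abs_le (C := N) hWm fun z => by
    rw [abs_of_nonneg (hW0 z)]; exact hWB z
  have hexpW := hexpi W hWm ⟨N, hWB⟩
  have hdb : ∀ f : (Fin N → E) → ℝ, (∀ z, |f z| ≤ N * B) →
      ∃ C, ∀ z, f z ^ 2 / (8 * B ^ 2 * N) ≤ C := fun f hf =>
    ⟨(N * B) ^ 2 / (8 * B ^ 2 * N), fun z => by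
      gcongr ?_ / _
      exact sq_le_sq' (neg_le_of_abs_le (hf z)) (le_of_abs_le (hf z))⟩
  have hEW : ∫ z, Real.exp (W z) ∂(Measure.pi fun _ => ν) ≤ 2 := by
    have hp := integral_exp_sq_sum_le ha hBpos haB h0 hN
    have hq := integral_exp_sq_sum_le (f := fun z => b z - β) (hb.sub_const β) hBpos hbβ
      (by rw [integral_sub hbi (integrable_const _)]; simp [hβdef]) hN
    have hpi := hexpi (fun z => U z ^ 2 / (8 * B ^ 2 * N)) (by fun_prop) (hdb U hUB)
    have hqi := hexpi (fun z => V z ^ 2 / (8 * B ^ 2 * N)) (by fun_prop) (hdb V hVB)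
    calc ∫ z, Real.exp (W z) ∂(Measure.pi fun _ => ν)
        ≤ ∫ z, (Real.exp (U z ^ 2 / (8 * B ^ 2 * N)) / 2 +
            Real.exp (V z ^ 2 / (8 * B ^ 2 * N)) / 2) ∂(Measure.pi fun _ => ν) := by
          refine integral_mono hexpW ((hpi.div_const 2).add (hqi.div_const 2)) fun z => ?_
          have := convexOn_exp.2 (Set.mem_univ (U z ^ 2 / (8 * B ^ 2 * N)))
            (Set.mem_univ (V z ^ 2 / (8 * B ^ 2 * N))) (by norm_num : (0 : ℝ) ≤ 1 / 2)
            (by norm_num : (0 : ℝ) ≤ 1 / 2) (by norm_num)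
          simp only [smul_eq_mul] at this
          have h2 : W z = 1 / 2 * (U z ^ 2 / (8 * B ^ 2 * N)) +
              1 / 2 * (V z ^ 2 / (8 * B ^ 2 * N)) := by
            simp only [hW]; field_simp; ring
          simp only [h2]
          linarith
      _ ≤ 2 := by
          rw [integral_add (hpi.div_const 2) (hqi.div_const 2), integral_div, integral_div]
          linarith
  have hEW1 : ∫ z, W z ∂(Measure.pi fun _ => ν) ≤ 1 := by
    have : ∫ z, (W z + 1) ∂(Measure.pi fun _ => ν) ≤ 2 :=
      (integral_mono (hWi.add (integrable_const _)) hexpW fun z => Real.add_one_le_exp _).trans hEW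
    rw [integral_add hWi (integrable_const _)] at this
    simp at this; linarith
  -- the bias
  have hXi : Integrable X (Measure.pi fun _ => ν) := integrable_of_abs_le hXm hX1
  have hVi : Integrable (fun z => X z * V z) (Measure.pi fun _ => ν) :=
    integrable_of_abs_le (C := 1 * (N * B)) (hXm.mul hVm) fun z => by
      rw [abs_mul]
      exact mul_le_mul (hX1 z) (hVB z) (abs_nonneg _) zero_le_one
  have hEU : ∫ z, U z ∂(Measure.pi fun _ => ν) = 0 := by
    simp only [hU]
    rw [integral_finsetSum]
    · refine Finset.sum_eq_zero fun i _ => ?_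
      rw [← h0]
      rw [← (measurePreserving_eval (fun _ : Fin N => ν) i).map_eq,
        integral_map (measurable_pi_apply i).aemeasurable ha.aestronglyMeasurable]
      simp [(measurePreserving_eval (fun _ : Fin N => ν) i).map_eq]
    · intro i _
      exact integrable_of_abs_le (by fun_prop) fun z => haB (z i)
  have hbias : |∫ z, X z ∂(Measure.pi fun _ => ν)| ≤ D / 2 := by
    -- The numerator is centred, so the mean of X comes only from its correlation with the
    -- fluctuation V of the denominator, a product of two terms that are both small.
    have h1 : N * β * ∫ z, X z ∂(Measure.pi fun _ => ν) =
        -∫ z, X z * V z ∂(Measure.pi fun _ => ν) := by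
      have : ∫ z, (X z * V z + N * β * X z) ∂(Measure.pi fun _ => ν) = 0 := by
        rw [← hEU]; congr 1; ext z; rw [← hXU z]; ring
      rw [integral_add hVi (hXi.const_mul _), integral_const_mul] at this
      linarith
    have h2 : |∫ z, X z * V z ∂(Measure.pi fun _ => ν)| ≤ N * β * (D / 2) := by
      refine (abs_integral_le_integral_abs).trans ?_
      refine (integral_mono hVi.abs ((hWi.const_mul (D / 2)).const_mul (N * β)) hXV).trans ?_
      rw [integral_const_mul, integral_const_mul]
      have : D / 2 * ∫ z, W z ∂(Measure.pi fun _ => ν) ≤ D / 2 * 1 :=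
        mul_le_mul_of_nonneg_left hEW1 (by positivity)
      rw [mul_one] at this
      exact mul_le_mul_of_nonneg_left this (by positivity)
    rw [← abs_neg, ← h1, abs_mul, abs_of_pos (by positivity)] at h2
    exact le_of_mul_le_mul_left h2 (by positivity)
  -- conclusion
  have hmain : ∫ z, Real.exp (l * X z) ∂(Measure.pi fun _ => ν) ≤
      Real.exp (2 * D * (l ^ 2 + |l|)) := by
    have hexpX := hexpi (fun z => l * X z) (by fun_prop) ⟨|l|, fun z => by
      refine (le_abs_self _).trans ?_
      rw [abs_mul]; exact mul_le_of_le_one_right (abs_nonneg _) (hX1 z)⟩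
    -- For small l, exp(l²X²) ≤ exp(l²D W) is interpolated linearly between 1 and exp W. For large
    -- l, lX ≤ l²D/4 + W, and the factor 2 bounding the mean of exp W is absorbed in exp(l²D).
    rcases le_total (l ^ 2 * D) 1 with hs | hs
    · have h1 : ∀ z, Real.exp (l * X z) ≤
          l * X z + ((1 - l ^ 2 * D) + l ^ 2 * D * Real.exp (W z)) := fun z => by
        refine (exp_le_self_add_exp_sq _).trans (add_le_add le_rfl ?_)
        have h2 := exp_mul_le_of_mem_unit (y := W z) (by positivity) hs
        refine le_trans (Real.exp_le_exp.mpr ?_) (h2.trans (le_of_eq (by ring)))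
        rw [mul_pow, mul_assoc]
        exact mul_le_mul_of_nonneg_left (hXsq z) (sq_nonneg _)
      have hi1 := hXi.const_mul l
      have hi2 := hexpW.const_mul (l ^ 2 * D)
      have hi3 : Integrable (fun z => (1 - l ^ 2 * D) + l ^ 2 * D * Real.exp (W z))
        (Measure.pi fun _ => ν) := (integrable_const _).add hi2
      refine (integral_mono hexpX (hi1.add hi3) h1).trans ?_
      change ∫ z, (l * X z + ((1 - l ^ 2 * D) + l ^ 2 * D * Real.exp (W z)))
        ∂(Measure.pi fun _ => ν) ≤ _
      rw [integral_add hi1 hi3, integral_add (integrable_const _) hi2, integral_const_mul,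
        integral_const_mul]
      simp only [integral_const, probReal_univ, smul_eq_mul, one_mul]
      have h2 : l * ∫ z, X z ∂(Measure.pi fun _ => ν) ≤ |l| * (D / 2) := by
        refine (le_abs_self _).trans ?_
        rw [abs_mul]; exact mul_le_mul_of_nonneg_left hbias (abs_nonneg _)
      have h3 : l ^ 2 * D * ∫ z, Real.exp (W z) ∂(Measure.pi fun _ => ν) ≤ l ^ 2 * D * 2 :=
        mul_le_mul_of_nonneg_left hEW (by positivity)
      refine le_trans ?_ (Real.add_one_le_exp _)
      have : 0 ≤ |l| * D := by positivity
      have : 0 ≤ l ^ 2 * D := by positivity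
      linarith
    · have h1 : ∀ z, Real.exp (l * X z) ≤ Real.exp (l ^ 2 * D / 4) * Real.exp (W z) := fun z => by
        rw [← Real.exp_add]
        refine Real.exp_le_exp.mpr (abs_le_of_sq_le_sq' ?_ ?_).2
        · rw [mul_pow]
          have := mul_le_mul_of_nonneg_left (hXsq z) (sq_nonneg l)
          nlinarith [sq_nonneg (l ^ 2 * D / 4 - W z)]
        · have := hW0 z
          positivity
      refine (integral_mono hexpX (hexpW.const_mul _) h1).trans ?_
      rw [integral_const_mul]
      have h2 : (2 : ℝ) ≤ Real.exp (l ^ 2 * D) := by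
        linarith [Real.add_one_le_exp (l ^ 2 * D)]
      refine (mul_le_mul_of_nonneg_left (hEW.trans h2) (by positivity)).trans ?_
      rw [← Real.exp_add]
      refine Real.exp_le_exp.mpr ?_
      have : 0 ≤ |l| * D := by positivity
      linarith
  refine hmain.trans (Real.exp_le_exp.mpr ?_)
  have h1 : 2 * D * (l ^ 2 + |l|) = 128 * B ^ 2 / β ^ 2 * (l ^ 2 + |l|) / N := by
    rw [hD]; field_simp; ring
  rw [h1]
  gcongr

/-! ### Oscillations, and importance sampling of functions with bounded oscillation. -/

/-- The oscillation of `f` is at most `D`. -/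
def OscLE {α : Type*} (f : α → ℝ) (D : ℝ) : Prop := ∀ x y, f x - f y ≤ D

namespace OscLE

variable {α β : Type*} {f g : α → ℝ} {D D' : ℝ}

lemma mono (h : OscLE f D) (hD : D ≤ D') : OscLE f D' := fun x y => (h x y).trans hD

lemma comp (h : OscLE f D) (φ : β → α) : OscLE (fun z => f (φ z)) D := fun _ _ => h _ _

lemma nonneg [Nonempty α] (h : OscLE f D) : 0 ≤ D := by
  have := h (Classical.arbitrary α) (Classical.arbitrary α)
  linarith

lemma sum {ι : Type*} {s : Finset ι} {f : ι → α → ℝ} {D : ι → ℝ}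
    (h : ∀ i ∈ s, OscLE (f i) (D i)) : OscLE (fun x => ∑ i ∈ s, f i x) (∑ i ∈ s, D i) :=
  fun x y => by
    rw [← Finset.sum_sub_distrib]
    exact Finset.sum_le_sum fun i hi => h i hi x y

lemma exists_range (h : OscLE f D) : ∃ c, ∀ x, c ≤ f x ∧ f x ≤ c + D := by
  rcases isEmpty_or_nonempty α with hα | hα
  · exact ⟨0, fun x => (hα.false x).elim⟩
  have hbdd : BddBelow (Set.range f) := by
    refine ⟨f (Classical.arbitrary α) - D, ?_⟩
    rintro _ ⟨x, rfl⟩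
    have := h (Classical.arbitrary α) x
    linarith
  refine ⟨⨅ x, f x, fun x => ⟨ciInf_le hbdd x, ?_⟩⟩
  have : f x - D ≤ ⨅ y, f y := le_ciInf fun y => by linarith [h x y]
  linarith

lemma of_range {c : ℝ} (h : ∀ x, c ≤ f x ∧ f x ≤ c + D) : OscLE f D := fun x y => by
  linarith [(h x).2, (h y).1]

end OscLE

lemma abs_sub_le_osc {E : Type*} {h : E → ℝ} (hb : ∃ K : ℝ, ∀ z, |h z| ≤ K) (x y : E) :
    |h x - h y| ≤ osc h := by
  obtain ⟨K, hK⟩ := hb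
  refine le_ciSup (f := fun z : E × E => |h z.1 - h z.2|) ⟨K + K, ?_⟩ (x, y)
  rintro _ ⟨z, rfl⟩
  exact (abs_sub _ _).trans (add_le_add (hK _) (hK _))

lemma oscLE_osc {E : Type*} {h : E → ℝ} (hb : ∃ K : ℝ, ∀ z, |h z| ≤ K) : OscLE h (osc h) :=
  fun x y => (le_abs_self _).trans (abs_sub_le_osc hb x y)

lemma osc_nonneg {E : Type*} (h : E → ℝ) : 0 ≤ osc h :=
  Real.iSup_nonneg fun _ => abs_nonneg _

/-- Exponential moments of an importance sampling estimator. -/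
lemma lintegral_exp_weighted_mean_le {E : Type*} [MeasurableSpace E] {ν : Measure E}
    [IsProbabilityMeasure ν] {b R : E → ℝ} (hb : Measurable b) (hR : Measurable R)
    {B β₀ c δ : ℝ} (hβ₀ : 0 < β₀) (hb0 : ∀ z, 0 ≤ b z) (hbpos : ∀ᵐ z ∂ν, 0 < b z)
    (hbB : ∀ z, b z ≤ B) (hβ : β₀ ≤ ∫ z, b z ∂ν) (hRc : ∀ z, c ≤ R z ∧ R z ≤ c + δ)
    {N : ℕ} (hN : 1 ≤ N) (l : ℝ) :
    ∫⁻ z, ENNReal.ofReal (Real.exp (l * ((∑ i : Fin N, b (z i) * R (z i)) / (∑ i, b (z i)) -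
        (∫ z, b z * R z ∂ν) / ∫ z, b z ∂ν))) ∂(Measure.pi fun _ => ν) ≤
      ENNReal.ofReal (Real.exp (128 * B ^ 2 / β₀ ^ 2 * ((l * δ) ^ 2 + |l * δ|) / N)) := by
  set Q := (∫ z, b z * R z ∂ν) / ∫ z, b z ∂ν with hQ
  have hβpos := hβ₀.trans_le hβ
  have hbi : Integrable b ν := integrable_of_abs_le hb fun z => by
    rw [abs_of_nonneg (hb0 z)]; exact hbB z
  have hbRi : Integrable (fun z => b z * R z) ν := by
    refine hbi.mul_bdd hR.aestronglyMeasurable (c := |c| + |δ|) (ae_of_all _ fun z => ?_)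
    rw [Real.norm_eq_abs, abs_le]
    constructor
    · linarith [(hRc z).1, neg_abs_le c, abs_nonneg δ]
    · linarith [(hRc z).2, le_abs_self c, le_abs_self δ]
  have hQ1 : c ≤ Q := by
    rw [hQ, le_div_iff₀ hβpos, ← integral_const_mul]
    refine integral_mono (hbi.const_mul c) hbRi fun z => ?_
    simp only
    rw [mul_comm]; exact mul_le_mul_of_nonneg_left (hRc z).1 (hb0 z)
  have hQ2 : Q ≤ c + δ := by
    rw [hQ, div_le_iff₀ hβpos, ← integral_const_mul]
    refine integral_mono hbRi (hbi.const_mul _) fun z => ?_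
    simp only
    rw [mul_comm (c + δ)]; exact mul_le_mul_of_nonneg_left (hRc z).2 (hb0 z)
  have hRQ : ∀ z, |R z - Q| ≤ δ := fun z => by
    rw [abs_le]; constructor <;> linarith [(hRc z).1, (hRc z).2]
  -- Centring at the target Q and dividing by δ gives |a| ≤ b and mean zero. The case δ = 0 is
  -- harmless: then R = Q and a = 0.
  set a : E → ℝ := fun z => b z * ((R z - Q) / δ) with ha
  have hδ : 0 ≤ δ := by linarith
  have haδ : ∀ z, δ * a z = b z * R z - b z * Q := fun z => by
    rcases eq_or_lt_of_le hδ with h | h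
    · have := hRQ z
      rw [← h] at this ⊢
      have : R z = Q := by linarith [abs_nonpos_iff.mp this]
      rw [this]; ring
    · simp only [ha]; field_simp
  have ham : Measurable a := by fun_prop
  have hab : ∀ z, |a z| ≤ b z := fun z => by
    simp only [ha]
    rw [abs_mul, abs_of_nonneg (hb0 z), abs_div, abs_of_nonneg hδ]
    exact mul_le_of_le_one_right (hb0 z) (div_le_one_of_le₀ (hRQ z) hδ)
  have h0 : ∫ z, a z ∂ν = 0 := by
    have : ∫ z, (b z * R z - Q * b z) / δ ∂ν = ∫ z, a z ∂ν := by
      congr 1; ext z; simp only [ha]; ring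
    rw [← this, integral_div, integral_sub hbRi (hbi.const_mul Q), integral_const_mul, hQ,
      div_mul_cancel₀ _ hβpos.ne', sub_self, zero_div]
  have key := integral_exp_ratio_le ham hb hβ₀ hab hbB h0 hβ hN (l * δ)
  have hXm : Measurable fun z : Fin N → E => (∑ i, a (z i)) / ∑ i, b (z i) := by fun_prop
  have hX1 : ∀ z : Fin N → E, |(∑ i, a (z i)) / ∑ i, b (z i)| ≤ 1 := fun z => by
    have h1 : |∑ i, a (z i)| ≤ ∑ i, b (z i) :=
      (Finset.abs_sum_le_sum_abs _ _).trans (Finset.sum_le_sum fun i _ => hab _)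
    rw [abs_div, abs_of_nonneg ((abs_nonneg _).trans h1)]
    exact div_le_one_of_le₀ h1 ((abs_nonneg _).trans h1)
  refine le_trans (le_of_eq ?_) (ENNReal.ofReal_le_ofReal key)
  rw [ofReal_integral_eq_lintegral_ofReal]
  -- The error is δ times the normalised ratio only where the denominator is nonzero; elsewhere the
  -- quotient reads 0 instead of Q. Hence the almost sure positivity of b.
  · refine lintegral_congr_ae ?_
    have : ∀ i : Fin N, ∀ᵐ z ∂(Measure.pi fun _ : Fin N => ν), 0 < b (z i) := fun i =>
      (measurePreserving_eval (fun _ : Fin N => ν) i).quasiMeasurePreserving.ae hbpos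
    filter_upwards [ae_all_iff.mpr this] with z hz
    have hpos : 0 < ∑ i, b (z i) :=
      Finset.sum_pos (fun i _ => hz i) ⟨⟨0, hN⟩, Finset.mem_univ _⟩
    congr 2
    rw [mul_assoc, ← mul_div_assoc, Finset.mul_sum]
    simp_rw [haδ]
    rw [Finset.sum_sub_distrib, ← Finset.sum_mul]
    field_simp
  · refine integrable_of_abs_le (C := Real.exp |l * δ|) (by fun_prop) fun z => ?_
    rw [Real.abs_exp]
    refine Real.exp_le_exp.mpr ((le_abs_self _).trans ?_)
    rw [abs_mul]; exact mul_le_of_le_one_right (abs_nonneg _) (hX1 z)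
  · exact ae_of_all _ fun z => by positivity

/-! ### Contraction of averages with comparable densities, and moments under finite laws. -/

/-- Dobrushin contraction for two averages whose densities are comparable. -/
lemma sub_le_of_density_comparable {Y : Type*} [MeasurableSpace Y] {η : Measure Y}
    {k k' q f : Y → ℝ} (hk : Measurable k) (hk' : Measurable k') (hq : Integrable q η)
    (hf : Measurable f) {σm σp D : ℝ} (hσm : 0 < σm)
    (hkb : ∀ y, σm ≤ k y ∧ k y ≤ σp) (hkb' : ∀ y, σm ≤ k' y ∧ k' y ≤ σp)
    (hq0 : ∀ y, 0 ≤ q y) (hqpos : 0 < ∫ y, q y ∂η) (hfD : OscLE f D) :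
    (∫ y, k y * q y * f y ∂η) / (∫ y, k y * q y ∂η) -
      (∫ y, k' y * q y * f y ∂η) / (∫ y, k' y * q y ∂η) ≤ (1 - σm / σp) * D := by
  obtain ⟨c, hc⟩ := hfD.exists_range
  have hσp : 0 < σp := by
    rcases isEmpty_or_nonempty Y with hY | ⟨⟨y⟩⟩
    · simp [integral_of_isEmpty] at hqpos
    · exact hσm.trans_le ((hkb y).1.trans (hkb y).2)
  have hint : ∀ k : Y → ℝ, Measurable k → (∀ y, σm ≤ k y ∧ k y ≤ σp) →
      Integrable (fun y => k y * q y) η := fun k hk hkb =>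
    hq.bdd_mul hk.aestronglyMeasurable (c := σp) (ae_of_all _ fun y => by
      rw [Real.norm_eq_abs, abs_of_nonneg (hσm.le.trans (hkb y).1)]; exact (hkb y).2)
  have hfb : ∀ y, ‖f y‖ ≤ |c| + |D| := fun y => by
    rw [Real.norm_eq_abs, abs_le]
    constructor
    · linarith [(hc y).1, neg_abs_le c, abs_nonneg D]
    · linarith [(hc y).2, le_abs_self c, le_abs_self D]
  have hmulf : ∀ g : Y → ℝ, Integrable g η → Integrable (fun y => g y * f y) η := fun g hg =>
    hg.mul_bdd hf.aestronglyMeasurable (ae_of_all _ hfb)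
  -- Doeblin minorisation: whatever k is, the average with density kq dominates σm/σp times the
  -- average with density q, on nonnegative functions.
  have aux : ∀ k : Y → ℝ, Measurable k → (∀ y, σm ≤ k y ∧ k y ≤ σp) →
      ∀ g : Y → ℝ, Integrable (fun y => q y * g y) η → Integrable (fun y => k y * q y * g y) η →
      (∀ y, 0 ≤ g y) →
      σm / σp * ((∫ y, q y * g y ∂η) / ∫ y, q y ∂η) ≤
        (∫ y, k y * q y * g y ∂η) / ∫ y, k y * q y ∂η := by
    intro k hk hkb g hg1 hg2 hg0
    have h1 : σm * ∫ y, q y * g y ∂η ≤ ∫ y, k y * q y * g y ∂η := by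
      rw [← integral_const_mul]
      refine integral_mono (hg1.const_mul _) hg2 fun y => ?_
      simp only
      rw [mul_assoc]
      exact mul_le_mul_of_nonneg_right (hkb y).1 (mul_nonneg (hq0 y) (hg0 y))
    have h2 : ∫ y, k y * q y ∂η ≤ σp * ∫ y, q y ∂η := by
      rw [← integral_const_mul]
      exact integral_mono (hint k hk hkb) (hq.const_mul _) fun y =>
        mul_le_mul_of_nonneg_right (hkb y).2 (hq0 y)
    have h3 : 0 < ∫ y, k y * q y ∂η := by
      refine (mul_pos hσm hqpos).trans_le ?_
      rw [← integral_const_mul]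
      exact integral_mono (hq.const_mul _) (hint k hk hkb) fun y =>
        mul_le_mul_of_nonneg_right (hkb y).1 (hq0 y)
    have h4 : 0 ≤ ∫ y, q y * g y ∂η := integral_nonneg fun y => mul_nonneg (hq0 y) (hg0 y)
    rw [div_mul_div_comm]
    exact div_le_div₀ ((mul_nonneg hσm.le h4).trans h1) h1 h3 h2
  have hpos : ∀ k : Y → ℝ, Measurable k → (∀ y, σm ≤ k y ∧ k y ≤ σp) →
      0 < ∫ y, k y * q y ∂η := fun k hk hkb => by
    refine (mul_pos hσm hqpos).trans_le ?_
    rw [← integral_const_mul]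
    exact integral_mono (hq.const_mul _) (hint k hk hkb) fun y =>
      mul_le_mul_of_nonneg_right (hkb y).1 (hq0 y)
  have lin : ∀ g : Y → ℝ, Integrable g η → ∀ e s : ℝ,
      Integrable (fun y => g y * (e + s * f y)) η ∧
      ∫ y, g y * (e + s * f y) ∂η = e * (∫ y, g y ∂η) + s * ∫ y, g y * f y ∂η := by
    intro g hg e s
    have h : (fun y => g y * (e + s * f y)) = fun y => e * g y + s * (g y * f y) := by
      ext y; ring
    rw [h]
    exact ⟨(hg.const_mul e).add ((hmulf g hg).const_mul s), by
      rw [integral_add (hg.const_mul e) ((hmulf g hg).const_mul s), integral_const_mul,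
        integral_const_mul]⟩
  have hki := hint k hk hkb
  have hki' := hint k' hk' hkb'
  -- The minorisation is applied to c + D - f for k and to f - c for k'. On adding, the q-averages
  -- of f cancel and (σm/σp) D is gained.
  have h1 := aux k hk hkb (fun y => (c + D) + (-1) * f y) (lin q hq _ _).1 (lin _ hki _ _).1
    fun y => by linarith [(hc y).2]
  have h2 := aux k' hk' hkb' (fun y => (-c) + 1 * f y) (lin q hq _ _).1 (lin _ hki' _ _).1
    fun y => by linarith [(hc y).1]
  rw [(lin q hq _ _).2, (lin _ hki _ _).2, add_div, add_div, mul_div_cancel_right₀ _ hqpos.ne',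
    mul_div_cancel_right₀ _ (hpos k hk hkb).ne'] at h1
  rw [(lin q hq _ _).2, (lin _ hki' _ _).2, add_div, add_div, mul_div_cancel_right₀ _ hqpos.ne',
    mul_div_cancel_right₀ _ (hpos k' hk' hkb').ne'] at h2
  simp only [neg_one_mul, one_mul, neg_div] at h1 h2
  linarith

/-- The discrete version of `sub_le_of_density_comparable`. -/
lemma sub_le_of_weights_comparable {ι : Type*} [Fintype ι] {k k' q f : ι → ℝ}
    {σm σp D : ℝ} (hσm : 0 < σm)
    (hkb : ∀ y, σm ≤ k y ∧ k y ≤ σp) (hkb' : ∀ y, σm ≤ k' y ∧ k' y ≤ σp)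
    (hq0 : ∀ y, 0 ≤ q y) (hqpos : 0 < ∑ y, q y) (hfD : OscLE f D) :
    (∑ y, k y * q y * f y) / (∑ y, k y * q y) -
      (∑ y, k' y * q y * f y) / (∑ y, k' y * q y) ≤ (1 - σm / σp) * D := by
  let _ : MeasurableSpace ι := ⊤
  have := sub_le_of_density_comparable (η := Measure.count) (k := k) (k' := k') (q := q) (f := f)
    (measurable_from_top) (measurable_from_top) (.of_finite) (measurable_from_top) hσm hkb hkb' hq0
    (by simpa [integral_count] using hqpos) hfD
  simpa [integral_count] using this

/-- Exponential moments of a bounded function under a finite probability vector. -/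
lemma sum_mul_exp_le {ι : Type*} [Fintype ι] {p f : ι → ℝ} (hp0 : ∀ i, 0 ≤ p i)
    (hp1 : ∑ i, p i = 1) {D : ℝ} (hfD : OscLE f D) (l : ℝ) :
    ∑ i, p i * Real.exp (l * f i) ≤ Real.exp (l * ∑ i, p i * f i + l ^ 2 * D ^ 2) := by
  obtain ⟨c, hc⟩ := hfD.exists_range
  set m := ∑ i, p i * f i with hm
  have h1 : c ≤ m := by
    calc c = ∑ i, p i * c := by rw [← Finset.sum_mul, hp1, one_mul]
      _ ≤ m := Finset.sum_le_sum fun i _ => mul_le_mul_of_nonneg_left (hc i).1 (hp0 i)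
  have h2 : m ≤ c + D := by
    calc m ≤ ∑ i, p i * (c + D) :=
          Finset.sum_le_sum fun i _ => mul_le_mul_of_nonneg_left (hc i).2 (hp0 i)
      _ = c + D := by rw [← Finset.sum_mul, hp1, one_mul]
  have hfm : ∀ i, (f i - m) ^ 2 ≤ D ^ 2 := fun i =>
    sq_le_sq' (by linarith [(hc i).1]) (by linarith [(hc i).2])
  -- The terms are expanded around the mean m, so that the linear parts sum to zero.
  have h3 : ∀ i, p i * Real.exp (l * f i) ≤
      Real.exp (l * m) * (l * (p i * f i - p i * m) + p i * Real.exp (l ^ 2 * D ^ 2)) := fun i => by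
    have h4 := exp_le_self_add_exp_sq (l * (f i - m))
    have h5 : Real.exp ((l * (f i - m)) ^ 2) ≤ Real.exp (l ^ 2 * D ^ 2) :=
      Real.exp_le_exp.mpr (by rw [mul_pow]; exact mul_le_mul_of_nonneg_left (hfm i) (sq_nonneg l))
    have h6 : Real.exp (l * f i) = Real.exp (l * m) * Real.exp (l * (f i - m)) := by
      rw [← Real.exp_add]; congr 1; ring
    calc p i * Real.exp (l * f i) = Real.exp (l * m) * (p i * Real.exp (l * (f i - m))) := by
          rw [h6]; ring
      _ ≤ Real.exp (l * m) * (p i * (l * (f i - m) + Real.exp (l ^ 2 * D ^ 2))) := by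
          gcongr
          · exact hp0 i
          · linarith
      _ = _ := by ring
  refine (Finset.sum_le_sum fun i _ => h3 i).trans (le_of_eq ?_)
  rw [← Finset.mul_sum, Finset.sum_add_distrib, ← Finset.mul_sum, Finset.sum_sub_distrib,
    ← Finset.sum_mul, ← Finset.sum_mul, hp1, ← hm, Real.exp_add]
  ring

/-! ### Sums of geometrically decaying oscillations -/

lemma sum_pow_le_of_injOn {ρ : ℝ} (h0 : 0 ≤ ρ) (h1 : ρ < 1) {A : Finset ℕ} {f : ℕ → ℕ}
    (hf : Set.InjOn f A) : ∑ t ∈ A, ρ ^ f t ≤ 1 / (1 - ρ) := by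
  rw [← Finset.sum_image (f := fun n => ρ ^ n) hf, one_div, ← tsum_geometric_of_lt_one h0 h1]
  exact (summable_geometric_of_lt_one h0 h1).sum_le_tsum _ fun n _ => pow_nonneg h0 n

/-- The bound `∑ ρ ^ d(t, [s - r, s])` of the decay of correlations, for sums over `t` or `s`. -/
lemma sum_pow_window_le {ρ : ℝ} (h0 : 0 ≤ ρ) (h1 : ρ < 1) {A : Finset ℕ} {f g : ℕ → ℕ} {r : ℕ}
    (hf : Set.InjOn f {t | t ∈ A ∧ f t ≠ 0}) (hg : Set.InjOn g {t | t ∈ A ∧ g t ≠ 0})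
    (hcard : (A.filter fun t => f t = 0 ∧ g t = 0).card ≤ r + 1) :
    ∑ t ∈ A, ρ ^ (f t + g t) ≤ (1 + 2 / (1 - ρ)) * (1 + r) := by
  -- The three terms are for points inside the window, at most r + 1 of them, and for points on
  -- either side, each giving part of a geometric series by injectivity.
  have h2 : ∀ t ∈ A, ρ ^ (f t + g t) ≤ (if f t = 0 ∧ g t = 0 then 1 else 0) +
      (if f t ≠ 0 then ρ ^ f t else 0) + (if g t ≠ 0 then ρ ^ g t else 0) := by
    intro t _
    have e1 := pow_nonneg h0 (f t)
    have e2 := pow_nonneg h0 (g t)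
    have e3 := pow_le_one₀ h0 h1.le (n := f t)
    have e4 := pow_le_one₀ h0 h1.le (n := g t)
    rw [pow_add]
    by_cases hft : f t = 0 <;> by_cases hgt : g t = 0 <;> simp [hft, hgt]
    nlinarith
  refine (Finset.sum_le_sum h2).trans ?_
  rw [Finset.sum_add_distrib, Finset.sum_add_distrib, ← Finset.sum_filter, ← Finset.sum_filter,
    ← Finset.sum_filter, Finset.sum_const, nsmul_eq_mul, mul_one]
  have e1 := sum_pow_le_of_injOn h0 h1 (A := A.filter fun t => f t ≠ 0) (f := f)
    (by simpa using hf)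
  have e2 := sum_pow_le_of_injOn h0 h1 (A := A.filter fun t => g t ≠ 0) (f := g)
    (by simpa using hg)
  have e3 : ((A.filter fun t => f t = 0 ∧ g t = 0).card : ℝ) ≤ r + 1 := by exact_mod_cast hcard
  have e4 : 0 ≤ 1 / (1 - ρ) := by have : 0 < 1 - ρ := by linarith
                                  positivity
  have e5 : 0 ≤ (r : ℝ) := Nat.cast_nonneg r
  have e6 : 2 / (1 - ρ) = 2 * (1 / (1 - ρ)) := by ring
  rw [e6]
  nlinarith [mul_nonneg e4 e5]

/-- The bound of the influence of time `t`: `∑_s ρ ^ d(t, [s - r, s]) o_s`. -/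
noncomputable def decayBound (ρ : ℝ) (T r : ℕ) (o : ℕ → ℝ) (t : ℕ) : ℝ :=
  ∑ s ∈ Finset.Icc r T, ρ ^ ((t - s) + (s - r - t)) * o s

lemma decayBound_nonneg {ρ : ℝ} (h0 : 0 ≤ ρ) (T r : ℕ) {o : ℕ → ℝ} (ho : ∀ s, 0 ≤ o s) (t : ℕ) :
    0 ≤ decayBound ρ T r o t :=
  Finset.sum_nonneg fun s _ => mul_nonneg (pow_nonneg h0 _) (ho s)

/-- With truncated subtraction, the exponent is the distance from t to [s - r, s]: at most one of
its two terms is nonzero, and each is injective in t where it is nonzero. -/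
lemma sum_pow_window_time_le {ρ : ℝ} (h0 : 0 ≤ ρ) (h1 : ρ < 1) (T r s : ℕ) :
    ∑ t ∈ Finset.range (T + 1), ρ ^ ((t - s) + (s - r - t)) ≤ (1 + 2 / (1 - ρ)) * (1 + r) := by
  refine sum_pow_window_le h0 h1 ?_ ?_ ?_
  · rintro a ⟨_, ha⟩ b ⟨_, hb⟩ h; dsimp only at *; omega
  · rintro a ⟨_, ha⟩ b ⟨_, hb⟩ h; omega
  · refine (Finset.card_le_card (t := Finset.Icc (s - r) s) ?_).trans ?_
    · intro t; simp only [Finset.mem_filter, Finset.mem_Icc]; omega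
    · rw [Nat.card_Icc]; omega

lemma sum_pow_window_index_le {ρ : ℝ} (h0 : 0 ≤ ρ) (h1 : ρ < 1) (T r t : ℕ) :
    ∑ s ∈ Finset.Icc r T, ρ ^ ((t - s) + (s - r - t)) ≤ (1 + 2 / (1 - ρ)) * (1 + r) := by
  refine sum_pow_window_le h0 h1 ?_ ?_ ?_
  · rintro a ⟨_, ha⟩ b ⟨_, hb⟩ h; omega
  · rintro a ⟨_, ha⟩ b ⟨_, hb⟩ h; dsimp only at *; omega
  · refine (Finset.card_le_card (t := Finset.Icc t (t + r)) ?_).trans ?_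
    · intro s; simp only [Finset.mem_filter, Finset.mem_Icc]; omega
    · rw [Nat.card_Icc]; omega

lemma sum_decayBound_le {ρ : ℝ} (h0 : 0 ≤ ρ) (h1 : ρ < 1) (T r : ℕ) {o : ℕ → ℝ}
    (ho : ∀ s, 0 ≤ o s) :
    ∑ t ∈ Finset.range (T + 1), decayBound ρ T r o t ≤
      (1 + 2 / (1 - ρ)) * ((1 + r) * ∑ s ∈ Finset.Icc r T, o s) := by
  simp only [decayBound]
  rw [Finset.sum_comm, ← mul_assoc, Finset.mul_sum]
  refine Finset.sum_le_sum fun s _ => ?_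
  rw [← Finset.sum_mul]
  exact mul_le_mul_of_nonneg_right (sum_pow_window_time_le h0 h1 T r s) (ho s)

/-- Schur's test for the matrix ρ^d: Cauchy–Schwarz bounds the squared norm by the product of the
row and column sums. The rows are at most G min(1 + r, T - r + 1) and the columns at most G(1 + r),
whose product contains `bigTheta`. -/
lemma sum_decayBound_sq_le {ρ : ℝ} (h0 : 0 ≤ ρ) (h1 : ρ < 1) {T r : ℕ} (hrT : r ≤ T) (o : ℕ → ℝ) :
    ∑ t ∈ Finset.range (T + 1), decayBound ρ T r o t ^ 2 ≤
      (1 + 2 / (1 - ρ)) ^ 2 * (bigTheta r T * ∑ s ∈ Finset.Icc r T, o s ^ 2) := by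
  set G := 1 + 2 / (1 - ρ) with hG
  have hρ : 0 < 1 - ρ := by linarith
  have hG1 : 1 ≤ G := by rw [hG]; have : 0 ≤ 2 / (1 - ρ) := by positivity
                         linarith
  have hT : (r : ℝ) ≤ T := by exact_mod_cast hrT
  have hrow : ∀ t, ∑ s ∈ Finset.Icc r T, ρ ^ ((t - s) + (s - r - t)) ≤
      G * min (1 + (r : ℝ)) ((T : ℝ) - r + 1) := by
    intro t
    have e1 := sum_pow_window_index_le h0 h1 T r t
    -- When there are fewer windows than their length, bounding each of the T - r + 1 powers by 1 is
    -- better.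
    have e2 : ∑ s ∈ Finset.Icc r T, ρ ^ ((t - s) + (s - r - t)) ≤ G * ((T : ℝ) - r + 1) := by
      refine (Finset.sum_le_sum fun s _ => pow_le_one₀ h0 h1.le).trans ?_
      rw [Finset.sum_const, Nat.card_Icc, nsmul_eq_mul, mul_one, Nat.cast_sub (by omega)]
      push_cast
      nlinarith
    rcases min_choice (1 + (r : ℝ)) ((T : ℝ) - r + 1) with h | h <;> rw [h]
    · exact e1
    · exact e2
  have hmin : 0 ≤ min (1 + (r : ℝ)) ((T : ℝ) - r + 1) := le_min (by positivity) (by linarith)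
  calc ∑ t ∈ Finset.range (T + 1), decayBound ρ T r o t ^ 2
      ≤ ∑ t ∈ Finset.range (T + 1), (G * min (1 + (r : ℝ)) ((T : ℝ) - r + 1)) *
          ∑ s ∈ Finset.Icc r T, ρ ^ ((t - s) + (s - r - t)) * o s ^ 2 := by
        refine Finset.sum_le_sum fun t _ => ?_
        have e1 : decayBound ρ T r o t ^ 2 ≤
            (∑ s ∈ Finset.Icc r T, ρ ^ ((t - s) + (s - r - t))) *
            ∑ s ∈ Finset.Icc r T, ρ ^ ((t - s) + (s - r - t)) * o s ^ 2 :=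
          Finset.sum_sq_le_sum_mul_sum_of_sq_le_mul _ (fun s _ => pow_nonneg h0 _)
            (fun s _ => mul_nonneg (pow_nonneg h0 _) (sq_nonneg _)) fun s _ => le_of_eq (by ring)
        exact e1.trans (mul_le_mul_of_nonneg_right (hrow t)
          (Finset.sum_nonneg fun s _ => mul_nonneg (pow_nonneg h0 _) (sq_nonneg _)))
    _ = (G * min (1 + (r : ℝ)) ((T : ℝ) - r + 1)) * ∑ s ∈ Finset.Icc r T,
          (∑ t ∈ Finset.range (T + 1), ρ ^ ((t - s) + (s - r - t))) * o s ^ 2 := by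
        rw [← Finset.mul_sum, Finset.sum_comm]
        simp_rw [Finset.sum_mul]
    _ ≤ (G * min (1 + (r : ℝ)) ((T : ℝ) - r + 1)) * ∑ s ∈ Finset.Icc r T,
          (G * (1 + r)) * o s ^ 2 := by
        refine mul_le_mul_of_nonneg_left (Finset.sum_le_sum fun s _ => ?_) (by positivity)
        exact mul_le_mul_of_nonneg_right (sum_pow_window_time_le h0 h1 T r s) (sq_nonneg _)
    _ = _ := by rw [← Finset.mul_sum, bigTheta]; ring

/-! ### Deviation inequality from exponential moments -/

/-- Chernoff's bound. As 2B ≤ ε, the bias uses at most half of lε, and l = ε/(4A) minimises the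
remaining l²A - lε/2. -/
lemma measureReal_lt_le_of_lintegral_exp {Ω : Type*} [MeasurableSpace Ω] {μ : Measure Ω}
    [IsProbabilityMeasure μ] {Z : Ω → ℝ} (hZ : Measurable Z) {A B ε : ℝ} (hA : 0 < A)
    (hε : 0 < ε) (hB : 2 * B ≤ ε)
    (h : ∀ l : ℝ, 0 ≤ l →
      ∫⁻ ω, ENNReal.ofReal (Real.exp (l * Z ω)) ∂μ ≤ ENNReal.ofReal (Real.exp (l ^ 2 * A + l * B))) :
    μ.real {ω | ε < Z ω} ≤ Real.exp (-(ε ^ 2 / (16 * A))) := by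
  set l := ε / (4 * A) with hl
  have hl0 : 0 ≤ l := by positivity
  have h1 := mul_meas_ge_le_lintegral (μ := μ) (f := fun ω => ENNReal.ofReal (Real.exp (l * Z ω)))
    (by fun_prop) (ENNReal.ofReal (Real.exp (l * ε)))
  have h2 : {ω | ε < Z ω} ⊆ {ω | ENNReal.ofReal (Real.exp (l * ε)) ≤
      ENNReal.ofReal (Real.exp (l * Z ω))} := fun ω hω =>
    ENNReal.ofReal_le_ofReal (Real.exp_le_exp.mpr (mul_le_mul_of_nonneg_left (le_of_lt hω) hl0))
  have h3 := ((mul_le_mul_right (measure_mono h2) (ENNReal.ofReal (Real.exp (l * ε)))).trans h1).trans (h l hl0)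
  have h4 := ENNReal.toReal_mono ENNReal.ofReal_ne_top h3
  rw [ENNReal.toReal_mul, ENNReal.toReal_ofReal (by positivity),
    ENNReal.toReal_ofReal (by positivity)] at h4
  have h5 : Real.exp (l * ε) * Real.exp (-(l * ε)) = 1 := by rw [← Real.exp_add]; simp
  calc μ.real {ω | ε < Z ω}
      = Real.exp (-(l * ε)) * (Real.exp (l * ε) * μ.real {ω | ε < Z ω}) := by
        rw [← mul_assoc, mul_comm (Real.exp (-(l * ε))), h5, one_mul]
    _ ≤ Real.exp (-(l * ε)) * Real.exp (l ^ 2 * A + l * B) :=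
        mul_le_mul_of_nonneg_left h4 (by positivity)
    _ ≤ Real.exp (-(ε ^ 2 / (16 * A))) := by
        rw [← Real.exp_add]
        refine Real.exp_le_exp.mpr ?_
        have e1 : l * (2 * B) ≤ l * ε := mul_le_mul_of_nonneg_left hB hl0
        have e2 : l ^ 2 * A = ε ^ 2 / (16 * A) := by rw [hl]; field_simp; norm_num
        have e3 : l * ε = 4 * (ε ^ 2 / (16 * A)) := by rw [hl]; field_simp; norm_num
        linarith

/-- Above twice the bias level KGw/N, Chernoff's bound for Z and -Z gives the Gaussian term. Below
it, the second term already exceeds 1. The constant is smaller than both 1/(16KG²) and 1/(2KG),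
which these two regimes require. -/
lemma deviation_of_lintegral_exp {Ω : Type*} [MeasurableSpace Ω] {μ : Measure Ω}
    [IsProbabilityMeasure μ] {Z : Ω → ℝ} (hZ : Measurable Z) {K G v w ε : ℝ} {N : ℕ} (hK : 0 < K)
    (hG : 0 < G) (hv : 0 ≤ v) (hw : 0 ≤ w) (hN : 1 ≤ N) (hε : 0 < ε)
    (h : ∀ l : ℝ, ∫⁻ ω, ENNReal.ofReal (Real.exp (l * Z ω)) ∂μ ≤
      ENNReal.ofReal (Real.exp (K * (l ^ 2 * (G ^ 2 * v) + |l| * (G * w)) / N))) :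
    μ.real {ω | ε < |Z ω|} ≤
      2 * Real.exp (-(1 / (16 * K * G ^ 2 + 2 * K * G) * N * ε ^ 2 / v)) +
        8 * Real.exp (-(1 / (16 * K * G ^ 2 + 2 * K * G) * N * ε / w)) := by
  have hNpos : (0 : ℝ) < N := by exact_mod_cast hN
  have hCpos : 0 < 16 * K * G ^ 2 + 2 * K * G := by positivity
  set C := 1 / (16 * K * G ^ 2 + 2 * K * G) with hC
  have e1 : 0 < Real.exp (-(C * N * ε ^ 2 / v)) := Real.exp_pos _
  have e2 : 0 < Real.exp (-(C * N * ε / w)) := Real.exp_pos _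
  have hle1 : μ.real {ω | ε < |Z ω|} ≤ 1 := measureReal_le_one
  -- If v or w vanishes, its quotient reads 0, one exponential equals 1 and the claim is trivial.
  rcases eq_or_lt_of_le hv with rfl | hv
  · simp only [div_zero, neg_zero, Real.exp_zero] at *; linarith
  rcases eq_or_lt_of_le hw with rfl | hw
  · simp only [div_zero, neg_zero, Real.exp_zero] at *; linarith
  rcases le_total (2 * (K * G * w / N)) ε with hB | hB
  · have hA : 0 < K * G ^ 2 * v / N := by positivity
    have hp := measureReal_lt_le_of_lintegral_exp (μ := μ) hZ hA hε hB fun l hl => by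
      refine (h l).trans (ENNReal.ofReal_le_ofReal (Real.exp_le_exp.mpr (le_of_eq ?_)))
      rw [abs_of_nonneg hl]; ring
    have hn := measureReal_lt_le_of_lintegral_exp (μ := μ) hZ.neg hA hε hB fun l hl => by
      simp only [Pi.neg_apply, mul_neg, ← neg_mul]
      refine (h (-l)).trans (ENNReal.ofReal_le_ofReal (Real.exp_le_exp.mpr (le_of_eq ?_)))
      rw [abs_neg, abs_of_nonneg hl]; ring
    have hsub : {ω | ε < |Z ω|} ⊆ {ω | ε < Z ω} ∪ {ω | ε < (-Z) ω} := fun ω hω => by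
      rcases lt_abs.mp (by simpa using hω : ε < |Z ω|) with h | h
      · exact Or.inl h
      · exact Or.inr h
    have hfin : Real.exp (-(ε ^ 2 / (16 * (K * G ^ 2 * v / N)))) ≤
        Real.exp (-(C * N * ε ^ 2 / v)) := by
      refine Real.exp_le_exp.mpr (neg_le_neg ?_)
      rw [hC]
      have : ε ^ 2 / (16 * (K * G ^ 2 * v / N)) = 1 / (16 * K * G ^ 2) * N * ε ^ 2 / v := by
        field_simp
      rw [this]
      gcongr
      linarith [show 0 < 2 * K * G by positivity]
    have := (measureReal_mono hsub (μ := μ)).trans (measureReal_union_le _ _)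
    linarith
  · have h1 : C * N * ε / w ≤ 1 := by
      rw [div_le_one hw, hC]
      have h2 : N * ε ≤ 2 * K * G * w := by
        have := mul_le_mul_of_nonneg_left hB hNpos.le
        have e : (N : ℝ) * (2 * (K * G * w / N)) = 2 * K * G * w := by field_simp
        linarith
      have h3 : 1 / (16 * K * G ^ 2 + 2 * K * G) ≤ 1 / (2 * K * G) := by
        gcongr
        linarith [show 0 < 16 * K * G ^ 2 by positivity]
      calc 1 / (16 * K * G ^ 2 + 2 * K * G) * N * ε
          = 1 / (16 * K * G ^ 2 + 2 * K * G) * (N * ε) := by ring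
        _ ≤ 1 / (2 * K * G) * (2 * K * G * w) := by gcongr
        _ = w := by field_simp
    have h2 : Real.exp (-1) ≤ Real.exp (-(C * N * ε / w)) :=
      Real.exp_le_exp.mpr (neg_le_neg h1)
    have h3 : (1 : ℝ) / 8 ≤ Real.exp (-1) := by
      rw [Real.exp_neg, ← one_div]
      have := Real.exp_one_lt_d9
      gcongr
      linarith
    linarith

/-! ### Bounded measurable functions. -/

/-- Bounded measurable functions. -/
structure BddMeas {E : Type*} [MeasurableSpace E] (F : E → ℝ) : Prop where
  meas : Measurable F
  bdd : ∃ K : ℝ, ∀ x, |F x| ≤ K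

namespace BddMeas

variable {E E' : Type*} [MeasurableSpace E] [MeasurableSpace E'] {F G : E → ℝ}

lemma integrable (h : BddMeas F) (ν : Measure E) [IsFiniteMeasure ν] : Integrable F ν := by
  obtain ⟨K, hK⟩ := h.bdd
  exact integrable_of_abs_le h.meas hK

lemma mul (hF : BddMeas F) (hG : BddMeas G) : BddMeas fun x => F x * G x := by
  obtain ⟨K, hK⟩ := hF.bdd
  obtain ⟨K', hK'⟩ := hG.bdd
  refine ⟨hF.meas.mul hG.meas, K * K', fun x => ?_⟩
  rw [abs_mul]
  exact mul_le_mul (hK x) (hK' x) (abs_nonneg _) ((abs_nonneg _).trans (hK x))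

lemma comp (hF : BddMeas F) {φ : E' → E} (hφ : Measurable φ) : BddMeas fun x => F (φ x) := by
  obtain ⟨K, hK⟩ := hF.bdd
  exact ⟨hF.meas.comp hφ, K, fun x => hK _⟩

lemma const (c : ℝ) : BddMeas fun _ : E => c := ⟨measurable_const, |c|, fun _ => le_rfl⟩

lemma sum {ι : Type*} {s : Finset ι} {F : ι → E → ℝ} (h : ∀ i ∈ s, BddMeas (F i)) :
    BddMeas fun x => ∑ i ∈ s, F i x := by
  refine ⟨Finset.measurable_fun_sum s fun i hi => (h i hi).meas, ?_⟩
  choose! K hK using fun i hi => (h i hi).bdd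
  exact ⟨∑ i ∈ s, K i, fun x => (Finset.abs_sum_le_sum_abs _ _).trans
    (Finset.sum_le_sum fun i hi => hK i hi x)⟩

end BddMeas

lemma measurable_update_prod {X : Type*} [MeasurableSpace X] (t : ℕ) :
    Measurable fun z : (ℕ → X) × X => Function.update z.1 t z.2 := by
  refine measurable_pi_iff.mpr fun i => ?_
  by_cases h : i = t
  · subst h; simpa using measurable_snd
  · simp only [Function.update_of_ne h]
    fun_prop

/-! ### Forward integration under the smoothing distribution, and its forgetting. -/

namespace ParticleModel

variable {X : Type u} [MeasurableSpace X]

attribute [instance] ParticleModel.prob_χ ParticleModel.markov_M ParticleModel.prob_ρ₀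

section Forward

variable {S : ParticleModel X} {σm σp cm Bθ Bω : ℝ}

lemma integral_M (S : ParticleModel X) (x : X) (f : X → ℝ) :
    ∫ y, f y ∂(S.M x) = ∫ y, S.m x y * f y ∂S.lam := by
  have hm : Measurable (S.m x) := S.measurable_m.comp (measurable_prodMk_left)
  rw [S.M_eq, integral_withDensity_eq_integral_toReal_smul (by fun_prop)
    (ae_of_all _ fun y => ENNReal.ofReal_lt_top)]
  simp [ENNReal.toReal_ofReal (S.m_nonneg x _)]

lemma Assumptions.bddMeas_g (hA : S.Assumptions σm σp cm Bθ Bω) (t : ℕ) : BddMeas (S.g t) := by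
  obtain ⟨K, hK⟩ := hA.g_bdd
  exact ⟨S.measurable_g t, K, fun x => by rw [abs_of_pos (hA.g_pos t x)]; exact hK t x⟩

/-- A transition density of total mass 1 that is bounded below by σm leaves the reference measure
with mass at most 1/σm. -/
lemma Assumptions.isFiniteMeasure_lam [Nonempty X] (hA : S.Assumptions σm σp cm Bθ Bω)
    (hσm : 0 < σm) : IsFiniteMeasure S.lam := by
  obtain ⟨x⟩ := ‹Nonempty X›
  have h1 : S.M x Set.univ = 1 := measure_univ
  rw [S.M_eq, withDensity_apply _ MeasurableSet.univ, Measure.restrict_univ] at h1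
  have h2 : ENNReal.ofReal σm * S.lam Set.univ ≤ 1 := by
    rw [← h1, ← lintegral_const]
    exact lintegral_mono fun y => ENNReal.ofReal_le_ofReal (hA.mixing x y).1
  refine ⟨lt_top_iff_ne_top.mpr fun h => ?_⟩
  rw [h, ENNReal.mul_top (by simpa using hσm)] at h2
  simp at h2

lemma measurable_iterInt {F : (ℕ → X) → ℝ} (hF : Measurable F) (k : ℕ) :
    ∀ t, Measurable (S.iterInt F t k) := by
  induction k with
  | zero => intro t; exact hF
  | succ k ih =>
    intro t
    have h1 : Measurable fun z : (ℕ → X) × X =>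
        S.g (t + 1) z.2 * S.iterInt F (t + 1) k (Function.update z.1 (t + 1) z.2) :=
      ((S.measurable_g _).comp measurable_snd).mul ((ih _).comp (measurable_update_prod _))
    exact (h1.stronglyMeasurable.integral_kernel_prod_right'
      (κ := S.M.comap (fun x : ℕ → X => x t) (measurable_pi_apply t))).measurable

lemma Assumptions.bddMeas_iterInt (hA : S.Assumptions σm σp cm Bθ Bω) {F : (ℕ → X) → ℝ}
    (hF : BddMeas F) (k : ℕ) : ∀ t, BddMeas (S.iterInt F t k) := by
  induction k with
  | zero => intro t; exact hF
  | succ k ih =>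
    intro t
    refine ⟨measurable_iterInt hF.meas _ t, ?_⟩
    obtain ⟨K, hK⟩ := (ih (t + 1)).bdd
    obtain ⟨K', hK'⟩ := (hA.bddMeas_g (t + 1)).bdd
    refine ⟨K' * K, fun x => ?_⟩
    have := norm_integral_le_of_norm_le_const (μ := S.M (x t)) (C := K' * K)
      (f := fun y => S.g (t + 1) y * S.iterInt F (t + 1) k (Function.update x (t + 1) y))
      (ae_of_all _ fun y => by
        rw [norm_mul]
        exact mul_le_mul (hK' y) (hK _) (abs_nonneg _) ((abs_nonneg _).trans (hK' y)))
    simpa [iterInt] using this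

lemma Assumptions.bddMeas_iterInt_step (hA : S.Assumptions σm σp cm Bθ Bω) {F : (ℕ → X) → ℝ}
    (hF : BddMeas F) (k t : ℕ) (x : ℕ → X) : BddMeas fun y =>
      S.g (t + 1) y * S.iterInt F (t + 1) k (Function.update x (t + 1) y) :=
  (hA.bddMeas_g _).mul ((hA.bddMeas_iterInt hF k (t + 1)).comp (measurable_update x))

lemma iterInt_const_mul (c : ℝ) (F : (ℕ → X) → ℝ) (k : ℕ) :
    ∀ t x, S.iterInt (fun x => c * F x) t k x = c * S.iterInt F t k x := by
  induction k with
  | zero => intro t x; rfl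
  | succ k ih =>
    intro t x
    simp only [iterInt, ih]
    rw [← integral_const_mul]
    congr 1; ext y; ring

lemma Assumptions.iterInt_sum (hA : S.Assumptions σm σp cm Bθ Bω) {ι : Type*} {A : Finset ι}
    {F : ι → (ℕ → X) → ℝ} (hF : ∀ i ∈ A, BddMeas (F i)) (k : ℕ) :
    ∀ t x, S.iterInt (fun x => ∑ i ∈ A, F i x) t k x = ∑ i ∈ A, S.iterInt (F i) t k x := by
  induction k with
  | zero => intro t x; rfl
  | succ k ih =>
    intro t x
    simp only [iterInt, ih, Finset.mul_sum]
    exact integral_finsetSum _ fun i hi =>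
      (hA.bddMeas_iterInt_step (hF i hi) k t x).integrable _

lemma Assumptions.iterInt_mono (hA : S.Assumptions σm σp cm Bθ Bω)
    {F G : (ℕ → X) → ℝ} (hF : BddMeas F) (hG : BddMeas G) (hFG : ∀ x, F x ≤ G x) (k : ℕ) :
    ∀ t x, S.iterInt F t k x ≤ S.iterInt G t k x := by
  induction k with
  | zero => intro t x; exact hFG x
  | succ k ih =>
    intro t x
    simp only [iterInt]
    refine integral_mono ((hA.bddMeas_iterInt_step hF k t x).integrable _)
      ((hA.bddMeas_iterInt_step hG k t x).integrable _) fun y => ?_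
    exact mul_le_mul_of_nonneg_left (ih _ _) (hA.g_pos _ _).le

/-- The coordinates t + 1, …, t + k are overwritten by the integration variables, while the first
transition introduces the coordinate t. -/
lemma iterInt_dependsOn {F : (ℕ → X) → ℝ} {A : Set ℕ} (hF : DependsOn F A) (k : ℕ) :
    ∀ t, DependsOn (S.iterInt F t k) ({t} ∪ A \ Set.Ioc t (t + k)) := by
  induction k with
  | zero =>
    intro t
    exact hF.mono (by intro i hi; right; simpa using hi)
  | succ k ih =>
    intro t x x' h
    simp only [iterInt]
    rw [h t (by simp)]
    congr 1; ext y
    congr 1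
    refine ih (t + 1) fun i hi => ?_
    by_cases hit : i = t + 1
    · subst hit; simp
    · rw [Function.update_of_ne hit, Function.update_of_ne hit]
      refine h i ?_
      rcases hi with hi | hi
      · exact absurd hi hit
      · refine Or.inr ⟨hi.1, fun h2 => hi.2 ?_⟩
        simp only [Set.mem_Ioc] at h2 ⊢
        omega

/-- Serves only to make normalising constants positive; the power of cm never enters the final
constant. -/
lemma Assumptions.pow_le_iterInt_one (hA : S.Assumptions σm σp cm Bθ Bω) (hcm : 0 < cm) (k : ℕ) :
    ∀ t x, cm ^ k ≤ S.iterInt (fun _ => 1) t k x := by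
  induction k with
  | zero => intro t x; simp [iterInt]
  | succ k ih =>
    intro t x
    simp only [iterInt]
    calc cm ^ (k + 1) = cm ^ k * cm := pow_succ _ _
      _ ≤ cm ^ k * ∫ y, S.g (t + 1) y ∂(S.M (x t)) :=
          mul_le_mul_of_nonneg_left (hA.lower_succ _ (by omega) _) (by positivity)
      _ = ∫ y, S.g (t + 1) y * cm ^ k ∂(S.M (x t)) := by rw [integral_mul_const, mul_comm]
      _ ≤ _ := by
        refine integral_mono (((hA.bddMeas_g _).integrable _).mul_const _)
          ((hA.bddMeas_iterInt_step (BddMeas.const 1) k t x).integrable _) fun y => ?_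
        exact mul_le_mul_of_nonneg_left (ih _ _) (hA.g_pos _ _).le

lemma Assumptions.iterInt_one_pos (hA : S.Assumptions σm σp cm Bθ Bω) (hcm : 0 < cm) (k t : ℕ)
    (x : ℕ → X) : 0 < S.iterInt (fun _ => 1) t k x :=
  (pow_pos hcm k).trans_le (hA.pow_le_iterInt_one hcm k t x)

lemma iterInt_one_congr (k t : ℕ) {x x' : ℕ → X} (h : x t = x' t) :
    S.iterInt (fun _ => 1) t k x = S.iterInt (fun _ => 1) t k x' := by
  refine iterInt_dependsOn (A := ∅) (fun _ _ _ => rfl) k t fun i hi => ?_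
  simp only [Set.empty_sdiff, Set.union_empty, Set.mem_singleton_iff] at hi
  rw [hi, h]

/-- The conditional expectation of `F` given the path up to time `t`, under the smoothing
distribution with horizon `t + k`. -/
noncomputable def fwd (S : ParticleModel X) (F : (ℕ → X) → ℝ) (t k : ℕ) (x : ℕ → X) : ℝ :=
  S.iterInt F t k x / S.iterInt (fun _ => 1) t k x

lemma Assumptions.fwd_mul (hA : S.Assumptions σm σp cm Bθ Bω) (hcm : 0 < cm) (F : (ℕ → X) → ℝ)
    (t k : ℕ) (x : ℕ → X) :
    S.iterInt (fun _ => 1) t k x * S.fwd F t k x = S.iterInt F t k x :=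
  mul_div_cancel₀ _ (hA.iterInt_one_pos hcm k t x).ne'

lemma Assumptions.fwd_range (hA : S.Assumptions σm σp cm Bθ Bω) (hcm : 0 < cm)
    {F : (ℕ → X) → ℝ} (hF : BddMeas F) {a b : ℝ} (h : ∀ x, a ≤ F x ∧ F x ≤ b) (t k : ℕ)
    (x : ℕ → X) : a ≤ S.fwd F t k x ∧ S.fwd F t k x ≤ b := by
  have hp := hA.iterInt_one_pos hcm k t x
  have e : ∀ c : ℝ, S.iterInt (fun _ => c) t k x = c * S.iterInt (fun _ => 1) t k x := fun c => by
    simpa using iterInt_const_mul (S := S) c (fun _ => 1) k t x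
  rw [fwd, le_div_iff₀ hp, div_le_iff₀ hp, ← e, ← e]
  exact ⟨hA.iterInt_mono (BddMeas.const a) hF (fun x => (h x).1) k t x,
    hA.iterInt_mono hF (BddMeas.const b) (fun x => (h x).2) k t x⟩

lemma Assumptions.fwd_oscLE (hA : S.Assumptions σm σp cm Bθ Bω) (hcm : 0 < cm)
    {F : (ℕ → X) → ℝ} (hF : BddMeas F) {D : ℝ} (h : OscLE F D) (t k : ℕ) :
    OscLE (S.fwd F t k) D := by
  obtain ⟨c, hc⟩ := h.exists_range
  exact OscLE.of_range (c := c) fun x => hA.fwd_range hcm hF hc t k x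

lemma Assumptions.bddMeas_fwd (hA : S.Assumptions σm σp cm Bθ Bω) (hcm : 0 < cm)
    {F : (ℕ → X) → ℝ} (hF : BddMeas F) (t k : ℕ) : BddMeas (S.fwd F t k) := by
  obtain ⟨K, hK⟩ := hF.bdd
  refine ⟨(measurable_iterInt hF.meas k t).div (measurable_iterInt measurable_const k t), K,
    fun x => ?_⟩
  have := hA.fwd_range hcm hF (fun x => abs_le.mp (hK x)) t k x
  exact abs_le.mpr this

lemma Assumptions.fwd_sum (hA : S.Assumptions σm σp cm Bθ Bω) {ι : Type*} {A : Finset ι}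
    {F : ι → (ℕ → X) → ℝ} (hF : ∀ i ∈ A, BddMeas (F i)) (t k : ℕ) (x : ℕ → X) :
    S.fwd (fun x => ∑ i ∈ A, F i x) t k x = ∑ i ∈ A, S.fwd (F i) t k x := by
  simp only [fwd, hA.iterInt_sum hF, Finset.sum_div]

lemma fwd_dependsOn {F : (ℕ → X) → ℝ} {A : Set ℕ} (hF : DependsOn F A) (t k : ℕ) :
    DependsOn (S.fwd F t k) ({t} ∪ A \ Set.Ioc t (t + k)) := fun x x' h => by
  simp only [fwd]
  rw [iterInt_dependsOn hF k t h, iterInt_one_congr k t (h t (by simp))]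

lemma iterInt_eq_mul (k : ℕ) : ∀ t {F : (ℕ → X) → ℝ}, DependsOn F (Set.Iic t) →
    ∀ x, S.iterInt F t k x = F x * S.iterInt (fun _ => 1) t k x := by
  induction k with
  | zero => intro t F _ x; simp [iterInt]
  | succ k ih =>
    intro t F hF x
    simp only [iterInt]
    rw [← integral_const_mul]
    congr 1; ext y
    rw [ih (t + 1) (hF.mono (Set.Iic_subset_Iic.mpr (by omega)))]
    have : F (Function.update x (t + 1) y) = F x := hF fun i hi =>
      Function.update_of_ne (by simp only [Set.mem_Iic] at hi; omega) _ _
    rw [this]; ring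

lemma Assumptions.fwd_eq_self (hA : S.Assumptions σm σp cm Bθ Bω) (hcm : 0 < cm)
    {F : (ℕ → X) → ℝ} {t : ℕ} (hF : DependsOn F (Set.Iic t)) (k : ℕ) (x : ℕ → X) :
    S.fwd F t k x = F x := by
  rw [fwd, iterInt_eq_mul k t hF, mul_div_assoc, div_self (hA.iterInt_one_pos hcm k t x).ne',
    mul_one]

/-- Before the window of F is reached, a step of `fwd` averages a function of the next state with
density m(x_t, ·)q, where q does not depend on x_t. Mixing makes these densities comparable, so each
of the n steps gains a Dobrushin factor. -/
lemma Assumptions.fwd_contraction (hA : S.Assumptions σm σp cm Bθ Bω) (hσm : 0 < σm)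
    (hcm : 0 < cm) [Nonempty X] {F : (ℕ → X) → ℝ} (hF : BddMeas F) {D : ℝ} (hD : OscLE F D)
    {s s' : ℕ} (hs : DependsOn F (Set.Icc s s')) (n : ℕ) :
    ∀ t k, t + n = s → s' ≤ t + k → OscLE (S.fwd F t k) ((1 - σm / σp) ^ n * D) := by
  induction n with
  | zero => intro t k _ _; simpa using hA.fwd_oscLE hcm hF hD t k
  | succ n ih =>
    intro t k ht hk x x'
    -- With no coordinate left to integrate, s' ≤ t < s: the window is empty and F is constant.
    rcases k with _ | k
    · -- the window is empty
      have : F x = F x' := hs fun i hi => by simp only [Set.mem_Icc] at hi; omega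
      have h0 := (ih (t + 1) 0 (by omega) (by omega)).nonneg
      rw [hA.fwd_eq_self hcm (hs.mono fun i hi => by simp only [Set.mem_Icc, Set.mem_Iic] at *; omega),
        hA.fwd_eq_self hcm (hs.mono fun i hi => by simp only [Set.mem_Icc, Set.mem_Iic] at *; omega),
        this, sub_self]
      have hκ : 0 ≤ 1 - σm / σp := by
        obtain ⟨z⟩ := ‹Nonempty X›
        have h1 := (hA.mixing z z).1.trans (hA.mixing z z).2
        have : σm / σp ≤ 1 := (div_le_one (hσm.trans_le h1)).mpr h1
        linarith
      rw [pow_succ', mul_assoc]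
      exact mul_nonneg hκ h0
    have hfin := hA.isFiniteMeasure_lam hσm
    obtain ⟨z⟩ := ‹Nonempty X›
    -- The window lies in [t + 1, t + 1 + k], so only the coordinate t + 1 survives and the path can
    -- be replaced by a constant one.
    have hdep : ∀ (x : ℕ → X) y, S.fwd F (t + 1) k (Function.update x (t + 1) y) =
        S.fwd F (t + 1) k fun _ => y := fun x y => by
      refine fwd_dependsOn hs (t + 1) k fun i hi => ?_
      have : i = t + 1 := by
        rcases hi with hi | hi
        · exact hi
        · have := hi.2
          have := hi.1
          simp only [Set.mem_Icc, Set.mem_Ioc] at *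
          omega
      subst this; simp
    have hone : ∀ (x : ℕ → X) y, S.iterInt (fun _ => 1) (t + 1) k (Function.update x (t + 1) y) =
        S.iterInt (fun _ => 1) (t + 1) k fun _ => y := fun x y =>
      iterInt_one_congr _ _ (by simp)
    set q : X → ℝ := fun y => S.g (t + 1) y * S.iterInt (fun _ => 1) (t + 1) k fun _ => y with hq
    set f : X → ℝ := fun y => S.fwd F (t + 1) k fun _ => y with hf
    have hconst : Measurable fun y : X => (fun _ : ℕ => y) := measurable_pi_iff.mpr fun _ => measurable_id
    have hqB : BddMeas q := (hA.bddMeas_g _).mul ((hA.bddMeas_iterInt (BddMeas.const 1) k _).comp hconst)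
    have hfB : BddMeas f := (hA.bddMeas_fwd hcm hF _ k).comp hconst
    have hq0 : ∀ y, 0 ≤ q y := fun y =>
      mul_nonneg (hA.g_pos _ _).le (hA.iterInt_one_pos hcm _ _ _).le
    have e1 : ∀ x : ℕ → X, S.iterInt (fun _ => 1) t (k + 1) x = ∫ y, S.m (x t) y * q y ∂S.lam :=
      fun x => by
        simp only [iterInt, hone]
        rw [integral_M]
    have e2 : ∀ x : ℕ → X, S.iterInt F t (k + 1) x = ∫ y, S.m (x t) y * q y * f y ∂S.lam :=
      fun x => by
        simp only [iterInt, ← hA.fwd_mul hcm F (t + 1), hone, hdep]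
        rw [integral_M]
        congr 1; ext y; simp only [hq, hf]; ring
    have hqpos : 0 < ∫ y, q y ∂S.lam := by
      have h1 := hA.iterInt_one_pos hcm (k + 1) t x
      rw [e1] at h1
      refine lt_of_le_of_ne (integral_nonneg hq0) fun h2 => h1.ne' ?_
      have h3 := (integral_eq_zero_iff_of_nonneg hq0 (hqB.integrable _)).mp h2.symm
      rw [integral_eq_zero_of_ae]
      filter_upwards [h3] with y hy
      simp [hy]
    have hmm : ∀ x, Measurable (S.m x) := fun x => S.measurable_m.comp measurable_prodMk_left
    have := sub_le_of_density_comparable (hmm (x t)) (hmm (x' t)) (hqB.integrable S.lam) hfB.meas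
      hσm (hA.mixing _) (hA.mixing _) hq0 hqpos
      ((ih (t + 1) k (by omega) (by omega)).comp fun y : X => (fun _ : ℕ => y))
    rw [fwd, fwd, e1, e1, e2, e2, pow_succ', mul_assoc]
    exact this

/-- The starting point enters only through the first transition density, which lies in [σm, σp]. The
ratio is thus bounded uniformly in k, unlike the constants themselves. -/
lemma Assumptions.iterInt_one_ratio (hA : S.Assumptions σm σp cm Bθ Bω) (hσm : 0 < σm)
    (hcm : 0 < cm) [Nonempty X] (t k : ℕ) (x x' : ℕ → X) :
    σm / σp * S.iterInt (fun _ => 1) t k x' ≤ S.iterInt (fun _ => 1) t k x := by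
  have hσ := (hA.mixing (x 0) (x 0)).1.trans (hA.mixing (x 0) (x 0)).2
  have hσp := hσm.trans_le hσ
  rcases k with _ | k
  · simpa [iterInt] using (div_le_one hσp).mpr hσ
  have hfin := hA.isFiniteMeasure_lam hσm
  simp only [iterInt]
  set q : X → ℝ := fun y => S.g (t + 1) y * S.iterInt (fun _ => 1) (t + 1) k fun _ => y with hq
  have hconst : Measurable fun y : X => (fun _ : ℕ => y) := measurable_pi_iff.mpr fun _ => measurable_id
  have hqB : BddMeas q := (hA.bddMeas_g _).mul ((hA.bddMeas_iterInt (BddMeas.const 1) k _).comp hconst)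
  have hq0 : ∀ y, 0 ≤ q y := fun y =>
    mul_nonneg (hA.g_pos _ _).le (hA.iterInt_one_pos hcm _ _ _).le
  have hone : ∀ (x : ℕ → X) y, S.iterInt (fun _ => 1) (t + 1) k (Function.update x (t + 1) y) =
      S.iterInt (fun _ => 1) (t + 1) k fun _ => y := fun x y =>
    iterInt_one_congr _ _ (by simp)
  simp only [hone, integral_M]
  have hmm : ∀ x, BddMeas (S.m x) := fun x =>
    ⟨S.measurable_m.comp measurable_prodMk_left, σp, fun y => by
      rw [abs_of_nonneg (S.m_nonneg _ _)]; exact (hA.mixing _ _).2⟩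
  rw [div_mul_eq_mul_div, div_le_iff₀ hσp, ← integral_const_mul, ← integral_mul_const]
  refine integral_mono ((((hmm _).mul hqB).integrable _).const_mul _)
    ((((hmm _).mul hqB).integrable _).mul_const _) fun y => ?_
  have h1 := mul_le_mul_of_nonneg_right (hA.mixing (x t) y).1 (hq0 y)
  have h2 := mul_le_mul_of_nonneg_right (hA.mixing (x' t) y).2 (hq0 y)
  have h3 := mul_le_mul_of_nonneg_left h2 hσm.le
  have h4 := mul_le_mul_of_nonneg_right h1 hσp.le
  simp only [hq] at *
  linarith

end Forward

end ParticleModel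

/-! ### Additive functionals and the backward Markov chain of a particle array. -/

namespace ParticleModel

/-- The summand `h_s(x_{s-r:s})` of an additive functional, as a function of the whole path. -/
def window {X : Type*} (r : ℕ) (h : ℕ → (Fin (r + 1) → X) → ℝ) (s : ℕ) (p : ℕ → X) : ℝ :=
  h s fun i => p (s - r + i)

lemma additiveFunctional_eq_sum_window {X : Type*} (T r : ℕ) (h : ℕ → (Fin (r + 1) → X) → ℝ) (p : ℕ → X) :
    additiveFunctional T r h (fun u => p u) = ∑ s ∈ Finset.Icc r T, window r h s p := by
  have e : Finset.Icc r T = Finset.Ico r (T + 1) := by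
    ext s; simp only [Finset.mem_Icc, Finset.mem_Ico]; omega
  rw [e, Finset.sum_Ico_eq_sum_range, Finset.sum_range]
  simp [additiveFunctional, window]

lemma dependsOn_window {X : Type*} {r s : ℕ} (hrs : r ≤ s) (h : ℕ → (Fin (r + 1) → X) → ℝ) :
    DependsOn (window r h s) (Set.Icc (s - r) s) := fun p p' hp => by
  simp only [window]
  congr 1; ext i
  exact hp _ ⟨by omega, by omega⟩

variable {X : Type u} [MeasurableSpace X]

section Backward

variable {N : ℕ} {S : ParticleModel X} {σm σp cm Bθ Bω : ℝ}
  {w : ℕ → Fin N → ℝ} {x : ℕ → Fin N → X}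

/-- The backward probability of the particle `j` at time `t`, given the position `y` at time
`t + 1`. -/
noncomputable def backWeight (S : ParticleModel X) (w : ℕ → Fin N → ℝ) (x : ℕ → Fin N → X) (t : ℕ)
    (y : X) (j : Fin N) : ℝ :=
  w t j * S.m (x t j) y / ∑ l, w t l * S.m (x t l) y

/-- Integration of the coordinates `t - 1, …, 0` of a path functional under the backward Markov
chain of the particle system, given the coordinates `t, t + 1, …`. -/
noncomputable def back (S : ParticleModel X) (w : ℕ → Fin N → ℝ) (x : ℕ → Fin N → X) :
    ℕ → ((ℕ → X) → ℝ) → (ℕ → X) → ℝ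
  | 0, F, p => F p
  | t + 1, F, p =>
      ∑ j, S.backWeight w x t (p (t + 1)) j * back S w x t F (Function.update p t (x t j))

lemma Assumptions.sum_weight_mul_pos (hA : S.Assumptions σm σp cm Bθ Bω) (hσm : 0 < σm)
    (hN : 1 ≤ N) {t : ℕ} (hw : ∀ j, 0 < w t j) (y : X) : 0 < ∑ l, w t l * S.m (x t l) y :=
  Finset.sum_pos (fun l _ => mul_pos (hw l) (hσm.trans_le (hA.mixing _ _).1))
    ⟨⟨0, hN⟩, Finset.mem_univ _⟩

lemma Assumptions.backWeight_nonneg (hA : S.Assumptions σm σp cm Bθ Bω) (hσm : 0 < σm)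
    (hN : 1 ≤ N) {t : ℕ} (hw : ∀ j, 0 < w t j) (y : X) (j : Fin N) :
    0 ≤ S.backWeight w x t y j :=
  div_nonneg (mul_nonneg (hw j).le (S.m_nonneg _ _)) (hA.sum_weight_mul_pos hσm hN hw y).le

lemma Assumptions.sum_backWeight (hA : S.Assumptions σm σp cm Bθ Bω) (hσm : 0 < σm)
    (hN : 1 ≤ N) {t : ℕ} (hw : ∀ j, 0 < w t j) (y : X) :
    ∑ j, S.backWeight w x t y j = 1 := by
  simp only [backWeight]
  rw [← Finset.sum_div, div_self (hA.sum_weight_mul_pos hσm hN hw y).ne']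

lemma back_sum {ι : Type*} {A : Finset ι} {F : ι → (ℕ → X) → ℝ} (t : ℕ) :
    ∀ p, S.back w x t (fun p => ∑ i ∈ A, F i p) p = ∑ i ∈ A, S.back w x t (F i) p := by
  induction t with
  | zero => intro p; rfl
  | succ t ih =>
    intro p
    simp only [back, ih, Finset.mul_sum]
    exact Finset.sum_comm

lemma Assumptions.back_mono (hA : S.Assumptions σm σp cm Bθ Bω) (hσm : 0 < σm)
    (hN : 1 ≤ N) {F G : (ℕ → X) → ℝ} (hFG : ∀ p, F p ≤ G p) (t : ℕ) :
    (∀ s < t, ∀ j, 0 < w s j) → ∀ p, S.back w x t F p ≤ S.back w x t G p := by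
  induction t with
  | zero => intro _ p; exact hFG p
  | succ t ih =>
    intro hw p
    exact Finset.sum_le_sum fun j _ => mul_le_mul_of_nonneg_left
      (ih (fun s hs => hw s (by omega)) _)
      (hA.backWeight_nonneg hσm hN (hw t (by omega)) _ _)

lemma back_dependsOn {F : (ℕ → X) → ℝ} {A : Set ℕ} (hF : DependsOn F A) (t : ℕ) :
    DependsOn (S.back w x t F) ({t} ∪ A \ Set.Iio t) := by
  induction t with
  | zero => exact hF.mono fun i hi => Or.inr ⟨hi, by simp⟩
  | succ t ih =>
    intro p p' h
    simp only [back]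
    rw [h (t + 1) (by simp)]
    refine Finset.sum_congr rfl fun j _ => ?_
    congr 1
    refine ih fun i hi => ?_
    by_cases hit : i = t
    · subst hit; simp
    · rw [Function.update_of_ne hit, Function.update_of_ne hit]
      refine h i ?_
      rcases hi with hi | hi
      · exact absurd hi hit
      · refine Or.inr ⟨hi.1, fun h2 => hi.2 ?_⟩
        simp only [Set.mem_Iio] at h2 ⊢
        omega

lemma Assumptions.back_eq_self (hA : S.Assumptions σm σp cm Bθ Bω) (hσm : 0 < σm)
    (hN : 1 ≤ N) {F : (ℕ → X) → ℝ} (t : ℕ) :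
    DependsOn F (Set.Ici t) → (∀ s < t, ∀ j, 0 < w s j) → ∀ p, S.back w x t F p = F p := by
  induction t with
  | zero => intro _ _ p; rfl
  | succ t ih =>
    intro hF hw p
    have : ∀ j, F (Function.update p t (x t j)) = F p := fun j => hF fun i hi =>
      Function.update_of_ne (by simp only [Set.mem_Ici] at hi; omega) _ _
    simp only [back]
    simp_rw [ih (hF.mono (Set.Ici_subset_Ici.mpr (by omega))) fun s hs => hw s (by omega), this]
    rw [← Finset.sum_mul, hA.sum_backWeight hσm hN (hw t (by omega)), one_mul]

lemma Assumptions.back_range (hA : S.Assumptions σm σp cm Bθ Bω) (hσm : 0 < σm)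
    (hN : 1 ≤ N) {F : (ℕ → X) → ℝ} {a b : ℝ} (h : ∀ p, a ≤ F p ∧ F p ≤ b) {t : ℕ}
    (hw : ∀ s < t, ∀ j, 0 < w s j) (p : ℕ → X) :
    a ≤ S.back w x t F p ∧ S.back w x t F p ≤ b := by
  have e : ∀ c : ℝ, S.back w x t (fun _ => c) p = c := fun c =>
    hA.back_eq_self hσm hN t (fun _ _ _ => rfl) hw p
  constructor
  · rw [← e a]; exact hA.back_mono hσm hN (fun p => (h p).1) t hw p
  · rw [← e b]; exact hA.back_mono hσm hN (fun p => (h p).2) t hw p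

lemma Assumptions.back_oscLE (hA : S.Assumptions σm σp cm Bθ Bω) (hσm : 0 < σm)
    (hN : 1 ≤ N) {F : (ℕ → X) → ℝ} {D : ℝ} (h : OscLE F D) {t : ℕ}
    (hw : ∀ s < t, ∀ j, 0 < w s j) : OscLE (S.back w x t F) D := by
  obtain ⟨c, hc⟩ := h.exists_range
  exact OscLE.of_range (c := c) (hA.back_range hσm hN hc hw)

/-- Given the next state y, the backward law on the particles has weights w_j m(x_j, y), comparable
for different y whatever the w_j. The backward chain therefore forgets at the same rate as the
forward one. -/
lemma Assumptions.back_contraction (hA : S.Assumptions σm σp cm Bθ Bω) (hσm : 0 < σm)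
    (hN : 1 ≤ N) {F : (ℕ → X) → ℝ} {D : ℝ} (hD : OscLE F D) {s : ℕ}
    (hF : DependsOn F (Set.Iic s)) (n : ℕ) :
    (∀ s' < s + n, ∀ j, 0 < w s' j) →
      OscLE (S.back w x (s + n) F) ((1 - σm / σp) ^ n * D) := by
  induction n with
  | zero => intro hw; simpa using hA.back_oscLE hσm hN hD hw
  | succ n ih =>
    intro hw p p'
    set t := s + n with ht
    have ih' := ih fun s' hs' => hw s' (by omega)
    have hdep : ∀ p j, S.back w x t F (Function.update p t (x t j)) =
        S.back w x t F fun _ => x t j := fun p j => by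
      refine back_dependsOn hF t fun i hi => ?_
      have : i = t := by
        rcases hi with hi | hi
        · exact hi
        · have h1 := hi.1
          have h2 := hi.2
          simp only [Set.mem_Iic, Set.mem_Iio] at h1 h2
          omega
      subst this; simp
    have e : ∀ p, S.back w x (t + 1) F p =
        (∑ j, S.m (x t j) (p (t + 1)) * w t j * S.back w x t F fun _ => x t j) /
          ∑ j, S.m (x t j) (p (t + 1)) * w t j := fun p => by
      simp only [back, hdep, backWeight]
      rw [Finset.sum_div]
      refine Finset.sum_congr rfl fun j _ => ?_
      simp_rw [mul_comm (S.m _ _)]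
      ring
    have hwt : ∀ j, 0 < w t j := hw t (by omega)
    have := sub_le_of_weights_comparable (k := fun j => S.m (x t j) (p (t + 1)))
      (k' := fun j => S.m (x t j) (p' (t + 1))) (q := w t)
      (f := fun j => S.back w x t F fun _ => x t j) hσm (fun j => hA.mixing _ _)
      (fun j => hA.mixing _ _) (fun j => (hwt j).le)
      (Finset.sum_pos (fun l _ => hwt l) ⟨⟨0, hN⟩, Finset.mem_univ _⟩)
      (ih'.comp fun j => (fun _ => x t j))
    rw [show s + (n + 1) = t + 1 by omega, e, e, pow_succ', mul_assoc]
    exact this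

lemma measurable_backWeight (t : ℕ) (j : Fin N) :
    Measurable fun z : ((ℕ → Fin N → ℝ) × (ℕ → Fin N → X)) × X =>
      S.backWeight z.1.1 z.1.2 t z.2 j := by
  have h : ∀ l, Measurable fun z : ((ℕ → Fin N → ℝ) × (ℕ → Fin N → X)) × X =>
      z.1.1 t l * S.m (z.1.2 t l) z.2 := fun l => by
    have h1 : Measurable fun z : ((ℕ → Fin N → ℝ) × (ℕ → Fin N → X)) × X => (z.1.2 t l, z.2) := by
      fun_prop
    have h2 : Measurable fun z : ((ℕ → Fin N → ℝ) × (ℕ → Fin N → X)) × X => z.1.1 t l := by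
      fun_prop
    exact h2.mul (S.measurable_m.comp h1)
  exact (h j).div (Finset.measurable_fun_sum _ fun l _ => h l)

lemma measurable_back {F : (ℕ → X) → ℝ} (hF : Measurable F) (t : ℕ) :
    Measurable fun z : ((ℕ → Fin N → ℝ) × (ℕ → Fin N → X)) × (ℕ → X) =>
      S.back z.1.1 z.1.2 t F z.2 := by
  induction t with
  | zero => exact hF.comp measurable_snd
  | succ t ih =>
    simp only [back]
    refine Finset.measurable_fun_sum _ fun j _ => ?_
    have h1 : Measurable fun z : ((ℕ → Fin N → ℝ) × (ℕ → Fin N → X)) × (ℕ → X) =>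
        (z.1, z.2 (t + 1)) := by fun_prop
    have h2 : Measurable fun z : ((ℕ → Fin N → ℝ) × (ℕ → Fin N → X)) × (ℕ → X) =>
        (z.1, Function.update z.2 t (z.1.2 t j)) :=
      measurable_fst.prodMk ((measurable_update_prod t).comp
        (g := fun z : (ℕ → X) × X => Function.update z.1 t z.2)
        (f := fun z : ((ℕ → Fin N → ℝ) × (ℕ → Fin N → X)) × (ℕ → X) => (z.2, z.1.2 t j))
        (by fun_prop))
    exact ((measurable_backWeight t j).comp h1).mul (ih.comp h2)

lemma Assumptions.bddMeas_back (hA : S.Assumptions σm σp cm Bθ Bω) (hσm : 0 < σm)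
    (hN : 1 ≤ N) {F : (ℕ → X) → ℝ} (hF : BddMeas F) {t : ℕ}
    (hw : ∀ s < t, ∀ j, 0 < w s j) : BddMeas (S.back w x t F) := by
  obtain ⟨K, hK⟩ := hF.bdd
  exact ⟨(measurable_back hF.meas t).comp (measurable_prodMk_left (x := (w, x))), K, fun p =>
    abs_le.mpr (hA.back_range hσm hN (fun p => abs_le.mp (hK p)) hw p)⟩

/-- The backward sums alter only coordinates below t and read none above t, whereas the forward step
alters τ + 1 > t, so the two commute. -/
lemma Assumptions.back_integral (hA : S.Assumptions σm σp cm Bθ Bω) (hσm : 0 < σm)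
    (hN : 1 ≤ N) {H : (ℕ → X) → ℝ} (hH : BddMeas H) (τ t : ℕ) :
    t ≤ τ → (∀ s < t, ∀ j, 0 < w s j) → ∀ p,
      S.back w x t (fun p => ∫ y, S.g (τ + 1) y * H (Function.update p (τ + 1) y) ∂(S.M (p τ))) p =
        ∫ y, S.g (τ + 1) y * S.back w x t H (Function.update p (τ + 1) y) ∂(S.M (p τ)) := by
  induction t with
  | zero => intro _ _ p; rfl
  | succ t ih =>
    intro ht hw p
    have hw' : ∀ s < t, ∀ j, 0 < w s j := fun s hs => hw s (by omega)
    simp only [back]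
    simp_rw [ih (by omega) hw']
    have e1 : ∀ y, Function.update p (τ + 1) y (t + 1) = p (t + 1) := fun y =>
      Function.update_of_ne (by omega) _ _
    have e2 : ∀ j, Function.update p t (x t j) τ = p τ := fun j =>
      Function.update_of_ne (by omega) _ _
    simp_rw [e1, e2, Finset.mul_sum]
    rw [integral_finsetSum]
    · refine Finset.sum_congr rfl fun j _ => ?_
      rw [← integral_const_mul]
      congr 1; ext y
      rw [Function.update_comm (by omega : t ≠ τ + 1)]
      ring
    · intro j _
      refine BddMeas.integrable ((hA.bddMeas_g _).mul ((BddMeas.const _).mul ?_)) _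
      refine (hA.bddMeas_back hσm hN hH hw').comp
        (φ := fun y => Function.update (Function.update p (τ + 1) y) t (x t j)) ?_
      simp_rw [Function.update_comm (by omega : τ + 1 ≠ t)]
      exact measurable_update _

/-- The exponential moments of a functional of the backward chain. -/
lemma Assumptions.back_exp_le (hA : S.Assumptions σm σp cm Bθ Bω) (hσm : 0 < σm)
    (hN : 1 ≤ N) {F : (ℕ → X) → ℝ} {b : ℕ → ℝ} (l : ℝ) (t : ℕ) :
    (∀ s < t, ∀ j, 0 < w s j) →
    (∀ s < t, ∀ p, OscLE (fun j => S.back w x s F (Function.update p s (x s j))) (b s)) →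
    ∀ p, S.back w x t (fun p => Real.exp (l * F p)) p ≤
      Real.exp (l * S.back w x t F p + l ^ 2 * ∑ s ∈ Finset.range t, b s ^ 2) := by
  induction t with
  | zero => intro _ _ p; simp [back]
  | succ t ih =>
    intro hw hb p
    have ih' := ih (fun s hs => hw s (by omega)) (fun s hs => hb s (by omega))
    simp only [back]
    rw [Finset.sum_range_succ]
    calc ∑ j, S.backWeight w x t (p (t + 1)) j *
          S.back w x t (fun p => Real.exp (l * F p)) (Function.update p t (x t j))
        ≤ ∑ j, Real.exp (l ^ 2 * ∑ s ∈ Finset.range t, b s ^ 2) *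
          (S.backWeight w x t (p (t + 1)) j *
            Real.exp (l * S.back w x t F (Function.update p t (x t j)))) := by
          refine Finset.sum_le_sum fun j _ => ?_
          refine (mul_le_mul_of_nonneg_left (ih' _)
            (hA.backWeight_nonneg hσm hN (hw t (by omega)) _ _)).trans (le_of_eq ?_)
          rw [Real.exp_add]; ring
      _ ≤ Real.exp (l ^ 2 * ∑ s ∈ Finset.range t, b s ^ 2) *
          Real.exp (l * ∑ j, S.backWeight w x t (p (t + 1)) j *
            S.back w x t F (Function.update p t (x t j)) + l ^ 2 * b t ^ 2) := by
          rw [← Finset.mul_sum]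
          exact mul_le_mul_of_nonneg_left (sum_mul_exp_le
            (hA.backWeight_nonneg hσm hN (hw t (by omega)) _)
            (hA.sum_backWeight hσm hN (hw t (by omega)) _) (hb t (by omega) p) l)
            (Real.exp_pos _).le
      _ = _ := by rw [← Real.exp_add]; congr 1; ring

/-- Induction on the last index. The coefficient c is arbitrary so that it can absorb the first
backward transition, and p carries the coordinates after T that are already fixed. -/
lemma sum_path_eq_back (T : ℕ) : ∀ (c : Fin N → ℝ) (G : (ℕ → X) → ℝ) (p : ℕ → X),
    ∑ j : Fin (T + 1) → Fin N, c (j (Fin.last T)) *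
        (∏ u : Fin T, S.backMatrix w x u (j u.succ) (j u.castSucc)) *
        G (fun u => if hu : u < T + 1 then x u (j ⟨u, hu⟩) else p u) =
      ∑ i, c i * S.back w x T G (Function.update p T (x T i)) := by
  induction T with
  | zero =>
    intro c G p
    rw [← (Equiv.funUnique (Fin 1) (Fin N)).symm.sum_comp]
    refine Finset.sum_congr rfl fun i _ => ?_
    simp only [Finset.univ_eq_empty, Finset.prod_empty, mul_one, back]
    congr 2
    ext u
    by_cases hu : u < 1
    · obtain rfl : u = 0 := by omega
      simp
    · rw [dif_neg (by omega), Function.update_of_ne (by omega)]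
  | succ T ih =>
    intro c G p
    rw [← (Fin.snocEquiv fun _ : Fin (T + 2) => Fin N).sum_comp, Fintype.sum_prod_type]
    refine Finset.sum_congr rfl fun i _ => ?_
    have := ih (fun j => c i * S.backWeight w x T (x (T + 1) i) j) G
      (Function.update p (T + 1) (x (T + 1) i))
    simp only [back, Function.update_self]
    rw [Finset.mul_sum]
    simp_rw [← mul_assoc]
    rw [← this]
    refine Finset.sum_congr rfl fun j _ => ?_
    have e1 : (Fin.snocEquiv fun _ : Fin (T + 2) => Fin N) (i, j) = Fin.snoc j i := rfl
    rw [e1, Fin.snoc_last, Fin.prod_univ_castSucc]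
    congr 1
    · simp only [Fin.succ_last, Fin.snoc_last, ← Fin.castSucc_succ, Fin.snoc_castSucc,
        Fin.val_castSucc, Fin.val_last]
      simp only [backMatrix, backWeight]
      ring
    · congr 1
      ext u
      rcases lt_trichotomy u (T + 1) with hu | rfl | hu
      · rw [dif_pos (by omega), dif_pos hu]
        congr 1
        exact Fin.snoc_castSucc (α := fun _ => Fin N) i j ⟨u, hu⟩
      · rw [dif_pos (by omega), dif_neg (by omega), Function.update_self]
        congr 1
        exact Fin.snoc_last (α := fun _ => Fin N) i j
      · rw [dif_neg (by omega), dif_neg (by omega), Function.update_of_ne (by omega)]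

lemma ffbs_eq_back (T : ℕ) (F : (Fin (T + 1) → X) → ℝ) :
    S.ffbs T w x F = ∑ i, w T i / (∑ l, w T l) *
      S.back w x T (fun p => F fun u => p u) (fun _ => x T i) := by
  rcases isEmpty_or_nonempty (Fin N) with hN | hN
  · simp [ffbs]
  obtain ⟨i₀⟩ := hN
  have := sum_path_eq_back (S := S) (w := w) (x := x) T (fun i => w T i / ∑ l, w T l)
    (fun p => F fun u => p u) (fun _ => x 0 i₀)
  simp only [ffbs, pathProb]
  have e : ∀ i, S.back w x T (fun p => F fun u => p u) (fun _ => x T i) =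
      S.back w x T (fun p => F fun u => p u) (Function.update (fun _ => x 0 i₀) T (x T i)) :=
    fun i => back_dependsOn (A := Set.Iic T) (fun p p' h => by
      congr 1; ext u; exact h u (by simp only [Set.mem_Iic]; omega)) T fun i hi => by
        have : i = T := by
          rcases hi with hi | hi
          · exact hi
          · have h1 := hi.1
            have h2 := hi.2
            simp only [Set.mem_Iic, Set.mem_Iio] at h1 h2
            omega
        subst this; simp
  simp_rw [e]
  rw [← this]
  refine Finset.sum_congr rfl fun j _ => ?_
  congr 2
  ext u
  simp only [dif_pos u.2]

/-! ### Additive functionals -/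

lemma bddMeas_window {r s : ℕ} {h : ℕ → (Fin (r + 1) → X) → ℝ} (hs : BddMeas (h s)) :
    BddMeas (window r h s) :=
  hs.comp (φ := fun p : ℕ → X => fun i : Fin (r + 1) => p (s - r + i)) (by fun_prop)

lemma oscLE_window {r s : ℕ} {h : ℕ → (Fin (r + 1) → X) → ℝ} (hs : BddMeas (h s)) :
    OscLE (window r h s) (osc (h s)) :=
  (oscLE_osc hs.bdd).comp fun p : ℕ → X => fun i : Fin (r + 1) => p (s - r + i)

/-- A window after t is damped by forward contraction, a window before t by backward contraction,
and a window containing t only has its trivial oscillation. -/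
lemma Assumptions.oscLE_back_fwd (hA : S.Assumptions σm σp cm Bθ Bω) (hσm : 0 < σm)
    (hcm : 0 < cm) [Nonempty X] (hN : 1 ≤ N) {T r : ℕ} {h : ℕ → (Fin (r + 1) → X) → ℝ}
    (hh : ∀ s ∈ Finset.Icc r T, BddMeas (h s)) {t : ℕ} (ht : t ≤ T)
    (hw : ∀ s < t, ∀ j, 0 < w s j) :
    OscLE (S.back w x t (S.fwd (fun p => ∑ s ∈ Finset.Icc r T, window r h s p) t (T - t)))
      (decayBound (1 - σm / σp) T r (fun s => osc (h s)) t) := by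
  have e : S.back w x t (S.fwd (fun p => ∑ s ∈ Finset.Icc r T, window r h s p) t (T - t)) =
      fun p => ∑ s ∈ Finset.Icc r T, S.back w x t (S.fwd (window r h s) t (T - t)) p := by
    rw [← funext fun p => back_sum t p]
    congr 1
    exact funext fun p => hA.fwd_sum (fun s hs => bddMeas_window (hh s hs)) t _ p
  rw [e]
  refine OscLE.sum fun s hs => ?_
  have hs' := Finset.mem_Icc.mp hs
  have hF := bddMeas_window (hh s hs)
  have hD := oscLE_window (hh s hs)
  have hdep := dependsOn_window hs'.1 h
  rcases lt_or_ge t (s - r) with h1 | h1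
  · rw [show t - s + (s - r - t) = s - r - t by omega]
    exact hA.back_oscLE hσm hN (hA.fwd_contraction hσm hcm hF hD hdep (s - r - t) t (T - t)
      (by omega) (by omega)) hw
  · rcases le_or_gt t s with h2 | h2
    · rw [show t - s + (s - r - t) = 0 by omega, pow_zero, one_mul]
      exact hA.back_oscLE hσm hN (hA.fwd_oscLE hcm hF hD t (T - t)) hw
    · have e2 : S.fwd (window r h s) t (T - t) = window r h s := funext fun p =>
        hA.fwd_eq_self hcm (hdep.mono fun i hi => (hi.2.trans h2.le : i ≤ t)) _ p
      obtain ⟨n, rfl⟩ := Nat.exists_eq_add_of_le h2.le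
      rw [e2, show s + n - s + (s - r - (s + n)) = n by omega]
      exact hA.back_contraction hσm hN hD (hdep.mono fun i hi => hi.2) n hw

/-- This is the influence of one backward draw when all later coordinates are fixed. A window
entirely after t does not see the draw and contributes nothing. -/
lemma Assumptions.oscLE_back_update (hA : S.Assumptions σm σp cm Bθ Bω) (hσm : 0 < σm)
    (hσp : σm < σp) (hN : 1 ≤ N) {T r : ℕ} {h : ℕ → (Fin (r + 1) → X) → ℝ}
    (hh : ∀ s ∈ Finset.Icc r T, BddMeas (h s)) {t : ℕ} (hw : ∀ s < t, ∀ j, 0 < w s j)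
    (p : ℕ → X) :
    OscLE (fun j => S.back w x t (fun p => ∑ s ∈ Finset.Icc r T, window r h s p)
        (Function.update p t (x t j)))
      (decayBound (1 - σm / σp) T r (fun s => osc (h s)) t) := by
  simp_rw [back_sum]
  refine OscLE.sum fun s hs => ?_
  have hs' := Finset.mem_Icc.mp hs
  have hD := oscLE_window (hh s hs)
  have hdep := dependsOn_window hs'.1 h
  rcases lt_or_ge t (s - r) with h1 | h1
  · have e : ∀ j, S.back w x t (window r h s) (Function.update p t (x t j)) = window r h s p :=
      fun j => by
        rw [hA.back_eq_self hσm hN t (hdep.mono fun i hi => (h1.le.trans hi.1 : t ≤ i)) hw]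
        exact hdep fun i hi => Function.update_of_ne (by have := hi.1; omega) _ _
    have hκ : 0 ≤ 1 - σm / σp :=
      sub_nonneg.mpr ((div_le_one (hσm.trans hσp)).mpr hσp.le)
    intro i j
    simp only [e, sub_self]
    exact mul_nonneg (pow_nonneg hκ _) (osc_nonneg _)
  · rcases le_or_gt t s with h2 | h2
    · rw [show t - s + (s - r - t) = 0 by omega, pow_zero, one_mul]
      exact (hA.back_oscLE hσm hN hD hw).comp _
    · obtain ⟨n, rfl⟩ := Nat.exists_eq_add_of_le h2.le
      rw [show s + n - s + (s - r - (s + n)) = n by omega]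
      exact (hA.back_contraction hσm hN hD (hdep.mono fun i hi => hi.2) n hw).comp _

end Backward

end ParticleModel

/-! ### One generation of particles as an importance sampling step. -/

namespace ParticleModel

variable {X : Type u} [MeasurableSpace X]

section Step

variable {N : ℕ} {S : ParticleModel X} {σm σp cm Bθ Bω : ℝ}
  {w : ℕ → Fin N → ℝ} {x : ℕ → Fin N → X}

lemma measurable_const_path : Measurable fun y : X => (fun _ : ℕ => y) :=
  measurable_pi_iff.mpr fun _ => measurable_id

lemma back_congr {w' : ℕ → Fin N → ℝ} {x' : ℕ → Fin N → X} {F : (ℕ → X) → ℝ} (t : ℕ) :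
    (∀ s < t, w s = w' s) → (∀ s < t, x s = x' s) →
      ∀ p, S.back w x t F p = S.back w' x' t F p := by
  induction t with
  | zero => intro _ _ p; rfl
  | succ t ih =>
    intro hw hx p
    simp only [back, backWeight, hw t (by omega), hx t (by omega)]
    refine Finset.sum_congr rfl fun j _ => ?_
    rw [ih (fun s hs => hw s (by omega)) (fun s hs => hx s (by omega))]

lemma back_mul {u F : (ℕ → X) → ℝ} (t : ℕ) : DependsOn u (Set.Ici t) →
    ∀ p, S.back w x t (fun p => u p * F p) p = u p * S.back w x t F p := by
  induction t with
  | zero => intro _ p; rfl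
  | succ t ih =>
    intro hu p
    have : ∀ j, u (Function.update p t (x t j)) = u p := fun j => hu fun i hi =>
      Function.update_of_ne (by simp only [Set.mem_Ici] at hi; omega) _ _
    simp only [back]
    simp_rw [ih (hu.mono (Set.Ici_subset_Ici.mpr (by omega))), this]
    rw [Finset.mul_sum]
    exact Finset.sum_congr rfl fun j _ => by ring

/-- The normalising constant depends on the coordinate t alone, which backward integration leaves
untouched. This identifies the numerator of `hybrid` with a weighted sum of conditional
expectations. -/
lemma iterInt_one_mul_back_fwd (hA : S.Assumptions σm σp cm Bθ Bω) (hcm : 0 < cm)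
    (F : (ℕ → X) → ℝ) (t k : ℕ) (p : ℕ → X) :
    S.iterInt (fun _ => 1) t k p * S.back w x t (S.fwd F t k) p =
      S.back w x t (S.iterInt F t k) p := by
  rw [← back_mul (u := S.iterInt (fun _ => 1) t k)]
  · congr 1
    exact funext fun p => hA.fwd_mul hcm F t k p
  · exact fun p p' h => iterInt_one_congr k t (h t (Set.mem_Ici.mpr le_rfl))

/-- The particle approximation at time `t` of the smoothing distribution: the particles describe
the path up to time `t`, the future is integrated out exactly. -/
noncomputable def hybrid (S : ParticleModel X) (T : ℕ) (F : (ℕ → X) → ℝ) (t : ℕ)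
    (w : ℕ → Fin N → ℝ) (x : ℕ → Fin N → X) : ℝ :=
  (∑ i, w t i * S.back w x t (S.iterInt F t (T - t)) fun _ => x t i) /
    ∑ i, w t i * S.iterInt (fun _ => 1) t (T - t) fun _ => x t i

lemma measurable_hybrid {F : (ℕ → X) → ℝ} (hF : Measurable F) (T t : ℕ) :
    Measurable fun y : (ℕ → Fin N → ℝ) × (ℕ → Fin N → X) => S.hybrid T F t y.1 y.2 := by
  have h1 : ∀ i, Measurable fun y : (ℕ → Fin N → ℝ) × (ℕ → Fin N → X) => y.1 t i := fun i => by
    fun_prop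
  have h2 : ∀ i, Measurable fun y : (ℕ → Fin N → ℝ) × (ℕ → Fin N → X) => (fun _ : ℕ => y.2 t i) :=
    fun i => by fun_prop
  refine Measurable.div ?_ ?_
  · exact Finset.measurable_fun_sum _ fun i _ => (h1 i).mul
      ((measurable_back (measurable_iterInt hF _ t) t).comp (measurable_id.prodMk (h2 i)))
  · exact Finset.measurable_fun_sum _ fun i _ => (h1 i).mul
      ((measurable_iterInt measurable_const _ t).comp (h2 i))

lemma hybrid_last (T : ℕ) (F : (Fin (T + 1) → X) → ℝ) :
    S.hybrid T (fun p => F fun u => p u) T w x = S.ffbs T w x F := by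
  rw [ffbs_eq_back, hybrid, Nat.sub_self, Finset.sum_div]
  simp only [iterInt, mul_one]
  exact Finset.sum_congr rfl fun i _ => by rw [div_mul_eq_mul_div]

/-- The update of the arrays of weights and positions by the indices and positions drawn at time
`t + 1`. -/
noncomputable def stepArrays (S : ParticleModel X) (t : ℕ) (y : (ℕ → Fin N → ℝ) × (ℕ → Fin N → X))
    (z : Fin N → Fin N × X) : (ℕ → Fin N → ℝ) × (ℕ → Fin N → X) :=
  (Function.update y.1 (t + 1) fun l => S.weightFun (t + 1) (y.2 t (z l).1) (z l).2,
    Function.update y.2 (t + 1) fun l => (z l).2)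

lemma measurable_weightFun (t : ℕ) : Measurable fun z : X × X => S.weightFun t z.1 z.2 :=
  (S.measurable_m.mul ((S.measurable_g t).comp measurable_snd)).div
    (((S.measurable_θ t).comp measurable_fst).mul (S.measurable_p t))

lemma measurable_eval_index (n : ℕ) {E : Type*} [MeasurableSpace E] :
    Measurable fun z : (Fin n → E) × Fin n => z.1 z.2 :=
  measurable_from_prod_countable_left fun i => measurable_pi_apply i

lemma measurable_stepArrays (t : ℕ) :
    Measurable fun z : ((ℕ → Fin N → ℝ) × (ℕ → Fin N → X)) × (Fin N → Fin N × X) =>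
      S.stepArrays t z.1 z.2 := by
  refine Measurable.prodMk ?_ ?_
  · refine (measurable_update_prod (X := Fin N → ℝ) (t + 1)).comp
      ((by fun_prop : Measurable fun z : ((ℕ → Fin N → ℝ) × (ℕ → Fin N → X)) ×
        (Fin N → Fin N × X) => z.1.1).prodMk (measurable_pi_iff.mpr fun l => ?_))
    have h1 : Measurable fun z : ((ℕ → Fin N → ℝ) × (ℕ → Fin N → X)) × (Fin N → Fin N × X) =>
        z.1.2 t (z.2 l).1 := (measurable_eval_index N).comp
      (f := fun z : ((ℕ → Fin N → ℝ) × (ℕ → Fin N → X)) × (Fin N → Fin N × X) =>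
        (z.1.2 t, (z.2 l).1)) (by fun_prop)
    exact (measurable_weightFun (t + 1)).comp (h1.prodMk (by fun_prop))
  · exact (measurable_update_prod (X := Fin N → X) (t + 1)).comp
      (f := fun z : ((ℕ → Fin N → ℝ) × (ℕ → Fin N → X)) × (Fin N → Fin N × X) =>
        (z.1.2, fun l => (z.2 l).2)) (by fun_prop)

lemma Assumptions.weightFun_pos (hA : S.Assumptions σm σp cm Bθ Bω) (hσm : 0 < σm) {t : ℕ}
    (ht : 1 ≤ t) (y y' : X) : 0 < S.weightFun t y y' :=
  div_pos (mul_pos (hσm.trans_le (hA.mixing _ _).1) (hA.g_pos _ _))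
    (mul_pos (hA.θ_pos t ht _) (hA.p_pos t ht _ _))

lemma Assumptions.sum_weight_mul_θ_pos (hA : S.Assumptions σm σp cm Bθ Bω) (hN : 1 ≤ N) {t : ℕ}
    (ht : 1 ≤ t) {w₁ : Fin N → ℝ} (hw : ∀ j, 0 < w₁ j) (x₁ : Fin N → X) :
    0 < ∑ i, w₁ i * S.θ t (x₁ i) :=
  Finset.sum_pos (fun l _ => mul_pos (hw l) (hA.θ_pos t ht _)) ⟨⟨0, hN⟩, Finset.mem_univ _⟩

lemma Assumptions.isProbabilityMeasure_instrumental (hA : S.Assumptions σm σp cm Bθ Bω)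
    (hN : 1 ≤ N) {t : ℕ} (ht : 1 ≤ t) {w₁ : Fin N → ℝ} (hw : ∀ j, 0 < w₁ j) (x₁ : Fin N → X) :
    IsProbabilityMeasure (S.instrumental t w₁ x₁) := by
  have := S.markov_P t ht
  have hpos := hA.sum_weight_mul_θ_pos hN ht hw x₁
  refine ⟨?_⟩
  simp only [instrumental, Measure.finsetSum_apply, Measure.smul_apply, measure_univ, smul_eq_mul,
    mul_one]
  rw [← ENNReal.ofReal_sum_of_nonneg fun i _ =>
    div_nonneg (mul_pos (hw i) (hA.θ_pos t ht _)).le hpos.le, ← Finset.sum_div,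
    div_self hpos.ne', ENNReal.ofReal_one]

lemma integral_P {t : ℕ} (ht : 1 ≤ t)
    (hp : ∀ y y', 0 < S.p t y y') (y : X) (f : X → ℝ) :
    ∫ y', f y' ∂(S.P t y) = ∫ y', S.p t y y' * f y' ∂S.lam := by
  have hm : Measurable (S.p t y) := (S.measurable_p t).comp (measurable_prodMk_left)
  rw [S.P_eq t ht, integral_withDensity_eq_integral_toReal_smul (by fun_prop)
    (ae_of_all _ fun y => ENNReal.ofReal_lt_top)]
  simp [ENNReal.toReal_ofReal (hp y _).le]

lemma Assumptions.bddMeas_weight (hA : S.Assumptions σm σp cm Bθ Bω) (hσm : 0 < σm) {t : ℕ}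
    (ht : 1 ≤ t) (x₁ : Fin N → X) :
    BddMeas fun z : Fin N × X => S.weightFun t (x₁ z.1) z.2 := by
  have h1 : Measurable fun z : Fin N × X => x₁ z.1 := (Measurable.of_discrete).comp measurable_fst
  exact ⟨(measurable_weightFun t).comp (h1.prodMk measurable_snd), Bω, fun z => by
    rw [abs_of_pos (hA.weightFun_pos hσm ht _ _)]
    exact hA.weight_succ_le t ht _ _⟩

/-- The importance weight is designed to cancel both the adjustment multiplier and the proposal
density, leaving m g. -/
lemma Assumptions.integral_instrumental (hA : S.Assumptions σm σp cm Bθ Bω) (hσm : 0 < σm)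
    (hN : 1 ≤ N) {t : ℕ} (ht : 1 ≤ t) {w₁ : Fin N → ℝ} (hw : ∀ j, 0 < w₁ j) (x₁ : Fin N → X)
    {φ : X → ℝ} (hφ : BddMeas φ) :
    ∫ z, S.weightFun t (x₁ z.1) z.2 * φ z.2 ∂(S.instrumental t w₁ x₁) =
      (∑ i, w₁ i * ∫ y, S.g t y * φ y ∂(S.M (x₁ i))) / ∑ i, w₁ i * S.θ t (x₁ i) := by
  have := S.markov_P t ht
  have hpos := hA.sum_weight_mul_θ_pos hN ht hw x₁
  have hB := (hA.bddMeas_weight hσm ht x₁).mul (hφ.comp measurable_snd)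
  have hcoef : ∀ i, 0 ≤ w₁ i * S.θ t (x₁ i) / ∑ i, w₁ i * S.θ t (x₁ i) := fun i =>
    div_nonneg (mul_pos (hw i) (hA.θ_pos t ht _)).le hpos.le
  rw [instrumental, integral_finsetSum_measure fun i _ =>
    (hB.integrable _).smul_measure ENNReal.ofReal_ne_top, Finset.sum_div]
  refine Finset.sum_congr rfl fun i _ => ?_
  rw [integral_smul_measure, ENNReal.toReal_ofReal (hcoef i), Measure.dirac_prod,
    integral_map measurable_prodMk_left.aemeasurable hB.meas.aestronglyMeasurable,
    integral_P ht (hA.p_pos t ht), integral_M, smul_eq_mul, mul_div_right_comm, mul_assoc,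
    div_mul_eq_mul_div, ← integral_const_mul]
  congr 3; ext y
  have h1 := (hA.θ_pos t ht (x₁ i)).ne'
  have h2 := (hA.p_pos t ht (x₁ i) y).ne'
  simp only [weightFun]
  field_simp

/-- Bayes' formula for the particles: moving forward from the weighted mixture to y and drawing the
ancestor backwards is the same as choosing an ancestor and moving forward from it. The mixture has
density ∑ w_i m(x_i, y), the denominator of the backward weights, which cancels. This makes the
hybrid at t the exact target of generation t + 1. -/
lemma Assumptions.sum_integral_back (hA : S.Assumptions σm σp cm Bθ Bω) (hσm : 0 < σm)
    (hN : 1 ≤ N) [Nonempty X] {F : (ℕ → X) → ℝ} (hF : BddMeas F) {t k : ℕ}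
    (hFdep : DependsOn F (Set.Iic (t + 1 + k))) (hw : ∀ s ≤ t, ∀ j, 0 < w s j) :
    ∑ i, w t i * ∫ y, S.g (t + 1) y *
        S.back w x (t + 1) (S.iterInt F (t + 1) k) (fun _ => y) ∂(S.M (x t i)) =
      ∑ i, w t i * S.back w x t (S.iterInt F t (k + 1)) fun _ => x t i := by
  have hlam := hA.isFiniteMeasure_lam hσm
  set H := S.iterInt F (t + 1) k with hH
  have hHB : BddMeas H := hA.bddMeas_iterInt hF k _
  have hHdep : DependsOn H (Set.Iic (t + 1)) := (iterInt_dependsOn hFdep k (t + 1)).mono fun i hi => by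
    rcases hi with rfl | hi
    · exact Set.mem_Iic.mpr le_rfl
    · have h1 := hi.1
      have h2 := hi.2
      simp only [Set.mem_Iic, Set.mem_Ioc] at *
      omega
  have hw' : ∀ s < t, ∀ j, 0 < w s j := fun s hs => hw s hs.le
  -- Only the coordinates t and t + 1 matter, and both paths carry x t j and y there.
  have hV : ∀ j y, S.back w x t H (Function.update (fun _ => y) t (x t j)) =
      S.back w x t H (Function.update (fun _ => x t j) (t + 1) y) := fun j y => by
    refine back_dependsOn hHdep t fun i hi => ?_
    have : i = t ∨ i = t + 1 := by
      rcases hi with hi | hi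
      · exact Or.inl hi
      · have h1 := hi.1
        have h2 := hi.2
        simp only [Set.mem_Iic, Set.mem_Iio] at h1 h2
        omega
    rcases this with rfl | rfl
    · simp
    · simp
  have e1 : ∀ j, S.back w x t (S.iterInt F t (k + 1)) (fun _ => x t j) =
      ∫ y, S.g (t + 1) y * S.back w x t H (Function.update (fun _ => y) t (x t j)) ∂(S.M (x t j)) :=
    fun j => by
      simp_rw [hV]
      exact hA.back_integral hσm hN hHB t t le_rfl hw' (fun _ => x t j)
  have hmm : ∀ y, BddMeas (S.m y) := fun y =>
    ⟨S.measurable_m.comp measurable_prodMk_left, σp, fun y' => by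
      rw [abs_of_nonneg (S.m_nonneg _ _)]; exact (hA.mixing _ _).2⟩
  have hback : BddMeas fun y : X => S.back w x (t + 1) H fun _ => y :=
    (hA.bddMeas_back hσm hN hHB fun s hs => hw s (by omega)).comp measurable_const_path
  have hVB : ∀ j, BddMeas fun y => S.back w x t H (Function.update (fun _ => y) t (x t j)) :=
    fun j => by
      simp_rw [hV]
      exact (hA.bddMeas_back hσm hN hHB hw').comp (measurable_update _)
  simp_rw [e1, integral_M, ← integral_const_mul]
  rw [← integral_finsetSum, ← integral_finsetSum]
  · congr 1; ext y
    have hpos := (hA.sum_weight_mul_pos (x := x) hσm hN (hw t le_rfl) y).ne'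
    have e2 : ∀ c : ℝ, ∑ i, w t i * (S.m (x t i) y * (S.g (t + 1) y * c)) =
        (∑ i, w t i * S.m (x t i) y) * (S.g (t + 1) y * c) := fun c => by
      rw [Finset.sum_mul]; exact Finset.sum_congr rfl fun i _ => by ring
    rw [e2]
    simp only [back, backWeight]
    rw [Finset.mul_sum, Finset.mul_sum]
    refine Finset.sum_congr rfl fun i _ => ?_
    field_simp
  · intro i _
    exact (((hmm _).mul ((hA.bddMeas_g _).mul (hVB i))).integrable _).const_mul _
  · intro i _
    exact (((hmm _).mul ((hA.bddMeas_g _).mul hback)).integrable _).const_mul _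

/-- Given the past, the new hybrid is a self-normalised mean of R with weights b, where R integrates
F over both the future and the past of the new particle. Its target is the old hybrid, so the bound
follows from `lintegral_exp_weighted_mean_le` and the oscillation of R. -/
lemma Assumptions.lintegral_exp_hybrid_succ_le (hA : S.Assumptions σm σp cm Bθ Bω) (hσm : 0 < σm)
    (hcm : 0 < cm) [Nonempty X] (hN : 1 ≤ N) {T r : ℕ} {h : ℕ → (Fin (r + 1) → X) → ℝ}
    (hh : ∀ s ∈ Finset.Icc r T, BddMeas (h s)) {t : ℕ} (ht : t < T)
    (hw : ∀ s ≤ t, ∀ j, 0 < w s j) (l : ℝ) :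
    ∫⁻ z, ENNReal.ofReal (Real.exp (l *
        (S.hybrid T (fun p => ∑ s ∈ Finset.Icc r T, window r h s p) (t + 1)
          (S.stepArrays t (w, x) z).1 (S.stepArrays t (w, x) z).2 -
        S.hybrid T (fun p => ∑ s ∈ Finset.Icc r T, window r h s p) t w x)))
        ∂(Measure.pi fun _ : Fin N => S.instrumental (t + 1) (w t) (x t)) ≤
      ENNReal.ofReal (Real.exp (128 * (Bω / (σm / σp)) ^ 2 / (σm / σp * cm / Bθ) ^ 2 *
        ((l * decayBound (1 - σm / σp) T r (fun s => osc (h s)) (t + 1)) ^ 2 +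
          |l * decayBound (1 - σm / σp) T r (fun s => osc (h s)) (t + 1)|) / N)) := by
  set F : (ℕ → X) → ℝ := fun p => ∑ s ∈ Finset.Icc r T, window r h s p with hFdef
  have hF : BddMeas F := BddMeas.sum fun s hs => bddMeas_window (hh s hs)
  have hFdep : DependsOn F (Set.Iic T) := fun p p' hp => Finset.sum_congr rfl fun s hs =>
    dependsOn_window (Finset.mem_Icc.mp hs).1 h fun i hi =>
      hp i (hi.2.trans (Finset.mem_Icc.mp hs).2)
  obtain ⟨k, hk⟩ : ∃ k, T = t + 1 + k := Nat.exists_eq_add_of_le ht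
  have hk1 : T - (t + 1) = k := by omega
  have hk2 : T - t = k + 1 := by omega
  have hprob := hA.isProbabilityMeasure_instrumental hN (Nat.le_add_left 1 t) (hw t le_rfl) (x t)
  obtain ⟨x₀⟩ := ‹Nonempty X›
  have hX : Nonempty X := ⟨x₀⟩
  have hσ := (hA.mixing x₀ x₀).1.trans (hA.mixing x₀ x₀).2
  have hσp : 0 < σp := hσm.trans_le hσ
  have hκ : 0 < σm / σp := div_pos hσm hσp
  have hBθ : 0 < Bθ := (hA.θ_pos (t + 1) (by omega) x₀).trans_le (hA.θ_le (t + 1) (by omega) x₀)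
  set L : X → ℝ := fun y => S.iterInt (fun _ => 1) (t + 1) k fun _ => y with hL
  -- Division by the value at a reference point leaves every ratio unchanged and bounds the weights
  -- uniformly in the remaining horizon.
  set L₀ := L x₀ with hL₀
  have hL0 : ∀ y, 0 < L y := fun y => hA.iterInt_one_pos hcm _ _ _
  have hLB : BddMeas L := (hA.bddMeas_iterInt (BddMeas.const 1) k _).comp measurable_const_path
  set b : Fin N × X → ℝ := fun z => S.weightFun (t + 1) (x t z.1) z.2 * (L z.2 / L₀) with hb
  set R : Fin N × X → ℝ := fun z => S.back w x (t + 1) (S.fwd F (t + 1) k) fun _ => z.2 with hR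
  have hw' : ∀ s < t + 1, ∀ j, 0 < w s j := fun s hs => hw s (by omega)
  have hosc := hA.oscLE_back_fwd (x := x) hσm hcm hN hh ht hw'
  rw [hk1, ← hFdef] at hosc
  obtain ⟨c, hc⟩ := hosc.exists_range
  have hfB := hA.bddMeas_fwd hcm hF (t + 1) k
  have hRB : BddMeas R := ((hA.bddMeas_back (x := x) hσm hN hfB hw').comp measurable_const_path).comp
    measurable_snd
  have hLL : BddMeas fun y => L y / L₀ := by
    simp_rw [div_eq_mul_inv]; exact hLB.mul (BddMeas.const _)
  have hbB : BddMeas b := (hA.bddMeas_weight hσm (Nat.le_add_left 1 t) (x t)).mul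
    (hLL.comp measurable_snd)
  have hbpos : ∀ z, 0 < b z := fun z =>
    mul_pos (hA.weightFun_pos hσm (Nat.le_add_left 1 t) _ _) (div_pos (hL0 _) (hL0 _))
  have hble : ∀ z, b z ≤ Bω / (σm / σp) := fun z => by
    have h1 := hA.weight_succ_le (t + 1) (by omega) (x t z.1) z.2
    have h2 : L z.2 / L₀ ≤ 1 / (σm / σp) := by
      rw [div_le_div_iff₀ (hL0 _) hκ, one_mul, mul_comm]
      exact hA.iterInt_one_ratio hσm hcm (t + 1) k _ _
    have h3 := hA.weightFun_pos hσm (Nat.le_add_left 1 t) (x t z.1) z.2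
    rw [div_eq_mul_one_div]
    exact mul_le_mul h1 h2 (div_pos (hL0 _) (hL0 _)).le (h3.le.trans h1)
  have hθpos := hA.sum_weight_mul_θ_pos hN (Nat.le_add_left 1 t) (hw t le_rfl) (x t)
  have hbint : ∫ z, b z ∂(S.instrumental (t + 1) (w t) (x t)) =
      (∑ i, w t i * ∫ y, S.g (t + 1) y * (L y / L₀) ∂(S.M (x t i))) /
        ∑ i, w t i * S.θ (t + 1) (x t i) :=
    hA.integral_instrumental hσm hN (Nat.le_add_left 1 t) (hw t le_rfl) (x t) hLL
  have hβ : σm / σp * cm / Bθ ≤ ∫ z, b z ∂(S.instrumental (t + 1) (w t) (x t)) := by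
    rw [hbint, div_le_div_iff₀ hBθ hθpos, Finset.mul_sum, Finset.sum_mul]
    refine Finset.sum_le_sum fun i _ => ?_
    have h1 : σm / σp * cm ≤ ∫ y, S.g (t + 1) y * (L y / L₀) ∂(S.M (x t i)) := by
      refine (mul_le_mul_of_nonneg_left (hA.lower_succ (t + 1) (by omega) (x t i)) hκ.le).trans ?_
      rw [← integral_const_mul]
      refine integral_mono (((hA.bddMeas_g _).integrable _).const_mul _)
        (((hA.bddMeas_g _).mul hLL).integrable _) fun y => ?_
      simp only
      rw [mul_comm]
      refine mul_le_mul_of_nonneg_left ?_ (hA.g_pos _ _).le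
      rw [le_div_iff₀ (hL0 _)]
      exact hA.iterInt_one_ratio hσm hcm (t + 1) k _ _
    have h2 := hA.θ_le (t + 1) (by omega) (x t i)
    have h3 := (hA.θ_pos (t + 1) (by omega) (x t i)).le
    have h4 := (hw t le_rfl i).le
    calc σm / σp * cm * (w t i * S.θ (t + 1) (x t i))
        = w t i * (σm / σp * cm * S.θ (t + 1) (x t i)) := by ring
      _ ≤ w t i * ((∫ y, S.g (t + 1) y * (L y / L₀) ∂(S.M (x t i))) * Bθ) := by
          refine mul_le_mul_of_nonneg_left ?_ h4
          exact mul_le_mul h1 h2 h3 ((mul_pos hκ hcm).le.trans h1)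
      _ = _ := by ring
  have hQ : (∫ z, b z * R z ∂(S.instrumental (t + 1) (w t) (x t))) /
      ∫ z, b z ∂(S.instrumental (t + 1) (w t) (x t)) = S.hybrid T F t w x := by
    have e1 : ∫ z, b z * R z ∂(S.instrumental (t + 1) (w t) (x t)) =
        (∑ i, w t i * ∫ y, S.g (t + 1) y * (S.back w x (t + 1) (S.iterInt F (t + 1) k)
          (fun _ => y) / L₀) ∂(S.M (x t i))) / ∑ i, w t i * S.θ (t + 1) (x t i) := by
      rw [← hA.integral_instrumental hσm hN (Nat.le_add_left 1 t) (hw t le_rfl) (x t)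
        (φ := fun y => S.back w x (t + 1) (S.iterInt F (t + 1) k) (fun _ => y) / L₀)]
      · congr 1; ext z
        simp only [hb, hR, ← iterInt_one_mul_back_fwd hA hcm F (t + 1) k, hL]
        ring
      · simp_rw [div_eq_mul_inv]
        exact BddMeas.mul ((hA.bddMeas_back hσm hN (hA.bddMeas_iterInt hF k _) hw').comp
          measurable_const_path) (BddMeas.const _)
    rw [e1, hbint]
    simp_rw [← mul_div_assoc, integral_div, ← mul_div_assoc, ← Finset.sum_div]
    rw [div_div_div_cancel_right₀ hθpos.ne', div_div_div_cancel_right₀ (hL0 _).ne',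
      hA.sum_integral_back hσm hN hF (hk ▸ hFdep) hw, hybrid, hk2]
    congr 1
    refine Finset.sum_congr rfl fun i _ => ?_
    simp only [hL, iterInt]
    congr 2
    ext y
    congr 1
    exact iterInt_one_congr _ _ (by simp)
  have key := lintegral_exp_weighted_mean_le hbB.meas hRB.meas
    (by positivity : 0 < σm / σp * cm / Bθ) (fun z => (hbpos z).le) (ae_of_all _ hbpos) hble hβ
    (fun z => hc _) hN l
  rw [hQ] at key
  refine le_trans (le_of_eq ?_) key
  congr 1; ext z
  congr 5
  simp only [hybrid, hk1, stepArrays, Function.update_self]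
  -- Backward integration from t + 1 reads only the arrays at times up to t, so the new generation
  -- does not affect it.
  have e2 : ∀ p, S.back (Function.update w (t + 1) fun l => S.weightFun (t + 1) (x t (z l).1) (z l).2)
      (Function.update x (t + 1) fun l => (z l).2) (t + 1) (S.iterInt F (t + 1) k) p =
      S.back w x (t + 1) (S.iterInt F (t + 1) k) p := fun p =>
    back_congr (t + 1) (fun s hs => Function.update_of_ne (by omega) _ _)
      (fun s hs => Function.update_of_ne (by omega) _ _) p
  simp only [e2, hb, hR, ← iterInt_one_mul_back_fwd hA hcm F (t + 1) k]
  have e3 : ∀ i, S.weightFun (t + 1) (x t (z i).1) (z i).2 * (L (z i).2 / L₀) *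
      S.back w x (t + 1) (S.fwd F (t + 1) k) (fun _ => (z i).2) =
      S.weightFun (t + 1) (x t (z i).1) (z i).2 * (L (z i).2 *
      S.back w x (t + 1) (S.fwd F (t + 1) k) (fun _ => (z i).2)) / L₀ := fun i => by ring
  simp_rw [e3, ← mul_div_assoc, ← Finset.sum_div]
  rw [div_div_div_cancel_right₀ (hL0 _).ne']

lemma integral_ρ₀ (S : ParticleModel X) (f : X → ℝ) :
    ∫ y, S.dχ y * f y ∂S.ρ₀ = ∫ y, f y ∂S.χ := by
  have := S.measurable_dχ
  rw [S.χ_eq, integral_withDensity_eq_integral_toReal_smul (by fun_prop)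
    (ae_of_all _ fun y => ENNReal.ofReal_lt_top)]
  simp [ENNReal.toReal_ofReal (S.dχ_nonneg _)]

/-- The first generation follows the same scheme: the initial weight turns integrals under ρ₀ into
integrals of g₀ under χ, and the target is the smoothing expectation itself. -/
lemma Assumptions.lintegral_exp_hybrid_zero_le (hA : S.Assumptions σm σp cm Bθ Bω) (hσm : 0 < σm)
    (hcm : 0 < cm) [Nonempty X] (hN : 1 ≤ N) {T r : ℕ} {h : ℕ → (Fin (r + 1) → X) → ℝ}
    (hh : ∀ s ∈ Finset.Icc r T, BddMeas (h s))
    {y : (Fin N → X) → (ℕ → Fin N → ℝ) × (ℕ → Fin N → X)}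
    (hy1 : ∀ z i, (y z).1 0 i = S.weightFun₀ (z i)) (hy2 : ∀ z, (y z).2 0 = z) (l : ℝ) :
    ∫⁻ z, ENNReal.ofReal (Real.exp (l *
        (S.hybrid T (fun p => ∑ s ∈ Finset.Icc r T, window r h s p) 0 (y z).1 (y z).2 -
        S.smooth T (additiveFunctional T r h)))) ∂(Measure.pi fun _ : Fin N => S.ρ₀) ≤
      ENNReal.ofReal (Real.exp (128 * (Bω / (σm / σp)) ^ 2 / (σm / σp * cm) ^ 2 *
        ((l * decayBound (1 - σm / σp) T r (fun s => osc (h s)) 0) ^ 2 +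
          |l * decayBound (1 - σm / σp) T r (fun s => osc (h s)) 0|) / N)) := by
  have hFeq : (fun p : ℕ → X => additiveFunctional T r h fun u => p u) =
      fun p => ∑ s ∈ Finset.Icc r T, window r h s p :=
    funext fun p => additiveFunctional_eq_sum_window T r h p
  set F : (ℕ → X) → ℝ := fun p => ∑ s ∈ Finset.Icc r T, window r h s p with hFdef
  have hF : BddMeas F := BddMeas.sum fun s hs => bddMeas_window (hh s hs)
  obtain ⟨x₀⟩ := ‹Nonempty X›
  have hX : Nonempty X := ⟨x₀⟩
  have hσ := (hA.mixing x₀ x₀).1.trans (hA.mixing x₀ x₀).2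
  have hσp : 0 < σp := hσm.trans_le hσ
  have hκ : 0 < σm / σp := div_pos hσm hσp
  set L : X → ℝ := fun y => S.iterInt (fun _ => 1) 0 T fun _ => y with hL
  set L₀ := L x₀ with hL₀
  have hL0 : ∀ y, 0 < L y := fun y => hA.iterInt_one_pos hcm _ _ _
  have hLB : BddMeas L := (hA.bddMeas_iterInt (BddMeas.const 1) T _).comp measurable_const_path
  set b : X → ℝ := fun z => S.weightFun₀ z * (L z / L₀) with hb
  set R : X → ℝ := fun z => S.fwd F 0 T fun _ => z with hR
  -- At time 0 there is nothing to integrate backwards, so arbitrary arrays may be supplied.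
  have hosc := hA.oscLE_back_fwd (x := fun _ (_ : Fin N) => x₀) (w := fun _ _ => 1) hσm hcm hN hh
    (Nat.zero_le T) (by simp)
  rw [Nat.sub_zero, ← hFdef] at hosc
  obtain ⟨c, hc⟩ := hosc.exists_range
  have hfB := hA.bddMeas_fwd hcm hF 0 T
  have hRB : BddMeas R := hfB.comp measurable_const_path
  have hLL : BddMeas fun y => L y / L₀ := by
    simp_rw [div_eq_mul_inv]; exact hLB.mul (BddMeas.const _)
  have hw0 : ∀ z, 0 ≤ S.weightFun₀ z := fun z => mul_nonneg (S.dχ_nonneg z) (hA.g_pos 0 z).le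
  have hwm : Measurable S.weightFun₀ := S.measurable_dχ.mul (S.measurable_g 0)
  have hwB : BddMeas S.weightFun₀ := ⟨hwm, Bω, fun z => by
    rw [abs_of_nonneg (hw0 z)]; exact hA.weight_zero_le z⟩
  have hbB : BddMeas b := hwB.mul hLL
  have hb0 : ∀ z, 0 ≤ b z := fun z => mul_nonneg (hw0 z) (div_pos (hL0 _) (hL0 _)).le
  have hbpos : ∀ᵐ z ∂S.ρ₀, 0 < b z := by
    filter_upwards [hA.dχ_pos] with z hz
    exact mul_pos (mul_pos hz (hA.g_pos 0 z)) (div_pos (hL0 _) (hL0 _))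
  have hble : ∀ z, b z ≤ Bω / (σm / σp) := fun z => by
    have h1 := hA.weight_zero_le z
    have h2 : L z / L₀ ≤ 1 / (σm / σp) := by
      rw [div_le_div_iff₀ (hL0 _) hκ, one_mul, mul_comm]
      exact hA.iterInt_one_ratio hσm hcm 0 T _ _
    rw [div_eq_mul_one_div]
    exact mul_le_mul h1 h2 (div_pos (hL0 _) (hL0 _)).le ((hw0 z).trans h1)
  have hint : ∀ φ : X → ℝ, ∫ z, S.weightFun₀ z * φ z ∂S.ρ₀ = ∫ z, S.g 0 z * φ z ∂S.χ := fun φ => by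
    rw [← integral_ρ₀]; simp only [weightFun₀, mul_assoc]
  have hβ : σm / σp * cm ≤ ∫ z, b z ∂S.ρ₀ := by
    simp only [hb]
    rw [hint fun z => L z / L₀]
    refine (mul_le_mul_of_nonneg_left hA.lower_zero hκ.le).trans ?_
    rw [← integral_const_mul]
    refine integral_mono (((hA.bddMeas_g _).integrable _).const_mul _)
      (((hA.bddMeas_g _).mul hLL).integrable _) fun y => ?_
    simp only
    rw [mul_comm]
    refine mul_le_mul_of_nonneg_left ?_ (hA.g_pos _ _).le
    rw [le_div_iff₀ (hL0 _)]
    exact hA.iterInt_one_ratio hσm hcm 0 T _ _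
  have hQ : (∫ z, b z * R z ∂S.ρ₀) / ∫ z, b z ∂S.ρ₀ = S.smooth T (additiveFunctional T r h) := by
    have e1 : ∀ z, b z * R z = S.weightFun₀ z * (S.iterInt F 0 T (fun _ => z) / L₀) := fun z => by
      rw [← hA.fwd_mul hcm F 0 T]; simp only [hb, hR, hL]; ring
    simp_rw [e1]
    simp only [hb]
    rw [hint fun z => L z / L₀, hint fun z => S.iterInt F 0 T (fun _ => z) / L₀]
    simp_rw [← mul_div_assoc, integral_div]
    rw [div_div_div_cancel_right₀ (hL0 _).ne', smooth, unnormSmooth, unnormSmooth, hFeq]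
  have key := lintegral_exp_weighted_mean_le hbB.meas hRB.meas
    (by positivity : 0 < σm / σp * cm) hb0 hbpos hble hβ (fun z => hc _) hN l
  rw [hQ] at key
  refine le_trans (le_of_eq ?_) key
  congr 1; ext z
  congr 5
  simp only [hybrid, Nat.sub_zero, hy1, hy2, back, hb, hR, ← hA.fwd_mul hcm F 0 T]
  have e3 : ∀ i, S.weightFun₀ (z i) * (L (z i) / L₀) * S.fwd F 0 T (fun _ => z i) =
      S.weightFun₀ (z i) * (L (z i) * S.fwd F 0 T (fun _ => z i)) / L₀ := fun i => by ring
  simp_rw [e3, ← mul_div_assoc, ← Finset.sum_div]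
  rw [div_div_div_cancel_right₀ (hL0 _).ne']

end Step

end ParticleModel

/-! ### The random particle system: conditioning on the past. -/

namespace ParticleModel

variable {X : Type u} [MeasurableSpace X]

/-- The weights and the positions of the particles, frozen after time `t`. -/
noncomputable def arrays {N : ℕ} {Ω : Type v} (S : ParticleModel X) (ξ : ℕ → Fin N → Ω → X)
    (I : ℕ → Fin N → Ω → Fin N) (t : ℕ) (ω : Ω) : (ℕ → Fin N → ℝ) × (ℕ → Fin N → X) :=
  (fun s i => S.weight ξ I (min s t) i ω, fun s i => ξ (min s t) i ω)

lemma stepArrays_arrays {N : ℕ} {S : ParticleModel X} {Ω : Type v} {ξ : ℕ → Fin N → Ω → X}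
    {I : ℕ → Fin N → Ω → Fin N} (t : ℕ) (ω : Ω) :
    (∀ s ≤ t + 1, (fun i => S.weight ξ I s i ω) = (S.stepArrays t (S.arrays ξ I t ω)
      fun i => (I (t + 1) i ω, ξ (t + 1) i ω)).1 s) ∧
    (∀ s ≤ t + 1, (fun i => ξ s i ω) = (S.stepArrays t (S.arrays ξ I t ω)
      fun i => (I (t + 1) i ω, ξ (t + 1) i ω)).2 s) := by
  constructor <;> intro s hs <;> rcases eq_or_ne s (t + 1) with rfl | hne
  · simp [stepArrays, arrays, weight]
  · simp [stepArrays, arrays, Function.update_of_ne hne, min_eq_left (by omega : s ≤ t)]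
  · simp [stepArrays]
  · simp [stepArrays, arrays, Function.update_of_ne hne, min_eq_left (by omega : s ≤ t)]

/-- Freezing after time t is what makes whole arrays measurable with respect to the past, so that
the conditional laws apply to them. -/
lemma measurable_arrays_history {N : ℕ} {S : ParticleModel X} {Ω : Type v}
    {ξ : ℕ → Fin N → Ω → X} {I : ℕ → Fin N → Ω → Fin N} (t : ℕ) :
    Measurable[S.history ξ I t] (S.arrays ξ I t) := by
  let _ : MeasurableSpace Ω := S.history ξ I t
  have h : ∀ s i, Measurable fun ω => (ξ (min s t) i ω, S.weight ξ I (min s t) i ω) := fun s i =>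
    Measurable.mono (comap_measurable _)
      (le_iSup_of_le (min s t) (le_iSup_of_le (min_le_right s t) (le_iSup_of_le i le_rfl))) le_rfl
  refine Measurable.prodMk ?_ ?_
  · exact measurable_pi_iff.mpr fun s => measurable_pi_iff.mpr fun i => (h s i).snd
  · exact measurable_pi_iff.mpr fun s => measurable_pi_iff.mpr fun i => (h s i).fst

section System

variable {N : ℕ} {S : ParticleModel X} {σm σp cm Bθ Bω : ℝ}
  {Ω : Type v} [MeasurableSpace Ω] {μ : Measure Ω} {T : ℕ}
  {ξ : ℕ → Fin N → Ω → X} {I : ℕ → Fin N → Ω → Fin N}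

lemma hybrid_congr {w w' : ℕ → Fin N → ℝ} {x x' : ℕ → Fin N → X} (F : (ℕ → X) → ℝ) (t : ℕ)
    (hw : ∀ s ≤ t, w s = w' s) (hx : ∀ s ≤ t, x s = x' s) :
    S.hybrid T F t w x = S.hybrid T F t w' x' := by
  simp only [hybrid, hw t le_rfl, hx t le_rfl]
  congr 1
  exact Finset.sum_congr rfl fun i _ => by
    rw [back_congr t (fun s hs => hw s hs.le) (fun s hs => hx s hs.le)]

lemma IsForwardPass.measurable_weight (hFP : S.IsForwardPass T μ ξ I) (t : ℕ) (i : Fin N) :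
    Measurable (S.weight ξ I t i) := by
  rcases t with _ | t
  · exact (S.measurable_dχ.mul (S.measurable_g 0)).comp (hFP.measurable_ξ 0 i)
  · have h1 : Measurable fun ω => ξ t (I (t + 1) i ω) ω :=
      (measurable_eval_index N).comp (f := fun ω => ((fun j => ξ t j ω), I (t + 1) i ω))
        ((measurable_pi_iff.mpr fun j => hFP.measurable_ξ t j).prodMk (hFP.measurable_I _ _))
    exact (measurable_weightFun (t + 1)).comp (h1.prodMk (hFP.measurable_ξ (t + 1) i))

lemma IsForwardPass.measurable_arrays (hFP : S.IsForwardPass T μ ξ I) (t : ℕ) :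
    Measurable (S.arrays ξ I t) := by
  unfold arrays
  refine Measurable.prodMk ?_ ?_
  · exact measurable_pi_iff.mpr fun _ => measurable_pi_iff.mpr fun _ => hFP.measurable_weight _ _
  · exact measurable_pi_iff.mpr fun _ => measurable_pi_iff.mpr fun _ => hFP.measurable_ξ _ _

lemma IsForwardPass.map_zero (hFP : S.IsForwardPass T μ ξ I) :
    μ.map (fun ω i => ξ 0 i ω) = Measure.pi fun _ : Fin N => S.ρ₀ := by
  have hm : Measurable fun ω i => ξ 0 i ω := measurable_pi_iff.mpr fun i => hFP.measurable_ξ 0 i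
  refine (Measure.pi_eq fun B hB => ?_).symm
  rw [Measure.map_apply hm (MeasurableSet.univ_pi hB), ← hFP.law_zero B hB]
  congr 1; ext ω; simp

/-- Only initial weights can vanish, on a null event; the later weight functions are positive
everywhere. -/
lemma IsForwardPass.ae_weight_pos (hFP : S.IsForwardPass T μ ξ I)
    (hA : S.Assumptions σm σp cm Bθ Bω) (hσm : 0 < σm) :
    ∀ᵐ ω ∂μ, ∀ t i, 0 < S.weight ξ I t i ω := by
  have hm : Measurable fun ω i => ξ 0 i ω := measurable_pi_iff.mpr fun i => hFP.measurable_ξ 0 i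
  have h1 : ∀ᵐ z ∂(Measure.pi fun _ : Fin N => S.ρ₀), ∀ i, 0 < S.dχ (z i) :=
    ae_all_iff.mpr fun i =>
      (measurePreserving_eval (fun _ : Fin N => S.ρ₀) i).quasiMeasurePreserving.ae hA.dχ_pos
  rw [← hFP.map_zero] at h1
  filter_upwards [ae_of_ae_map hm.aemeasurable h1] with ω hω t i
  rcases t with _ | t
  · exact mul_pos (hω i) (hA.g_pos 0 _)
  · exact hA.weightFun_pos hσm (by omega) _ _

lemma measurable_pi_instrumental (S : ParticleModel X) (t : ℕ) :
    Measurable fun y : (ℕ → Fin N → ℝ) × (ℕ → Fin N → X) =>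
      Measure.pi fun _ : Fin N => S.instrumental (t + 1) (y.1 t) (y.2 t) := by
  have := S.markov_P (t + 1) (by omega)
  have hfin : ∀ y : (ℕ → Fin N → ℝ) × (ℕ → Fin N → X),
      IsFiniteMeasure (S.instrumental (t + 1) (y.1 t) (y.2 t)) := fun y => by
    refine ⟨?_⟩
    simp only [instrumental, Measure.finsetSum_apply, Measure.smul_apply, measure_univ,
      smul_eq_mul, mul_one]
    exact ENNReal.sum_lt_top.mpr fun i _ => ENNReal.ofReal_lt_top
  have hθ : ∀ i, Measurable fun y : (ℕ → Fin N → ℝ) × (ℕ → Fin N → X) =>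
      y.1 t i * S.θ (t + 1) (y.2 t i) := fun i =>
    (by fun_prop : Measurable fun y : (ℕ → Fin N → ℝ) × (ℕ → Fin N → X) => y.1 t i).mul
      ((S.measurable_θ (t + 1)).comp (by fun_prop))
  have hins : ∀ B : Set (Fin N × X), MeasurableSet B →
      Measurable fun y : (ℕ → Fin N → ℝ) × (ℕ → Fin N → X) =>
        S.instrumental (t + 1) (y.1 t) (y.2 t) B := fun B hB => by
    simp only [instrumental, Measure.finsetSum_apply, Measure.smul_apply, smul_eq_mul]
    refine Finset.measurable_fun_sum _ fun i _ => ?_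
    refine (((hθ i).div (Finset.measurable_fun_sum _ fun j _ => hθ j)).ennreal_ofReal).mul ?_
    simp only [Measure.dirac_prod, Measure.map_apply measurable_prodMk_left hB]
    exact ((S.P (t + 1)).measurable_coe (measurable_prodMk_left hB)).comp (by fun_prop)
  refine Measurable.measure_of_isPiSystem generateFrom_pi.symm isPiSystem_pi ?_ ?_
  · rintro _ ⟨B, hB, rfl⟩
    simp only [Measure.pi_pi]
    exact Finset.measurable_fun_prod _ fun i _ => hins _ (hB i (Set.mem_univ i))
  · simp only [Measure.pi_univ]
    exact Finset.measurable_fun_prod _ fun i _ => hins _ MeasurableSet.univ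

/-- Integration of a functional of the past and of the new particles, by conditioning. -/
lemma IsForwardPass.lintegral_succ [IsProbabilityMeasure μ] (hFP : S.IsForwardPass T μ ξ I)
    (hA : S.Assumptions σm σp cm Bθ Bω) (hσm : 0 < σm) (hN : 1 ≤ N) [Nonempty X] {t : ℕ}
    (ht : t < T)
    {G : ((ℕ → Fin N → ℝ) × (ℕ → Fin N → X)) × (Fin N → Fin N × X) → ENNReal}
    (hG : Measurable G) :
    ∫⁻ ω, G (S.arrays ξ I t ω, fun i => (I (t + 1) i ω, ξ (t + 1) i ω)) ∂μ =
      ∫⁻ ω, ∫⁻ z, G (S.arrays ξ I t ω, z) ∂(Measure.pi fun _ : Fin N =>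
        S.instrumental (t + 1) (fun i => S.weight ξ I t i ω) (fun i => ξ t i ω)) ∂μ := by
  classical
  obtain ⟨x₀⟩ := ‹Nonempty X›
  set Y := S.arrays ξ I t with hY
  set Z : Ω → Fin N → Fin N × X := fun ω i => (I (t + 1) i ω, ξ (t + 1) i ω) with hZ
  have hYm : Measurable Y := hFP.measurable_arrays t
  have hZm : Measurable Z := measurable_pi_iff.mpr fun i =>
    (hFP.measurable_I _ _).prodMk (hFP.measurable_ξ _ _)
  have hgood : MeasurableSet {y : (ℕ → Fin N → ℝ) × (ℕ → Fin N → X) | ∀ j, 0 < y.1 t j} := by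
    have : {y : (ℕ → Fin N → ℝ) × (ℕ → Fin N → X) | ∀ j, 0 < y.1 t j} =
        ⋂ j, {y | 0 < y.1 t j} := by ext y; simp
    rw [this]
    exact MeasurableSet.iInter fun j => measurableSet_lt measurable_const (by fun_prop)
  -- The product of instrumental laws need not be a probability for bad weights; a Dirac mass there
  -- gives a Markov kernel and changes nothing almost surely.
  let κ : Kernel ((ℕ → Fin N → ℝ) × (ℕ → Fin N → X)) (Fin N → Fin N × X) :=
    ⟨fun y => if ∀ j, 0 < y.1 t j then
        Measure.pi fun _ : Fin N => S.instrumental (t + 1) (y.1 t) (y.2 t)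
      else Measure.dirac fun i => (i, x₀),
      Measurable.ite hgood (measurable_pi_instrumental S t) measurable_const⟩
  have hκ : ∀ y, κ y = if ∀ j, 0 < y.1 t j then
        Measure.pi fun _ : Fin N => S.instrumental (t + 1) (y.1 t) (y.2 t)
      else Measure.dirac fun i => (i, x₀) := fun y => rfl
  have hκM : IsMarkovKernel κ := ⟨fun y => by
    rw [hκ]
    split_ifs with h
    · have := hA.isProbabilityMeasure_instrumental hN (Nat.le_add_left 1 t) h (y.2 t)
      infer_instance
    · infer_instance⟩
  have hae : ∀ᵐ ω ∂μ, κ (Y ω) = Measure.pi fun _ : Fin N =>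
      S.instrumental (t + 1) (fun i => S.weight ξ I t i ω) (fun i => ξ t i ω) := by
    filter_upwards [hFP.ae_weight_pos hA hσm] with ω hω
    have h1 : ∀ j, 0 < (Y ω).1 t j := fun j => by simpa [hY, arrays] using hω t j
    rw [hκ, if_pos h1]
    simp [hY, arrays]
  have hjoint : μ.map (fun ω => (Y ω, Z ω)) = (μ.map Y) ⊗ₘ κ := by
    have : IsProbabilityMeasure (μ.map Y) := Measure.isProbabilityMeasure_map hYm.aemeasurable
    have : IsProbabilityMeasure (μ.map fun ω => (Y ω, Z ω)) :=
      Measure.isProbabilityMeasure_map (hYm.prodMk hZm).aemeasurable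
    refine Measure.ext_prod fun {A} {C} hA' hC => ?_
    rw [Measure.map_apply (hYm.prodMk hZm) (hA'.prod hC), Measure.compProd_apply_prod hA' hC,
      setLIntegral_map hA' (κ.measurable_coe hC) hYm]
    have hκY : Measurable fun ω => κ (Y ω) := κ.measurable.comp hYm
    -- For a fixed event of the past, `law_succ` gives equality on boxes, a generating π-system.
    have e : (μ.restrict (Y ⁻¹' A)).map Z = (μ.restrict (Y ⁻¹' A)).bind fun ω => κ (Y ω) := by
      refine ext_of_generate_finite _ generateFrom_pi.symm isPiSystem_pi ?_ ?_
      · rintro _ ⟨B, hB, rfl⟩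
        have hB' : ∀ i, MeasurableSet (B i) := fun i => hB i (Set.mem_univ i)
        rw [Measure.map_apply hZm (MeasurableSet.univ_pi hB'),
          Measure.bind_apply (MeasurableSet.univ_pi hB') hκY.aemeasurable,
          Measure.restrict_apply (hZm (MeasurableSet.univ_pi hB'))]
        have h2 := hFP.law_succ t ht (Y ⁻¹' A) (measurable_arrays_history t hA') B hB'
        have h3 : Z ⁻¹' Set.univ.pi B ∩ Y ⁻¹' A =
            Y ⁻¹' A ∩ {ω | ∀ i, (I (t + 1) i ω, ξ (t + 1) i ω) ∈ B i} := by
          rw [Set.inter_comm]; ext ω; simp [hZ]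
        rw [h3, h2]
        refine lintegral_congr_ae (ae_restrict_of_ae ?_)
        filter_upwards [hae, hFP.ae_weight_pos hA hσm] with ω hω hω'
        have := hA.isProbabilityMeasure_instrumental hN (Nat.le_add_left 1 t) (hω' t)
          (fun i => ξ t i ω)
        rw [hω, Measure.pi_pi]
      · rw [Measure.map_apply hZm MeasurableSet.univ,
          Measure.bind_apply MeasurableSet.univ hκY.aemeasurable]
        simp
    have e2 := congrArg (fun m => m C) e
    rw [Measure.map_apply hZm hC, Measure.bind_apply hC hκY.aemeasurable,
      Measure.restrict_apply (hZm hC)] at e2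
    rw [← e2, Set.inter_comm]
    rfl
  have h1 : ∫⁻ ω, G (Y ω, Z ω) ∂μ = ∫⁻ p, G p ∂(μ.map fun ω => (Y ω, Z ω)) :=
    (lintegral_map hG (hYm.prodMk hZm)).symm
  have : IsProbabilityMeasure (μ.map Y) := Measure.isProbabilityMeasure_map hYm.aemeasurable
  rw [h1, hjoint, Measure.lintegral_compProd hG, lintegral_map hG.lintegral_kernel_prod_right' hYm]
  refine lintegral_congr_ae ?_
  filter_upwards [hae] with ω hω
  rw [hω]

lemma IsForwardPass.measurable_particles (hFP : S.IsForwardPass T μ ξ I) :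
    Measurable fun ω => ((fun s i => S.weight ξ I s i ω, fun s i => ξ s i ω) :
      (ℕ → Fin N → ℝ) × (ℕ → Fin N → X)) := by
  refine Measurable.prodMk ?_ ?_
  · exact measurable_pi_iff.mpr fun _ => measurable_pi_iff.mpr fun _ => hFP.measurable_weight _ _
  · exact measurable_pi_iff.mpr fun _ => measurable_pi_iff.mpr fun _ => hFP.measurable_ξ _ _

lemma IsForwardPass.measurable_hybrid (hFP : S.IsForwardPass T μ ξ I) {F : (ℕ → X) → ℝ}
    (hF : Measurable F) (t : ℕ) : Measurable fun ω =>
      S.hybrid T F t (fun s i => S.weight ξ I s i ω) (fun s i => ξ s i ω) :=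
  (ParticleModel.measurable_hybrid hF T t).comp hFP.measurable_particles

/-- Successive conditioning: each generation multiplies the exponential moment by a deterministic
factor. -/
lemma IsForwardPass.lintegral_exp_hybrid_le [IsProbabilityMeasure μ]
    (hFP : S.IsForwardPass T μ ξ I) (hA : S.Assumptions σm σp cm Bθ Bω) (hσm : 0 < σm)
    (hcm : 0 < cm) (hBθ : 1 ≤ Bθ) (hN : 1 ≤ N) [Nonempty X] {r : ℕ}
    {h : ℕ → (Fin (r + 1) → X) → ℝ} (hh : ∀ s ∈ Finset.Icc r T, BddMeas (h s)) (l : ℝ) (t : ℕ) :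
    t ≤ T →
    ∫⁻ ω, ENNReal.ofReal (Real.exp (l *
        (S.hybrid T (fun p => ∑ s ∈ Finset.Icc r T, window r h s p) t
          (fun s i => S.weight ξ I s i ω) (fun s i => ξ s i ω) -
        S.smooth T (additiveFunctional T r h)))) ∂μ ≤
      ENNReal.ofReal (Real.exp (128 * (Bω / (σm / σp)) ^ 2 / (σm / σp * cm / Bθ) ^ 2 *
        (∑ s ∈ Finset.range (t + 1),
          ((l * decayBound (1 - σm / σp) T r (fun s => osc (h s)) s) ^ 2 +
          |l * decayBound (1 - σm / σp) T r (fun s => osc (h s)) s|)) / N)) := by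
  set F : (ℕ → X) → ℝ := fun p => ∑ s ∈ Finset.Icc r T, window r h s p with hFdef
  have hF : BddMeas F := BddMeas.sum fun s hs => bddMeas_window (hh s hs)
  set Φ := S.smooth T (additiveFunctional T r h) with hΦ
  set K := 128 * (Bω / (σm / σp)) ^ 2 / (σm / σp * cm / Bθ) ^ 2 with hK
  set b := decayBound (1 - σm / σp) T r (fun s => osc (h s)) with hb
  have hσp : 0 < σp := by
    obtain ⟨x₀⟩ := ‹Nonempty X›
    exact hσm.trans_le ((hA.mixing x₀ x₀).1.trans (hA.mixing x₀ x₀).2)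
  induction t with
  | zero =>
    intro _
    let y : (Fin N → X) → (ℕ → Fin N → ℝ) × (ℕ → Fin N → X) := fun z =>
      (fun _ i => S.weightFun₀ (z i), fun _ => z)
    have hwm : Measurable S.weightFun₀ := S.measurable_dχ.mul (S.measurable_g 0)
    have hym : Measurable y := by
      refine Measurable.prodMk ?_ ?_
      · exact measurable_pi_iff.mpr fun _ => measurable_pi_iff.mpr fun i =>
          hwm.comp (measurable_pi_apply i)
      · exact measurable_pi_iff.mpr fun _ => measurable_id
    have key := hA.lintegral_exp_hybrid_zero_le hσm hcm hN hh (y := y) (fun _ _ => rfl)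
      (fun _ => rfl) l
    rw [← hFP.map_zero, lintegral_map _ (measurable_pi_iff.mpr fun i => hFP.measurable_ξ 0 i)] at key
    · rw [Finset.sum_range_one]
      refine le_trans (le_of_eq ?_) (key.trans (ENNReal.ofReal_le_ofReal (Real.exp_le_exp.mpr ?_)))
      · rfl
      -- The initial step involves no adjustment multiplier; Bθ ≥ 1 makes the constant of the later
      -- steps cover it.
      · have h1 : σm / σp * cm / Bθ ≤ σm / σp * cm := div_le_self (by positivity) hBθ
        have h2 : 0 < Bθ := by linarith
        simp only [hK, hb]
        gcongr
    · exact ((((ParticleModel.measurable_hybrid hF.meas T 0).comp hym).sub_const Φ).const_mul l).exp.ennreal_ofReal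
  | succ t ih =>
    intro ht
    have ih' := ih (by omega)
    let G : ((ℕ → Fin N → ℝ) × (ℕ → Fin N → X)) × (Fin N → Fin N × X) → ENNReal := fun z =>
      ENNReal.ofReal (Real.exp (l * (S.hybrid T F (t + 1) (S.stepArrays t z.1 z.2).1
        (S.stepArrays t z.1 z.2).2 - Φ)))
    have hG : Measurable G :=
      ((((ParticleModel.measurable_hybrid hF.meas T (t + 1)).comp
        (measurable_stepArrays t)).sub_const Φ).const_mul l).exp.ennreal_ofReal
    have e1 : ∀ ω, ENNReal.ofReal (Real.exp (l * (S.hybrid T F (t + 1)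
        (fun s i => S.weight ξ I s i ω) (fun s i => ξ s i ω) - Φ))) =
        G (S.arrays ξ I t ω, fun i => (I (t + 1) i ω, ξ (t + 1) i ω)) := fun ω => by
      simp only [G]
      rw [hybrid_congr F (t + 1) (stepArrays_arrays t ω).1 (stepArrays_arrays t ω).2]
    simp_rw [e1]
    rw [hFP.lintegral_succ hA hσm hN (by omega) hG]
    set c := Real.exp (K * ((l * b (t + 1)) ^ 2 + |l * b (t + 1)|) / N) with hc
    have e2 : ∀ᵐ ω ∂μ, ∫⁻ z, G (S.arrays ξ I t ω, z) ∂(Measure.pi fun _ : Fin N =>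
        S.instrumental (t + 1) (fun i => S.weight ξ I t i ω) (fun i => ξ t i ω)) ≤
        ENNReal.ofReal (Real.exp (l * (S.hybrid T F t
          (fun s i => S.weight ξ I s i ω) (fun s i => ξ s i ω) - Φ))) * ENNReal.ofReal c := by
      filter_upwards [hFP.ae_weight_pos hA hσm] with ω hω
      have key := hA.lintegral_exp_hybrid_succ_le hσm hcm hN hh (t := t) (by omega)
        (w := (S.arrays ξ I t ω).1) (x := (S.arrays ξ I t ω).2)
        (fun s _ j => by simpa [arrays] using hω _ j) l
      have e3 : S.hybrid T F t (S.arrays ξ I t ω).1 (S.arrays ξ I t ω).2 =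
          S.hybrid T F t (fun s i => S.weight ξ I s i ω) (fun s i => ξ s i ω) :=
        hybrid_congr F t (fun s hs => by simp [arrays, min_eq_left hs])
          fun s hs => by simp [arrays, min_eq_left hs]
      rw [← hFdef, e3] at key
      have e4 : (S.arrays ξ I t ω).1 t = fun i => S.weight ξ I t i ω := by simp [arrays]
      have e5 : (S.arrays ξ I t ω).2 t = fun i => ξ t i ω := by simp [arrays]
      rw [e4, e5] at key
      refine le_trans (le_of_eq ?_) (mul_le_mul_right key _)
      rw [← lintegral_const_mul' _ _ ENNReal.ofReal_ne_top]
      congr 1; ext z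
      rw [← ENNReal.ofReal_mul (Real.exp_pos _).le, ← Real.exp_add]
      simp only [G]
      congr 2; ring
    refine (lintegral_mono_ae e2).trans ?_
    rw [lintegral_mul_const' _ _ ENNReal.ofReal_ne_top]
    refine (mul_le_mul_left ih' _).trans (le_of_eq ?_)
    rw [← ENNReal.ofReal_mul (Real.exp_pos _).le, hc, ← Real.exp_add,
      Finset.sum_range_succ _ (t + 1)]
    congr 2; ring

end System

end ParticleModel

/-! ### Backward simulation, conditionally on the particles. -/

namespace ParticleModel

variable {X : Type u} [MeasurableSpace X]

section BackwardSimulation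

variable {N : ℕ} {S : ParticleModel X} {σm σp cm Bθ Bω : ℝ}
  {Ω : Type v} [MeasurableSpace Ω] {μ : Measure Ω} {T : ℕ}
  {ξ : ℕ → Fin N → Ω → X} {I : ℕ → Fin N → Ω → Fin N} {J : Fin N → Ω → Fin (T + 1) → Fin N}

lemma measurable_pathProb (S : ParticleModel X) (T : ℕ) (j : Fin (T + 1) → Fin N) :
    Measurable fun y : (ℕ → Fin N → ℝ) × (ℕ → Fin N → X) => S.pathProb T y.1 y.2 j := by
  have h1 : ∀ i, Measurable fun y : (ℕ → Fin N → ℝ) × (ℕ → Fin N → X) => y.1 T i := fun i => by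
    fun_prop
  refine ((h1 _).div (Finset.measurable_fun_sum _ fun i _ => h1 i)).mul
    (Finset.measurable_fun_prod _ fun u _ => ?_)
  exact (measurable_backWeight (S := S) u (j u.castSucc)).comp
    (f := fun y : (ℕ → Fin N → ℝ) × (ℕ → Fin N → X) => (y, y.2 (u + 1) (j u.succ))) (by fun_prop)

lemma pathProb_nonneg (S : ParticleModel X)
    {w : ℕ → Fin N → ℝ} (hw : ∀ s i, 0 < w s i) (x : ℕ → Fin N → X) (j : Fin (T + 1) → Fin N) :
    0 ≤ S.pathProb T w x j := by
  have h0 : ∀ s i, 0 ≤ w s i := fun s i => (hw s i).le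
  refine mul_nonneg (div_nonneg (h0 _ _) (Finset.sum_nonneg fun i _ => h0 _ _))
    (Finset.prod_nonneg fun u _ => div_nonneg (mul_nonneg (h0 _ _) (S.m_nonneg _ _))
      (Finset.sum_nonneg fun i _ => mul_nonneg (h0 _ _) (S.m_nonneg _ _)))

/-- The exponential moments of an additive functional under the law of the index paths. -/
lemma Assumptions.ffbs_exp_le (hA : S.Assumptions σm σp cm Bθ Bω) (hσm : 0 < σm)
    (hσp : σm < σp) (hcm : 0 < cm) (hN : 1 ≤ N) [Nonempty X] {r : ℕ}
    {h : ℕ → (Fin (r + 1) → X) → ℝ} (hh : ∀ s ∈ Finset.Icc r T, BddMeas (h s))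
    {w : ℕ → Fin N → ℝ} (hw : ∀ s i, 0 < w s i) (x : ℕ → Fin N → X) (l : ℝ) :
    S.ffbs T w x (fun p => Real.exp (l * additiveFunctional T r h p)) ≤
      Real.exp (l * S.ffbs T w x (additiveFunctional T r h) + l ^ 2 *
        ∑ t ∈ Finset.range (T + 1),
          decayBound (1 - σm / σp) T r (fun s => osc (h s)) t ^ 2) := by
  simp only [ffbs_eq_back, additiveFunctional_eq_sum_window]
  set F : (ℕ → X) → ℝ := fun p => ∑ s ∈ Finset.Icc r T, window r h s p with hFdef
  set b := decayBound (1 - σm / σp) T r (fun s => osc (h s)) with hb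
  have hsum : 0 < ∑ i, w T i := Finset.sum_pos (fun i _ => hw T i) ⟨⟨0, hN⟩, Finset.mem_univ _⟩
  -- The index at time T is drawn from the weights alone and closes the chain of backward draws; at
  -- t = T the forward integration is void.
  have hosc : OscLE (S.back w x T F) (b T) := by
    have h1 := hA.oscLE_back_fwd (x := x) hσm hcm hN hh le_rfl (fun s _ j => hw s j)
    have h2 : S.fwd F T (T - T) = F := by
      ext p; simp [fwd, iterInt]
    rwa [← hFdef, h2] at h1
  have h1 : ∀ i, w T i / (∑ l, w T l) * S.back w x T (fun p => Real.exp (l * F p)) (fun _ => x T i) ≤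
      Real.exp (l ^ 2 * ∑ t ∈ Finset.range T, b t ^ 2) * (w T i / (∑ l, w T l) *
        Real.exp (l * S.back w x T F fun _ => x T i)) := fun i => by
    refine (mul_le_mul_of_nonneg_left (hA.back_exp_le hσm hN (b := b) l T (fun s _ j => hw s j)
      (fun s _ p => hA.oscLE_back_update hσm hσp hN hh (fun s _ j => hw s j) p) _)
      (div_pos (hw T i) hsum).le).trans (le_of_eq ?_)
    rw [Real.exp_add]; ring
  refine (Finset.sum_le_sum fun i _ => h1 i).trans ?_
  rw [← Finset.mul_sum]
  refine (mul_le_mul_of_nonneg_left (sum_mul_exp_le (fun i => (div_pos (hw T i) hsum).le)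
    (by rw [← Finset.sum_div, div_self hsum.ne']) (hosc.comp fun i => (fun _ => x T i)) l)
    (Real.exp_pos _).le).trans (le_of_eq ?_)
  rw [← Real.exp_add, Finset.sum_range_succ]
  congr 1; ring

lemma IsBackwardSimulation.measurableSet_eq (hBS : S.IsBackwardSimulation T μ ξ I J)
    (j : Fin N → Fin (T + 1) → Fin N) : MeasurableSet {ω | ∀ i, J i ω = j i} := by
  have : {ω | ∀ i, J i ω = j i} = ⋂ i, J i ⁻¹' {j i} := by ext ω; simp
  rw [this]
  exact MeasurableSet.iInter fun i => hBS.measurable_J i (measurableSet_singleton _)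

/-- On events of the past, restriction to a given family of paths and weighting by its conditional
probability are the same measure, so both have the same image under the arrays. -/
lemma IsBackwardSimulation.setLIntegral_eq (hBS : S.IsBackwardSimulation T μ ξ I J)
    (hFP : S.IsForwardPass T μ ξ I) (j : Fin N → Fin (T + 1) → Fin N)
    {H : (ℕ → Fin N → ℝ) × (ℕ → Fin N → X) → ENNReal} (hH : Measurable H) :
    ∫⁻ ω in {ω | ∀ i, J i ω = j i}, H (S.arrays ξ I T ω) ∂μ =
      ∫⁻ ω, (∏ i, ENNReal.ofReal (S.pathProb T (fun s i => S.weight ξ I s i ω)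
        (fun s i => ξ s i ω) (j i))) * H (S.arrays ξ I T ω) ∂μ := by
  have hm := hFP.measurable_arrays T
  set D : Ω → ENNReal := fun ω => ∏ i, ENNReal.ofReal (S.pathProb T
    (fun s i => S.weight ξ I s i ω) (fun s i => ξ s i ω) (j i)) with hD
  have hfull := hFP.measurable_particles
  have hDm : Measurable D := Finset.measurable_fun_prod _ fun i _ =>
    ((measurable_pathProb S T (j i)).comp hfull).ennreal_ofReal
  have e : (μ.restrict {ω | ∀ i, J i ω = j i}).map (S.arrays ξ I T) =
      (μ.withDensity D).map (S.arrays ξ I T) := by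
    ext A hA
    rw [Measure.map_apply hm hA, Measure.map_apply hm hA, Measure.restrict_apply (hm hA),
      withDensity_apply _ (hm hA)]
    exact hBS.law _ (measurable_arrays_history T hA) j
  rw [← lintegral_map hH hm, e, lintegral_map hH hm]
  exact lintegral_withDensity_eq_lintegral_mul _ hDm (hH.comp hm)

/-- Given the particles, the N paths are i.i.d., so the moment at l is the N-th power of a one-path
moment at l/N. By `ffbs_exp_le` each path costs (l/N)²V, and the N means add up to l times the FFBS
estimator. -/
lemma lintegral_exp_ffbsi_le [IsProbabilityMeasure μ] (hBS : S.IsBackwardSimulation T μ ξ I J)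
    (hFP : S.IsForwardPass T μ ξ I) (hA : S.Assumptions σm σp cm Bθ Bω) (hσm : 0 < σm)
    (hσp : σm < σp) (hcm : 0 < cm) (hN : 1 ≤ N) [Nonempty X] {r : ℕ}
    {h : ℕ → (Fin (r + 1) → X) → ℝ} (hh : ∀ s ∈ Finset.Icc r T, BddMeas (h s)) (l φ : ℝ) :
    ∫⁻ ω, ENNReal.ofReal (Real.exp (l *
        (ffbsiEstimator T ξ J (additiveFunctional T r h) ω - φ))) ∂μ ≤
      ENNReal.ofReal (Real.exp (l ^ 2 * (∑ t ∈ Finset.range (T + 1),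
          decayBound (1 - σm / σp) T r (fun s => osc (h s)) t ^ 2) / N)) *
      ∫⁻ ω, ENNReal.ofReal (Real.exp (l *
        (S.ffbsEstimator T ξ I (additiveFunctional T r h) ω - φ))) ∂μ := by
  have hNpos : (0 : ℝ) < N := by exact_mod_cast hN
  set V := ∑ t ∈ Finset.range (T + 1), decayBound (1 - σm / σp) T r (fun s => osc (h s)) t ^ 2
    with hV
  set F : (Fin (T + 1) → X) → ℝ := additiveFunctional T r h with hF
  have hFm : Measurable fun p : ℕ → X => F fun u => p u := by
    simp_rw [hF, additiveFunctional_eq_sum_window]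
    exact (BddMeas.sum fun s hs => bddMeas_window (hh s hs)).meas
  let H : (Fin N → Fin (T + 1) → Fin N) → (ℕ → Fin N → ℝ) × (ℕ → Fin N → X) → ENNReal :=
    fun j y => ENNReal.ofReal (Real.exp (l * ((N : ℝ)⁻¹ * ∑ i, F (fun u => y.2 u (j i u)) - φ)))
  have hHm : ∀ j, Measurable (H j) := fun j => by
    have h1 : ∀ i, Measurable fun y : (ℕ → Fin N → ℝ) × (ℕ → Fin N → X) =>
        F fun u => y.2 u (j i u) := fun i => by
      have : Measurable fun y : (ℕ → Fin N → ℝ) × (ℕ → Fin N → X) =>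
          fun u : ℕ => y.2 u (if hu : u < T + 1 then j i ⟨u, hu⟩ else ⟨0, hN⟩) := by fun_prop
      have h2 := hFm.comp this
      refine (congrArg Measurable (funext fun y => ?_)).mp h2
      simp only [Function.comp, Fin.is_lt, dite_true]
    exact ((((Finset.measurable_fun_sum _ fun i _ => h1 i).const_mul _).sub_const φ).const_mul
      l).exp.ennreal_ofReal
  -- The finitely many values of the family of index paths partition the space.
  have hpart : ∀ f : Ω → ENNReal, ∫⁻ ω, f ω ∂μ =
      ∑ j : Fin N → Fin (T + 1) → Fin N, ∫⁻ ω in {ω | ∀ i, J i ω = j i}, f ω ∂μ := fun f => by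
    rw [← lintegral_biUnion_finset (fun j _ j' _ hjj' => ?_) fun j _ => hBS.measurableSet_eq j]
    · have : (⋃ j ∈ (Finset.univ : Finset (Fin N → Fin (T + 1) → Fin N)),
          {ω | ∀ i, J i ω = j i}) = Set.univ := by
        refine Set.eq_univ_of_forall fun ω => ?_
        simp only [Set.mem_iUnion]
        exact ⟨fun i => J i ω, Finset.mem_univ _, fun i => rfl⟩
      rw [this, Measure.restrict_univ]
    · refine Set.disjoint_left.mpr fun ω h1 h2 => hjj' (funext fun i => ?_)
      exact (h1 i).symm.trans (h2 i)
  rw [hpart]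
  have e1 : ∀ j : Fin N → Fin (T + 1) → Fin N,
      ∫⁻ ω in {ω | ∀ i, J i ω = j i}, ENNReal.ofReal (Real.exp (l *
        (ffbsiEstimator T ξ J F ω - φ))) ∂μ =
      ∫⁻ ω, (∏ i, ENNReal.ofReal (S.pathProb T (fun s i => S.weight ξ I s i ω)
        (fun s i => ξ s i ω) (j i))) * H j (S.arrays ξ I T ω) ∂μ := fun j => by
    rw [← hBS.setLIntegral_eq hFP j (hHm j)]
    refine setLIntegral_congr_fun (hBS.measurableSet_eq j) fun ω hω => ?_
    have hω' : ∀ i, J i ω = j i := hω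
    have h2 : ∀ u : Fin (T + 1), min (u : ℕ) T = u := fun u => by omega
    simp only [H, ffbsiEstimator, arrays, hω', h2]
  simp_rw [e1]
  have hfull := hFP.measurable_particles
  have hterm_meas : ∀ j : Fin N → Fin (T + 1) → Fin N, Measurable fun ω =>
      (∏ i, ENNReal.ofReal (S.pathProb T (fun s i => S.weight ξ I s i ω)
        (fun s i => ξ s i ω) (j i))) * H j (S.arrays ξ I T ω) := fun j => (Finset.measurable_fun_prod _ fun i _ =>
    ((measurable_pathProb S T (j i)).comp hfull).ennreal_ofReal).mul
      ((hHm j).comp (hFP.measurable_arrays T))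
  rw [← lintegral_finsetSum _ fun j _ => hterm_meas j, ← lintegral_const_mul' _ _ ENNReal.ofReal_ne_top]
  refine lintegral_mono_ae ?_
  filter_upwards [hFP.ae_weight_pos hA hσm] with ω hω
  set w : ℕ → Fin N → ℝ := fun s i => S.weight ξ I s i ω with hw
  set x : ℕ → Fin N → X := fun s i => ξ s i ω with hx
  have hp0 : ∀ j, 0 ≤ S.pathProb T w x j := fun j => pathProb_nonneg S hω x j
  have hterm : ∀ j : Fin N → Fin (T + 1) → Fin N,
      (∏ i, ENNReal.ofReal (S.pathProb T w x (j i))) * H j (S.arrays ξ I T ω) =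
      ENNReal.ofReal (Real.exp (-(l * φ)) * ∏ i, (S.pathProb T w x (j i) *
        Real.exp (l / N * F fun u => x u (j i u)))) := fun j => by
    have h2 : ∀ u : Fin (T + 1), min (u : ℕ) T = u := fun u => by omega
    rw [← ENNReal.ofReal_prod_of_nonneg fun i _ => hp0 _]
    simp only [H, arrays, h2]
    rw [← ENNReal.ofReal_mul (Finset.prod_nonneg fun i _ => hp0 _), Finset.prod_mul_distrib,
      ← Real.exp_sum, ← Finset.mul_sum, mul_left_comm, ← Real.exp_add]
    congr 3
    simp only [hx]
    ring
  simp_rw [hterm]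
  rw [← ENNReal.ofReal_sum_of_nonneg fun j _ => mul_nonneg (Real.exp_pos _).le
    (Finset.prod_nonneg fun i _ => mul_nonneg (hp0 _) (Real.exp_pos _).le), ← Finset.mul_sum,
    ← ENNReal.ofReal_mul (Real.exp_pos _).le]
  refine ENNReal.ofReal_le_ofReal ?_
  have hpow : ∑ j : Fin N → Fin (T + 1) → Fin N, ∏ i, (S.pathProb T w x (j i) *
        Real.exp (l / N * F fun u => x u (j i u))) =
      S.ffbs T w x (fun p => Real.exp (l / N * F p)) ^ N := by
    have := Finset.prod_univ_sum (fun _ : Fin N => (Finset.univ : Finset (Fin (T + 1) → Fin N)))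
      (fun _ j => S.pathProb T w x j * Real.exp (l / N * F fun u => x u (j u)))
    rw [Fintype.piFinset_univ] at this
    rw [← this]
    simp [ffbs]
  rw [hpow]
  have hle := hA.ffbs_exp_le hσm hσp hcm hN hh hω x (l / N)
  rw [← hF, ← hV] at hle
  have hnn : 0 ≤ S.ffbs T w x (fun p => Real.exp (l / N * F p)) :=
    Finset.sum_nonneg fun j _ => mul_nonneg (hp0 j) (Real.exp_pos _).le
  refine (mul_le_mul_of_nonneg_left (pow_le_pow_left₀ hnn hle N) (Real.exp_pos _).le).trans
    (le_of_eq ?_)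
  rw [← Real.exp_nat_mul, ← Real.exp_add, ← Real.exp_add]
  congr 1
  simp only [ffbsEstimator, hx]
  field_simp
  ring

end BackwardSimulation

lemma Assumptions.mono {S : ParticleModel X} {σm σp cm Bθ Bω Bθ' Bω' : ℝ}
    (hA : S.Assumptions σm σp cm Bθ Bω) (hθ : Bθ ≤ Bθ') (hω : Bω ≤ Bω') :
    S.Assumptions σm σp cm Bθ' Bω' :=
  { hA with
    θ_le := fun t ht x => (hA.θ_le t ht x).trans hθ
    weight_zero_le := fun x => (hA.weight_zero_le x).trans hω
    weight_succ_le := fun t ht x x' => (hA.weight_succ_le t ht x x').trans hω }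

end ParticleModel

/-! ### The deviation inequalities. -/

theorem theorem2 (σm σp cm Bθ Bω : ℝ) (hσm : 0 < σm) (hσ : σm < σp) (hcm : 0 < cm) :
    ∃ C : ℝ, 0 < C ∧
      ∀ (X : Type u) [MeasurableSpace X] [MeasurableSpace.CountablyGenerated X]
        (S : ParticleModel X), S.Assumptions σm σp cm Bθ Bω →
      ∀ (T N : ℕ), 1 ≤ N → ∀ (ε : ℝ), 0 < ε →
      ∀ (r : ℕ) (h : ℕ → (Fin (r + 1) → X) → ℝ),
        (∀ s ∈ Finset.Icc r T, Measurable (h s)) →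
        (∀ s ∈ Finset.Icc r T, ∃ K : ℝ, ∀ z, |h s z| ≤ K) →
      ∀ (Ω : Type v) [MeasurableSpace Ω] (μ : Measure Ω) [IsProbabilityMeasure μ]
        (ξ : ℕ → Fin N → Ω → X) (I : ℕ → Fin N → Ω → Fin N), S.IsForwardPass T μ ξ I →
        μ.real {ω | ε < |S.smooth T (additiveFunctional T r h) -
              S.ffbsEstimator T ξ I (additiveFunctional T r h) ω|} ≤
            2 * Real.exp (-(C * N * ε ^ 2 /
                (bigTheta r T * ∑ s ∈ Finset.Icc r T, osc (h s) ^ 2))) +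
              8 * Real.exp (-(C * N * ε /
                ((1 + (r : ℝ)) * ∑ s ∈ Finset.Icc r T, osc (h s)))) ∧
        ∀ J : Fin N → Ω → Fin (T + 1) → Fin N, S.IsBackwardSimulation T μ ξ I J →
          μ.real {ω | ε < |S.smooth T (additiveFunctional T r h) -
                ffbsiEstimator T ξ J (additiveFunctional T r h) ω|} ≤
              4 * Real.exp (-(C * N * ε ^ 2 /
                  (bigTheta r T * ∑ s ∈ Finset.Icc r T, osc (h s) ^ 2))) +
                8 * Real.exp (-(C * N * ε /
                  ((1 + (r : ℝ)) * ∑ s ∈ Finset.Icc r T, osc (h s)))) := by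
  have hσp : 0 < σp := hσm.trans hσ
  have hκ : 0 < σm / σp := div_pos hσm hσp
  set ρ := 1 - σm / σp with hρ
  have hρ0 : 0 ≤ ρ := sub_nonneg.mpr ((div_le_one hσp).mpr hσ.le)
  have hρ1 : ρ < 1 := by linarith
  set G := 1 + 2 / (1 - ρ) with hG
  have hGpos : 0 < G := by
    have : 0 < 1 - ρ := by linarith
    positivity
  set B' := max Bθ 1 with hB'
  have hB'1 : 1 ≤ B' := le_max_right _ _
  set K₀ := 128 * (Bω / (σm / σp)) ^ 2 / (σm / σp * cm / B') ^ 2 with hK₀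
  have hK₀0 : 0 ≤ K₀ := by positivity
  -- The additional 1 absorbs the term l²V/N of backward simulation, and makes K positive.
  set K := K₀ + 1 with hK
  have hKpos : 0 < K := by linarith
  refine ⟨1 / (16 * K * G ^ 2 + 2 * K * G), by positivity, ?_⟩
  intro X _ _ S hA₀ T N hN ε hε r h hmeas hbdd Ω _ μ _ ξ I hFP
  have hNpos : (0 : ℝ) < N := by exact_mod_cast hN
  have hA : S.Assumptions σm σp cm B' Bω := hA₀.mono (le_max_left _ _) le_rfl
  have hX : Nonempty X := by
    obtain ⟨ω⟩ := nonempty_of_isProbabilityMeasure μ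
    exact ⟨ξ 0 ⟨0, hN⟩ ω⟩
  have hh : ∀ s ∈ Finset.Icc r T, BddMeas (h s) := fun s hs => ⟨hmeas s hs, hbdd s hs⟩
  set b := decayBound ρ T r (fun s => osc (h s)) with hb
  have hb0 : ∀ t, 0 ≤ b t := decayBound_nonneg hρ0 T r fun s => osc_nonneg (h s)
  set v := bigTheta r T * ∑ s ∈ Finset.Icc r T, osc (h s) ^ 2 with hv
  set w := (1 + (r : ℝ)) * ∑ s ∈ Finset.Icc r T, osc (h s) with hw
  set V := ∑ t ∈ Finset.range (T + 1), b t ^ 2 with hV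
  have hV0 : 0 ≤ V := Finset.sum_nonneg fun t _ => sq_nonneg _
  have hVv : V ≤ G ^ 2 * v := by
    rcases le_or_gt r T with hrT | hrT
    · exact sum_decayBound_sq_le hρ0 hρ1 hrT fun s => osc (h s)
    · simp [hV, hb, hv, decayBound, Finset.Icc_eq_empty_of_lt hrT]
  have hBw : ∑ t ∈ Finset.range (T + 1), b t ≤ G * w :=
    sum_decayBound_le hρ0 hρ1 T r fun s => osc_nonneg (h s)
  -- `bigTheta` can be negative for r > T, so the sign is read off from 0 ≤ V ≤ G²v.
  have hv0 : 0 ≤ v := by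
    by_contra hneg
    have : G ^ 2 * v < 0 := mul_neg_of_pos_of_neg (by positivity) (not_le.mp hneg)
    linarith
  have hw0 : 0 ≤ w := mul_nonneg (by positivity) (Finset.sum_nonneg fun s _ => osc_nonneg (h s))
  set Φ := S.smooth T (additiveFunctional T r h) with hΦ
  have hFeq : (fun p : ℕ → X => additiveFunctional T r h fun u => p u) =
      fun p => ∑ s ∈ Finset.Icc r T, ParticleModel.window r h s p :=
    funext fun p => ParticleModel.additiveFunctional_eq_sum_window T r h p
  have hFB : BddMeas fun p : ℕ → X => ∑ s ∈ Finset.Icc r T, ParticleModel.window r h s p :=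
    BddMeas.sum fun s hs => ParticleModel.bddMeas_window (hh s hs)
  have hest : ∀ ω, S.ffbsEstimator T ξ I (additiveFunctional T r h) ω =
      S.hybrid T (fun p => ∑ s ∈ Finset.Icc r T, ParticleModel.window r h s p) T
        (fun s i => S.weight ξ I s i ω) (fun s i => ξ s i ω) := fun ω => by
    rw [ParticleModel.ffbsEstimator, ← ParticleModel.hybrid_last, hFeq]
  have hmf : Measurable fun ω => S.ffbsEstimator T ξ I (additiveFunctional T r h) ω := by
    simp_rw [hest]
    exact hFP.measurable_hybrid hFB.meas T
  have hexp : ∀ l : ℝ, ∫⁻ ω, ENNReal.ofReal (Real.exp (l *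
      (S.ffbsEstimator T ξ I (additiveFunctional T r h) ω - Φ))) ∂μ ≤
      ENNReal.ofReal (Real.exp (K₀ * (l ^ 2 * V + |l| * (G * w)) / N)) := fun l => by
    simp_rw [hest]
    refine (hFP.lintegral_exp_hybrid_le hA hσm hcm hB'1 hN hh l T le_rfl).trans
      (ENNReal.ofReal_le_ofReal (Real.exp_le_exp.mpr ?_))
    refine div_le_div_of_nonneg_right (mul_le_mul_of_nonneg_left ?_ hK₀0) hNpos.le
    rw [Finset.sum_add_distrib]
    refine add_le_add (le_of_eq ?_) ?_
    · rw [hV, Finset.mul_sum]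
      exact Finset.sum_congr rfl fun t _ => mul_pow _ _ _
    · refine le_trans (le_of_eq ?_) (mul_le_mul_of_nonneg_left hBw (abs_nonneg l))
      rw [Finset.mul_sum]
      exact Finset.sum_congr rfl fun t _ => by rw [abs_mul, abs_of_nonneg (hb0 t)]
  have hGw : ∀ l : ℝ, 0 ≤ |l| * (G * w) := fun l =>
    mul_nonneg (abs_nonneg l) (mul_nonneg hGpos.le hw0)
  have hlv : ∀ l : ℝ, l ^ 2 * V ≤ l ^ 2 * (G ^ 2 * v) := fun l =>
    mul_le_mul_of_nonneg_left hVv (sq_nonneg l)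
  have hlV : ∀ l : ℝ, 0 ≤ l ^ 2 * V := fun l => mul_nonneg (sq_nonneg l) hV0
  refine ⟨?_, fun J hBS => ?_⟩
  · simp_rw [abs_sub_comm Φ]
    refine deviation_of_lintegral_exp (hmf.sub_const Φ) hKpos hGpos hv0 hw0 hN hε fun l => ?_
    refine (hexp l).trans (ENNReal.ofReal_le_ofReal (Real.exp_le_exp.mpr ?_))
    refine div_le_div_of_nonneg_right ?_ hNpos.le
    nlinarith [hGw l, hlv l, hlV l]
  · have hmi : Measurable fun ω => ffbsiEstimator T ξ J (additiveFunctional T r h) ω := by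
      refine Measurable.const_mul (Finset.measurable_fun_sum _ fun i _ => ?_) _
      have h1 : Measurable fun ω => fun u : ℕ =>
          ξ u (if hu : u < T + 1 then J i ω ⟨u, hu⟩ else ⟨0, hN⟩) ω := by
        refine measurable_pi_iff.mpr fun u => ?_
        have h2 : Measurable fun ω => if hu : u < T + 1 then J i ω ⟨u, hu⟩ else (⟨0, hN⟩ : Fin N) := by
          by_cases hu : u < T + 1
          · simp only [hu, dite_true]
            exact (measurable_pi_apply _).comp (hBS.measurable_J i)
          · simp only [hu, dite_false]
            exact measurable_const
        exact (ParticleModel.measurable_eval_index N).comp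
          ((measurable_pi_iff.mpr fun j => hFP.measurable_ξ u j).prodMk h2)
      have h3 := hFB.meas.comp h1
      rw [← hFeq] at h3
      refine (congrArg Measurable (funext fun ω => ?_)).mp h3
      simp only [Function.comp, Fin.is_lt, dite_true]
    simp_rw [abs_sub_comm Φ]
    -- Both sources of error enter a single exponential moment, without a union bound, so even the
    -- factor 2 is obtained and is relaxed to 4.
    refine (deviation_of_lintegral_exp (hmi.sub_const Φ) hKpos hGpos hv0 hw0 hN hε fun l => ?_).trans
      (add_le_add (mul_le_mul_of_nonneg_right (by norm_num) (Real.exp_pos _).le) le_rfl)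
    refine (ParticleModel.lintegral_exp_ffbsi_le hBS hFP hA hσm hσ hcm hN hh l Φ).trans ?_
    refine (mul_le_mul_right (hexp l) _).trans ?_
    rw [← ENNReal.ofReal_mul (Real.exp_pos _).le, ← Real.exp_add, ← add_div]
    refine ENNReal.ofReal_le_ofReal (Real.exp_le_exp.mpr ?_)
    refine div_le_div_of_nonneg_right ?_ hNpos.le
    rw [← hρ, ← hb, ← hV]
    nlinarith [hGw l, hlv l, hlV l]
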